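/- **AdWords.** Let $A$ be a finite non-empty set of advertisers, each $a\in A$ with a budget $B_a>0$, and let impressions $i=1,\dots,n$ arrive one at a time with bids $0\le b_{ai}\le B_a$. Each impression is assigned on arrival to an advertiser. If advertiser $a$ receives the set $S_a$ of impressions, the objective is $\sum_a \min\{\sum_{i\in S_a}b_{ai},B_a\}$; $\mathrm{OPT}$ is its maximum over all assignments. **Basic online primal dual algorithm with parameter $\gamma$.** Put $\Delta x(1)=\frac12$ and $\Delta x(k)=2^{-k}(1-\gamma)^{k-2}(1+\gamma)$ for $k\ge2$; $\Delta\alpha(1)=\frac{3+\gamma}{6+3\gamma}\Delta x(1)$ and $\Delta\alpha(k)=\frac{1+\gamma}{2+\gamma}\Delta x(k)$ for $k\ge2$; $\Delta\beta(k)=\Delta x(k)-\Delta\alpha(k)$. For every $a$ maintain a function $k_a:[0,B_a)\to\{0,1,\dots,\infty\}$, initially $0$, and a point $y^*_a\in[0,B_a)$, initially $0$; let $Y_D=\{k_a=\infty\}$. When $i$ arrives, for each $a$ scan the circle obtained from $[0,B_a)$ by gluing its end points forward from $y^*_a$ until the scanned arc minus $Y_D$ has measure $b_{ai}$ (or once around,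 if $[0,B_a)\setminus Y_D$ has measure at most $b_{ai}$); let $Y_{ai}$ be the scanned arc minus $Y_D$, and put $$\Delta^R_a\beta_i=\int_{Y_{ai}}\Delta\beta(k_a(y)+1)\,dy,\qquad \Delta^D_a\beta_i=\int_{Y_{ai}}\sum_{\ell>k_a(y)}\Delta\beta(\ell)\,dy .$$ Let $a_1\neq a_2$ be two advertisers with the largest $\Delta^R_a\beta_i$ and let $a^*$ maximize $\Delta^D_a\beta_i$ (ties are broken arbitrarily). If $\Delta^R_{a_1}\beta_i+\Delta^R_{a_2}\beta_i\ge\Delta^D_{a^*}\beta_i$, the round is randomized: $i$ is semi-assigned to $(a_1,Y_{a_1i})$ and $(a_2,Y_{a_2i})$, $k_a$ is increased by $1$ on $Y_{ai}$ for $a=a_1,a_2$, and $i$ is assigned to the one of $a_1,a_2$ that the selection procedure below selects. Otherwise (in particular if $|A|=1$) the round is deterministic: $i$ is assigned to $a^*$, and $k_{a^*}$ is set to $\infty$ on $Y_{a^*i}$. For each advertiser to which $i$ was assigned or semi-assigned, $y^*_a$ moves to the end of the scanned arc. **Selection procedure (PanOCS for large bids, sender probability $p=\frac49$).** For randomized rounds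 $i'<i$, both semi-assigned to $a$ and with $b_{ai'},b_{ai}>B_a/2$, there is an arc $(i',i)_a$ if some $y\in Y_{ai'}\cap Y_{ai}$ lies in no $Y_{ai''}$ with $i'<i''<i$ and $i''$ semi-assigned to $a$. Each randomized round $i$ is, independently, a sender with probability $p$ and otherwise a receiver. A sender selects one of its two advertisers with a fresh fair bit and picks, uniformly at random, one of its four potential out-arcs (the first or the second out-arc with respect to one of its two advertisers). A receiver $i$ chooses uniformly one of its in-arcs $(i',i)_a$ that were picked by their sender $i'$, and selects $a$ if and only if $a$ was not selected in round $i'$; if there is no such in-arc, it selects with a fresh fair bit. **Theorem.** Let $\gamma=0.05144$ and $\Gamma=\frac{3+2\gamma}{6+3\gamma}$. Then $\Gamma>0.5041$. Moreover, on every AdWords instance in which every nonzero bid is large, i.e. $b_{ai}=0$ or $\frac12B_a<b_{ai}\le B_a$ for all $a,i$, the basic online primal dual algorithm with parameter $\gamma$ and the above selection procedure can always be carried out, and, however ties are broken, its expected objective is at least $\Gamma\cdot\mathrm{OPT}$. -/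

import Mathlib

open MeasureTheory
open scoped ENNReal NNReal

noncomputable section

/-- An AdWords instance with advertisers `A` and impressions `0, …, n - 1`, in order of arrival. -/
structure AdWords (A : Type*) (n : ℕ) where
  /-- `budget a` is `B_a` -/
  budget : A → ℝ
  /-- `bid i a` is `b_{ai}` -/
  bid : Fin n → A → ℝ
  budget_pos : ∀ a, 0 < budget a
  bid_nonneg : ∀ i a, 0 ≤ bid i a
  bid_le_budget : ∀ i a, bid i a ≤ budget a

/-- A decision of an oblivious semi-randomized algorithm for one impression: assign it to `a`
(deterministic round), or semi-assign it to `a₁` and `a₂` (randomized round). -/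
inductive AdWords.Decision (A : Type*) where
  | det (a : A) : AdWords.Decision A
  | rand (a₁ a₂ : A) : AdWords.Decision A

/-- The state variables: for every advertiser `a` the point `y^*` and the function `k_a`, where
`k_a(y) = ⊤` means that `y` has been assigned in a deterministic round. -/
structure AdWords.State (A : Type*) where
  start : A → ℝ
  k : A → ℝ → ℕ∞

namespace AdWords

variable {A : Type*} {n : ℕ}

/-! ### The offline problem -/

/-- Every nonzero bid is larger than half the budget. -/
def LargeBids (I : AdWords A n) : Prop :=
  ∀ i a, I.bid i a = 0 ∨ I.budget a / 2 < I.bid i a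

/-- The budget-additive payment `b_a(S)`. -/
def payment (I : AdWords A n) (a : A) (S : Finset (Fin n)) : ℝ :=
  min (∑ i ∈ S, I.bid i a) (I.budget a)

open Classical in
/-- The objective of the assignment of impressions to advertisers given by `f`. -/
def objective [Fintype A] (I : AdWords A n) (f : Fin n → A) : ℝ :=
  ∑ a, I.payment a (Finset.univ.filter fun i => f i = a)

/-- The offline optimum. -/
def opt [Fintype A] (I : AdWords A n) : ℝ :=
  ⨆ f : Fin n → A, I.objective f

/-! ### Panoramic interval-level assignment -/

/-- The length of the way from `y` forward to `z` on the circle obtained by gluing the end points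
of `[0, B)`. -/
def circDist (B y z : ℝ) : ℝ :=
  if y ≤ z then z - y else z - y + B

/-- The arc of length `t` of the circle `[0, B)` that starts at `y`. -/
def arc (B y t : ℝ) : Set ℝ :=
  {z | z ∈ Set.Ico 0 B ∧ circDist B y z < t}

open Classical in
/-- The length of the arc `[y, y ⊕_Y b)` of the circle `[0, B)`: the least length such that the arc,
excluding `Y`, has measure `b`, or the full circle if all of `[0, B) \ Y` has measure at
most `b`. -/
def scanLength (B y : ℝ) (Y : Set ℝ) (b : ℝ) : ℝ :=
  if volume.real (Set.Ico 0 B \ Y) ≤ b then B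
  else sInf {t | 0 ≤ t ∧ b ≤ volume.real (arc B y t \ Y)}

open Classical in
/-- The point `y ⊕_Y b` of `[0, B)`. It is `y` if all of `[0, B) \ Y` has measure at most `b`. -/
def oplus (B y : ℝ) (Y : Set ℝ) (b : ℝ) : ℝ :=
  if y + scanLength B y Y b < B then y + scanLength B y Y b
  else y + scanLength B y Y b - B

/-- The set `Y_D` of the points of `a` that have been assigned deterministically. -/
def State.detPoints (s : State A) (a : A) : Set ℝ :=
  {y | s.k a y = ⊤}

/-- `Y_{ai} = [y^*, y^* ⊕_{Y_D} b_{ai}) \ Y_D`, for an impression with bids `b` that arrives in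
state `s`. -/
def State.subset (s : State A) (I : AdWords A n) (b : A → ℝ) (a : A) : Set ℝ :=
  arc (I.budget a) (s.start a) (scanLength (I.budget a) (s.start a) (s.detPoints a) (b a)) \
    s.detPoints a

open Classical in
/-- The state after an impression with bids `b` has arrived in state `s` and has been treated
according to the decision `d`. -/
def State.step (s : State A) (I : AdWords A n) (b : A → ℝ) (d : Decision A) : State A where
  start a :=
    match d with
    | .det a' =>
        if a = a' then oplus (I.budget a) (s.start a) (s.detPoints a) (b a) else s.start a
    | .rand a₁ a₂ =>
        if a = a₁ ∨ a = a₂ then oplus (I.budget a) (s.start a) (s.detPoints a) (b a)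
        else s.start a
  k a y :=
    match d with
    | .det a' => if a = a' ∧ y ∈ s.subset I b a then ⊤ else s.k a y
    | .rand a₁ a₂ =>
        if (a = a₁ ∨ a = a₂) ∧ y ∈ s.subset I b a then s.k a y + 1 else s.k a y

/-- The state after the first `m` impressions, given the decisions `d`. -/
def stateAt (I : AdWords A n) (d : Fin n → Decision A) : ℕ → State A
  | 0 => ⟨fun _ => 0, fun _ _ => 0⟩
  | m + 1 =>
      if h : m < n then (stateAt I d m).step I (I.bid ⟨m, h⟩) (d ⟨m, h⟩) else stateAt I d m

/-- The subset `Y_{ai}` computed when impression `i` arrives, given the decisions `d`. -/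
def subsetAt (I : AdWords A n) (d : Fin n → Decision A) (i : Fin n) (a : A) : Set ℝ :=
  (stateAt I d i).subset I (I.bid i) a

/-! ### The basic online primal dual algorithm -/

/-- `Δx(k)`, `k ≥ 1`. -/
def deltaX (γ : ℝ) : ℕ → ℝ
  | 0 => 0
  | 1 => 1 / 2
  | k + 2 => (1 / 2) ^ (k + 2) * (1 - γ) ^ k * (1 + γ)

/-- The parameters `Δα(k)`, `k ≥ 1`, of the algorithm. -/
def deltaAlpha (γ : ℝ) : ℕ → ℝ
  | 0 => 0
  | 1 => (3 + γ) / (6 + 3 * γ) * deltaX γ 1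
  | k + 2 => (1 + γ) / (2 + γ) * deltaX γ (k + 2)

/-- `Δβ(k) = Δx(k) - Δα(k)`. -/
def deltaBeta (γ : ℝ) (k : ℕ) : ℝ :=
  deltaX γ k - deltaAlpha γ k

/-- `Δ_a^R β_i`, for an impression with bids `b` that arrives in state `s`. -/
def State.offerR (s : State A) (γ : ℝ) (I : AdWords A n) (b : A → ℝ) (a : A) : ℝ :=
  ∫ y in s.subset I b a, deltaBeta γ ((s.k a y).toNat + 1)

/-- `Δ_a^D β_i`, for an impression with bids `b` that arrives in state `s`; the inner sum runs over
all `ℓ > k_a(y)`. -/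
def State.offerD (s : State A) (γ : ℝ) (I : AdWords A n) (b : A → ℝ) (a : A) : ℝ :=
  ∫ y in s.subset I b a, ∑' j : ℕ, deltaBeta γ ((s.k a y).toNat + 1 + j)

/-- The decision `d` is one that the basic algorithm can take for an impression with bids `b` that
arrives in state `s`. In a randomized round, `a₁` and `a₂` are two distinct advertisers with the
largest `Δ_a^R β_i`, and the sum of these is at least the largest `Δ_a^D β_i`. In a deterministic
round, `a'` has the largest `Δ_a^D β_i`, which is greater than the sum of the two largest
`Δ_a^R β_i`. Ties may be broken in any way. -/
def IsBasicDecision (γ : ℝ) (I : AdWords A n) (s : State A) (b : A → ℝ) : Decision A → Prop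
  | .rand a₁ a₂ =>
      a₁ ≠ a₂ ∧
      (∀ a, a ≠ a₁ → a ≠ a₂ →
        s.offerR γ I b a ≤ s.offerR γ I b a₁ ∧ s.offerR γ I b a ≤ s.offerR γ I b a₂) ∧
      ∀ a, s.offerD γ I b a ≤ s.offerR γ I b a₁ + s.offerR γ I b a₂
  | .det a' =>
      (∀ a, s.offerD γ I b a ≤ s.offerD γ I b a') ∧
      ∀ a₁ a₂, a₁ ≠ a₂ → s.offerR γ I b a₁ + s.offerR γ I b a₂ < s.offerD γ I b a'

/-- `d` is the sequence of decisions in a run of the basic algorithm on the instance `I`. The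
decision for impression `i` depends only on the state before its arrival and on its bids. -/
def IsBasicRun (γ : ℝ) (I : AdWords A n) (d : Fin n → Decision A) : Prop :=
  ∀ i : Fin n, IsBasicDecision γ I (stateAt I d i) (I.bid i) (d i)

/-! ### Panoramic online correlated selection for large bids -/

/-- The round is randomized and semi-assigns its impression to `a`. -/
def Decision.SemiAssigns : Decision A → A → Prop
  | .det _, _ => False
  | .rand a₁ a₂, a => a = a₁ ∨ a = a₂

/-- The advertiser that gets the impression if the selection in a randomized round is the first
(`true`) or the second (`false`) of the two combinations. -/
def Decision.pick : Decision A → Bool → A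
  | .det a, _ => a
  | .rand a₁ a₂, c => if c then a₁ else a₂

/-- The impressions `i' < i` are adjacent with respect to the advertiser `a`. -/
def Adjacent (I : AdWords A n) (d : Fin n → Decision A) (i' i : Fin n) (a : A) : Prop :=
  i' < i ∧ (d i').SemiAssigns a ∧ (d i).SemiAssigns a ∧
  ∃ y, y ∈ subsetAt I d i' a ∧ y ∈ subsetAt I d i a ∧
    ∀ j, i' < j → j < i → (d j).SemiAssigns a → y ∉ subsetAt I d j a

/-- `(i', i)_a` is an arc of the ex-ante dependence graph `D`. -/
def IsArc (I : AdWords A n) (d : Fin n → Decision A) (i' i : Fin n) (a : A) : Prop :=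
  Adjacent I d i' i a ∧ I.budget a / 2 < I.bid i' a ∧ I.budget a / 2 < I.bid i a

/-- The random outcome of a round. The first component is `none` for a receiver, and `some (c, j)`
for a sender who picks its first (`j = 0`) or second (`j = 1`) out-arc with respect to the first
(`c = true`) or second (`c = false`) of its two advertisers. The second component is the selection:
the first (`true`) or the second (`false`) combination. -/
abbrev Outcome : Type :=
  Option (Bool × Fin 2) × Bool

open Classical in
/-- Given the outcomes `ω` of the earlier rounds, `(i', i)_a` is an arc of `D`, and `i'` is a sender
who picks it: it is the out-arc number `j` of `i'` with respect to `a`. -/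
def IsPickedArc (I : AdWords A n) (d : Fin n → Decision A) (ω : Fin n → Outcome)
    (i' i : Fin n) (a : A) : Prop :=
  IsArc I d i' i a ∧ ∃ (c : Bool) (j : Fin 2), (ω i').1 = some (c, j) ∧ (d i').pick c = a ∧
    (Finset.univ.filter fun i'' => i'' < i ∧ IsArc I d i' i'' a).card = (j : ℕ)

open Classical in
/-- The in-arcs `(i', i)_a` of `i` that have been picked by a sender. -/
def pickedInArcs (I : AdWords A n) (d : Fin n → Decision A) (ω : Fin n → Outcome) (i : Fin n)
    [Fintype A] : Finset (Fin n × A) :=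
  Finset.univ.filter fun e => IsPickedArc I d ω e.1 i e.2

/-- The law of a random bit that is `true` with probability `p`. -/
def biasedBit (p : ℝ≥0) (hp : p ≤ 1) : PMF Bool :=
  PMF.ofFintype (fun c => if c then (p : ℝ≥0∞) else 1 - (p : ℝ≥0∞))
    (by
      have h : (p : ℝ≥0∞) ≤ 1 := by exact_mod_cast hp
      simp [h])

open Classical in
/-- The law of the outcome of round `i` given the outcomes `ω` of the earlier rounds, when the
probability of being a sender is `p`. A sender selects with a fresh random bit and picks one of the
four (potential) out-arcs uniformly. A receiver chooses uniformly one of its in-arcs `(i', i)_a`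
picked by a sender, and selects `a` if and only if `i'` has not selected `a`; if there is no such
in-arc, it selects with a fresh random bit. Nothing is random in a deterministic round. -/
def roundLaw [Fintype A] (p : ℝ≥0) (hp : p ≤ 1) (I : AdWords A n) (d : Fin n → Decision A)
    (i : Fin n) (ω : Fin n → Outcome) : PMF Outcome :=
  match d i with
  | .det _ => PMF.pure (none, true)
  | .rand a₁ _ =>
      (biasedBit p hp).bind fun sender =>
        if sender then
          (PMF.uniformOfFintype Bool).bind fun c =>
            (PMF.uniformOfFintype (Bool × Fin 2)).bind fun e => PMF.pure (some e, c)
        else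
          if h : (pickedInArcs I d ω i).Nonempty then
            (PMF.uniformOfFinset (pickedInArcs I d ω i) h).bind fun e =>
              PMF.pure (none,
                if (d e.1).pick (ω e.1).2 = e.2 then !decide (e.2 = a₁) else decide (e.2 = a₁))
          else
            (PMF.uniformOfFintype Bool).bind fun c => PMF.pure (none, c)

/-- The joint law of the outcomes after the first `m` rounds (later entries hold a default
value). -/
def outcomeLaw [Fintype A] (p : ℝ≥0) (hp : p ≤ 1) (I : AdWords A n) (d : Fin n → Decision A) :
    ℕ → PMF (Fin n → Outcome)
  | 0 => PMF.pure fun _ => (none, true)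
  | m + 1 =>
      if h : m < n then
        (outcomeLaw p hp I d m).bind fun ω =>
          (roundLaw p hp I d ⟨m, h⟩ ω).bind fun o => PMF.pure (Function.update ω ⟨m, h⟩ o)
      else outcomeLaw p hp I d m

/-- The expected objective when the decisions are `d` and the selections in the randomized rounds
are made by the panoramic online correlated selection with sender probability `p`. -/
def expectedObjective [Fintype A] (p : ℝ≥0) (hp : p ≤ 1) (I : AdWords A n)
    (d : Fin n → Decision A) : ℝ :=
  ∑ ω : Fin n → Outcome,
    (outcomeLaw p hp I d n ω).toReal * I.objective fun i => (d i).pick (ω i).2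

/-- The sender probability `4/9`, which gives the `0.05144`-PanOCS. -/
def senderProb : ℝ≥0 := 4 / 9

theorem senderProb_le_one : senderProb ≤ 1 := by
  unfold senderProb
  exact div_le_one_of_le₀ (by norm_num) (by norm_num)

end AdWords

end

/-! The proof is a primal-dual argument made pointwise on the budget intervals. Write r(k) =
2Δβ(k+1) (`residual`) and t(k) = Σ_{ℓ>k} Δβ(ℓ) (`betaTail`), both zero at k = ⊤. The parameters are
tuned so that r(0) + t(0) = 1 and r(k) + t(k) = 2^(-k) (1-γ)^(k-1) for finite k ≥ 1. Thus 1 - r(k) -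
t(k) is a lower bound for the probability that a point with final count k is won, as soon as k
semi-assignments of a point all fail with probability at most 2^(-k) (1-γ)^(k-1).

Dual side. Let β_i be the offers accepted in round i, and let α_a = ΓB_a - ∫ r(k_a) for the final
k_a. Each round lowers Σ_a ∫ t(k_a) by exactly β_i (`sum_runBeta`), so Σα + Σβ = Σ_a ∫ (1 - r - t),
which is the sum of the `primalValue`s. Feasibility up to the factor Γ is `payment_le`: Γ times the
payment for S is at most α_a + Σ_{i∈S} β_i. Payments are capped at B_a and large bids exceed B_a/2,
so it suffices to treat no, one, or at least two large impressions in S. The bounds used are ∫ r ≤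
β_i + Γ(B_a - b_{ai}) and ∫ r ≤ 2β_i. The second needs the panoramic scan: the scanned arc is more
than half of the circle and consists of points that have been semi-assigned least often. Together
these give `mul_opt_le`.

Primal side. On a circle without deterministic points, two consecutive large rounds cover
everything, and after a large deterministic assignment less than half of the budget is left, all of
which is scanned by the next large bid. So at most one large round lies strictly between the ends of
an arc (`card_largeBetween_le_one`). Hence a round has at most two in-arcs and two out-arcs per
advertiser, and the rounds that semi-assign a point form a path in the dependence graph
(`lawMean_bitsIndicator_semiRounds_le`).

For such a path, the roles (receiver, or sender with a picked arc) are independent, and given the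
roles the failure probability is at most 2^(-k) times a product of link weights. This is
`lawMean_mul_bitsIndicator_le`, an induction that trades a receiver for the sender it copies from.
The expectation of the product over the roles is bounded in `roleMean_pathWeight_le` by the
recursion E[W_{l+1}] ≤ E[W_l] - (5/81)(1 - r/6) E[W_{l-1}], where the number r bounds how much a
sender with an arc off the path can raise the expected weight (`roleMean_pathWeight_update_le`). The
first link loses 25/486 > 0.05144 and is the bottleneck. -/

noncomputable section

namespace AdWords

/-! ### Independent roles -/

/-- The role of a round: `none` for a receiver, otherwise the out-arc picked by a sender. -/
abbrev Role : Type := Option (Bool × Fin 2)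

/-- The probability of a role in a randomized round. -/
def roleMass : Role → ℝ
  | none => 5 / 9
  | some _ => 1 / 9

theorem roleMass_nonneg (t : Role) : 0 ≤ roleMass t := by
  cases t <;> norm_num [roleMass]

theorem sum_roleMass_mul (f : Role → ℝ) :
    ∑ t, roleMass t * f t = 5 / 9 * f none + 1 / 9 * ∑ c, f (some c) := by
  rw [Fintype.sum_option, Finset.mul_sum]
  rfl

theorem sum_roleMass : ∑ t, roleMass t = 1 := by
  have := sum_roleMass_mul (fun _ => 1)
  simp only [mul_one] at this
  rw [this]
  norm_num

variable {ι : Type*}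

/-- The configuration that agrees with `τ` on `D` and consists of receivers elsewhere. -/
def restrictRoles [DecidableEq ι] (D : Finset ι) (τ : ι → Role) : ι → Role :=
  fun i => if i ∈ D then τ i else none

/-- The expectation of `g` when the rounds in `D` have independent random roles and all others are
receivers. -/
def roleMean [Fintype ι] [DecidableEq ι] (D : Finset ι) (g : (ι → Role) → ℝ) : ℝ :=
  ∑ τ : ι → Role, (∏ i, roleMass (τ i)) * g (restrictRoles D τ)

theorem prod_roleMass_nonneg [Fintype ι] (τ : ι → Role) : 0 ≤ ∏ i, roleMass (τ i) :=
  Finset.prod_nonneg fun i _ => roleMass_nonneg (τ i)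

theorem restrictRoles_of_notMem [DecidableEq ι] {D : Finset ι} {i : ι} (h : i ∉ D) (τ : ι → Role) :
    restrictRoles D τ i = none := by
  simp [restrictRoles, h]

variable [Fintype ι] [DecidableEq ι]

theorem roleMean_mono {D : Finset ι} {g h : (ι → Role) → ℝ}
    (H : ∀ τ : ι → Role, (∀ i, i ∉ D → τ i = none) → g τ ≤ h τ) :
    roleMean D g ≤ roleMean D h :=
  Finset.sum_le_sum fun τ _ => mul_le_mul_of_nonneg_left
    (H _ fun _ hi => restrictRoles_of_notMem hi τ) (prod_roleMass_nonneg τ)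

theorem roleMean_congr {D : Finset ι} {g h : (ι → Role) → ℝ}
    (H : ∀ τ : ι → Role, (∀ i, i ∉ D → τ i = none) → g τ = h τ) :
    roleMean D g = roleMean D h :=
  Finset.sum_congr rfl fun τ _ => by
    rw [H _ fun _ hi => restrictRoles_of_notMem hi τ]

theorem roleMean_sub (D : Finset ι) (g h : (ι → Role) → ℝ) :
    roleMean D (fun τ => g τ - h τ) = roleMean D g - roleMean D h := by
  simp only [roleMean, mul_sub, Finset.sum_sub_distrib]

theorem roleMean_const_mul (D : Finset ι) (c : ℝ) (g : (ι → Role) → ℝ) :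
    roleMean D (fun τ => c * g τ) = c * roleMean D g := by
  simp only [roleMean, Finset.mul_sum]
  exact Finset.sum_congr rfl fun τ _ => by ring

theorem roleMean_sum {κ : Type*} (D : Finset ι) (s : Finset κ) (g : κ → (ι → Role) → ℝ) :
    roleMean D (fun τ => ∑ k ∈ s, g k τ) = ∑ k ∈ s, roleMean D (g k) := by
  simp only [roleMean, Finset.mul_sum]
  exact Finset.sum_comm

theorem roleMean_const (D : Finset ι) (c : ℝ) : roleMean D (fun _ => c) = c := by
  simp only [roleMean]
  rw [← Finset.sum_mul, ← Fintype.prod_sum]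
  simp only [sum_roleMass, Finset.prod_const_one, one_mul]

theorem roleMean_nonneg {D : Finset ι} {g : (ι → Role) → ℝ} (H : ∀ τ, 0 ≤ g τ) :
    0 ≤ roleMean D g :=
  Finset.sum_nonneg fun τ _ => mul_nonneg (prod_roleMass_nonneg τ) (H _)

/-- Redrawing coordinate `i` independently preserves the product law. The exchange of the old and
the new role is a mass-preserving involution of the pairs. -/
theorem sum_prod_roleMass_resample (i : ι) (g : (ι → Role) → ℝ) :
    ∑ τ : ι → Role, (∏ j, roleMass (τ j)) * g τ =
      ∑ t, roleMass t * ∑ τ : ι → Role, (∏ j, roleMass (τ j)) * g (Function.update τ i t) := by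
  have hmass : ∀ (τ : ι → Role) (t : Role),
      roleMass (τ i) * ∏ j, roleMass (Function.update τ i t j) =
        roleMass t * ∏ j, roleMass (τ j) := by
    intro τ t
    rw [← Finset.mul_prod_erase _ _ (Finset.mem_univ i),
      ← Finset.mul_prod_erase _ (fun j => roleMass (τ j)) (Finset.mem_univ i)]
    rw [Finset.prod_congr rfl (g := fun j => roleMass (τ j))]
    · simp only [Function.update_self]; ring
    · intro j hj
      rw [Function.update_of_ne (Finset.ne_of_mem_erase hj)]
  have h1 : ∑ t, roleMass t * ∑ τ : ι → Role,
      (∏ j, roleMass (τ j)) * g (Function.update τ i t) =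
      ∑ x : Role × (ι → Role),
        roleMass x.1 * (∏ j, roleMass (x.2 j)) * g (Function.update x.2 i x.1) := by
    rw [Fintype.sum_prod_type]
    refine Finset.sum_congr rfl fun t _ => ?_
    rw [Finset.mul_sum]
    exact Finset.sum_congr rfl fun τ _ => by ring
  have h2 : ∑ τ : ι → Role, (∏ j, roleMass (τ j)) * g τ =
      ∑ x : Role × (ι → Role), roleMass x.1 * (∏ j, roleMass (x.2 j)) * g x.2 := by
    rw [Fintype.sum_prod_type]
    rw [Finset.sum_comm]
    refine Finset.sum_congr rfl fun τ _ => ?_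
    simp only [mul_assoc]
    rw [← Finset.sum_mul, sum_roleMass, one_mul]
  rw [h1, h2]
  refine Finset.sum_nbij' (fun x => (x.2 i, Function.update x.2 i x.1))
    (fun x => (x.2 i, Function.update x.2 i x.1)) (by simp) (by simp) (by simp) (by simp) ?_
  rintro ⟨t, τ⟩ -
  simp only [Function.update_idem, Function.update_eq_self]
  rw [hmass]

theorem roleMean_erase {D : Finset ι} {i : ι} (hi : i ∈ D) (g : (ι → Role) → ℝ) :
    roleMean D g =
      ∑ t, roleMass t * roleMean (D.erase i) (fun τ => g (Function.update τ i t)) := by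
  unfold roleMean
  rw [sum_prod_roleMass_resample i]
  refine Finset.sum_congr rfl fun t _ => ?_
  congr 1
  refine Finset.sum_congr rfl fun τ _ => ?_
  congr 2
  funext j
  by_cases hj : j = i
  · subst hj; simp [restrictRoles, hi]
  · simp [restrictRoles, hj]

theorem roleMean_mul_indicator {D : Finset ι} {i : ι} (hi : i ∈ D) (t : Role)
    (g : (ι → Role) → ℝ) :
    roleMean D (fun τ => if τ i = t then g τ else 0) =
      roleMass t * roleMean (D.erase i) (fun τ => g (Function.update τ i t)) := by
  rw [roleMean_erase hi, Finset.sum_eq_single t]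
  · simp
  · intro t' _ ht'
    simp [ht', roleMean_const]
  · simp

theorem roleMean_erase_of_indep {D : Finset ι} {i : ι} {g : (ι → Role) → ℝ}
    (H : ∀ τ t, g (Function.update τ i t) = g τ) :
    roleMean (D.erase i) g = roleMean D g := by
  by_cases hi : i ∈ D
  · rw [roleMean_erase hi]
    simp only [H]
    rw [← Finset.sum_mul, sum_roleMass, one_mul]
  · rw [Finset.erase_eq_of_notMem hi]

end AdWords
end

noncomputable section

namespace AdWords

/-! ### The weight of a path in the dependence graph -/

variable {n : ℕ}

/-- The number of in-arcs of `v`, given by their sources and their numbers there, that are picked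
under the roles `τ`. -/
def pickedCount (arcs : Fin n → Finset (Fin n × (Bool × Fin 2))) (v : Fin n)
    (τ : Fin n → Role) : ℕ :=
  ((arcs v).filter fun e => τ e.1 = some e.2).card

/-- The probability, given the roles `τ`, that the selections in the rounds `p j` and `p (j + 1)`
are not correlated through the arc `c j`. -/
def linkWeight (arcs : Fin n → Finset (Fin n × (Bool × Fin 2))) (p : ℕ → Fin n)
    (c : ℕ → Bool × Fin 2) (j : ℕ) (τ : Fin n → Role) : ℝ :=
  if τ (p (j + 1)) = none ∧ τ (p j) = some (c j) then
    1 - 1 / (pickedCount arcs (p (j + 1)) τ : ℝ) else 1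

/-- The product of the weights of the links in `J`. -/
def pathWeight (arcs : Fin n → Finset (Fin n × (Bool × Fin 2))) (p : ℕ → Fin n)
    (c : ℕ → Bool × Fin 2) (J : Finset ℕ) (τ : Fin n → Role) : ℝ :=
  ∏ j ∈ J, linkWeight arcs p c j τ

/-- The rounds `p 0 < ⋯ < p K` form a path in a graph with in-degrees at most four, in which the
arc from `p j` to `p (j + 1)` has number `c j` at its source. -/
structure IsLinkedPath (arcs : Fin n → Finset (Fin n × (Bool × Fin 2))) (p : ℕ → Fin n)
    (c : ℕ → Bool × Fin 2) (K : ℕ) : Prop where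
  eq_of_mem : ∀ {v v' e}, e ∈ arcs v → e ∈ arcs v' → v = v'
  card_le : ∀ v, (arcs v).card ≤ 4
  lt_of_mem : ∀ {v e}, e ∈ arcs v → e.1 < v
  lt_of_lt : ∀ {i j}, i < j → j ≤ K → p i < p j
  mem : ∀ {j}, j < K → (p j, c j) ∈ arcs (p (j + 1))

variable {arcs : Fin n → Finset (Fin n × (Bool × Fin 2))} {p : ℕ → Fin n}
  {c : ℕ → Bool × Fin 2} {K : ℕ}

theorem IsLinkedPath.injOn (h : IsLinkedPath arcs p c K) {i j : ℕ} (hi : i ≤ K) (hj : j ≤ K)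
    (hij : p i = p j) : i = j := by
  rcases lt_trichotomy i j with hl | hl | hl
  · exact absurd hij (h.lt_of_lt hl hj).ne
  · exact hl
  · exact absurd hij (h.lt_of_lt hl hi).ne'

theorem linkWeight_le_one (j : ℕ) (τ : Fin n → Role) : linkWeight arcs p c j τ ≤ 1 := by
  unfold linkWeight
  split_ifs
  · have : (0 : ℝ) ≤ 1 / (pickedCount arcs (p (j + 1)) τ : ℝ) := by positivity
    linarith
  · exact le_rfl

theorem linkWeight_nonneg (j : ℕ) (τ : Fin n → Role) : 0 ≤ linkWeight arcs p c j τ := by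
  unfold linkWeight
  split_ifs
  · rcases Nat.eq_zero_or_pos (pickedCount arcs (p (j + 1)) τ) with h | h
    · simp [h]
    · have : (1 : ℝ) ≤ (pickedCount arcs (p (j + 1)) τ : ℝ) := by exact_mod_cast h
      have := (div_le_one (by linarith)).2 this
      linarith
  · exact zero_le_one

theorem pathWeight_nonneg (J : Finset ℕ) (τ : Fin n → Role) : 0 ≤ pathWeight arcs p c J τ :=
  Finset.prod_nonneg fun j _ => linkWeight_nonneg j τ

/-- A link costs less when the receiver has more picked in-arcs to choose from, and nothing when the
link is not active. The path arc itself is counted, so the denominator for `τ` is positive. -/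
theorem linkWeight_le_linkWeight {j : ℕ} {τ τ' : Fin n → Role}
    (hmem : (p j, c j) ∈ arcs (p (j + 1)))
    (hcond : τ' (p (j + 1)) = none → τ' (p j) = some (c j) →
      τ (p (j + 1)) = none ∧ τ (p j) = some (c j))
    (hcount : ∀ e ∈ arcs (p (j + 1)), τ e.1 = some e.2 → τ' e.1 = some e.2) :
    linkWeight arcs p c j τ ≤ linkWeight arcs p c j τ' := by
  by_cases h' : τ' (p (j + 1)) = none ∧ τ' (p j) = some (c j)
  · have h := hcond h'.1 h'.2
    unfold linkWeight
    rw [if_pos h, if_pos h']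
    have h1 : pickedCount arcs (p (j + 1)) τ ≤ pickedCount arcs (p (j + 1)) τ' := by
      refine Finset.card_le_card fun e he => ?_
      rw [Finset.mem_filter] at he ⊢
      exact ⟨he.1, hcount e he.1 he.2⟩
    have h2 : 0 < pickedCount arcs (p (j + 1)) τ :=
      Finset.card_pos.2 ⟨_, Finset.mem_filter.2 ⟨hmem, h.2⟩⟩
    have h3 : (0 : ℝ) < pickedCount arcs (p (j + 1)) τ := by exact_mod_cast h2
    have h4 : (pickedCount arcs (p (j + 1)) τ : ℝ) ≤ pickedCount arcs (p (j + 1)) τ' := by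
      exact_mod_cast h1
    have := one_div_le_one_div_of_le h3 h4
    linarith
  · refine (linkWeight_le_one j τ).trans (le_of_eq ?_)
    unfold linkWeight
    rw [if_neg h']

theorem linkWeight_update_le {h : IsLinkedPath arcs p c K} {j : ℕ} (hj : j < K) {u : Fin n}
    {a : Bool × Fin 2} (ha : (u, a) ∉ arcs (p (j + 1))) {t : Role}
    (ht : p j = u → t ≠ some (c j)) (hn : p (j + 1) = u → t ≠ none) (τ : Fin n → Role) :
    linkWeight arcs p c j (Function.update τ u (some a)) ≤
      linkWeight arcs p c j (Function.update τ u t) := by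
  refine linkWeight_le_linkWeight (h.mem hj) ?_ ?_
  · intro h1 h2
    have hne1 : p (j + 1) ≠ u := fun e => hn e (by rw [e, Function.update_self] at h1; exact h1)
    have hne2 : p j ≠ u := fun e => ht e (by rw [e, Function.update_self] at h2; exact h2)
    rw [Function.update_of_ne hne1] at h1 ⊢
    rw [Function.update_of_ne hne2] at h2 ⊢
    exact ⟨h1, h2⟩
  · intro e he h1
    have hne : e.1 ≠ u := by
      rintro rfl
      rw [Function.update_self] at h1
      apply ha
      have : a = e.2 := Option.some_injective _ h1
      rw [this]
      exact he
    rw [Function.update_of_ne hne] at h1 ⊢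
    exact h1

/-- A sender whose arc misses the path activates no link and adds no competing in-arc on it. Any
other role that does not itself activate a link can therefore only raise the weight. -/
theorem pathWeight_update_le (h : IsLinkedPath arcs p c K) {J : Finset ℕ} (hJ : ∀ j ∈ J, j < K)
    {u : Fin n} {a : Bool × Fin 2} (ha : ∀ j ∈ J, (u, a) ∉ arcs (p (j + 1))) {t : Role}
    (ht : ∀ j ∈ J, p j = u → t ≠ some (c j)) (hn : ∀ j ∈ J, p (j + 1) = u → t ≠ none)
    (τ : Fin n → Role) :
    pathWeight arcs p c J (Function.update τ u (some a)) ≤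
      pathWeight arcs p c J (Function.update τ u t) :=
  Finset.prod_le_prod (fun j _ => linkWeight_nonneg j _) fun j hj =>
    linkWeight_update_le (h := h) (hJ j hj) (ha j hj) (ht j hj) (hn j hj) τ

theorem pathWeight_eq_mul_erase {J : Finset ℕ} {j : ℕ} (hj : j ∈ J) (τ : Fin n → Role) :
    pathWeight arcs p c J τ = linkWeight arcs p c j τ * pathWeight arcs p c (J.erase j) τ :=
  (Finset.mul_prod_erase J (fun j => linkWeight arcs p c j τ) hj).symm

/-- A round that picks an arc leading outside the path has a bounded influence on its weight. -/
theorem roleMean_pathWeight_update_le (h : IsLinkedPath arcs p c K) (J : Finset ℕ)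
    (hJ : ∀ j ∈ J, j < K) (D : Finset (Fin n)) {u : Fin n} (hu : u ∈ D) {a : Bool × Fin 2}
    (ha : ∀ j ∈ J, (u, a) ∉ arcs (p (j + 1))) :
    roleMean (D.erase u) (fun τ => pathWeight arcs p c J (Function.update τ u (some a))) ≤
      5 / 4 * roleMean D (pathWeight arcs p c J) := by
  induction hs : J.card using Nat.strong_induction_on generalizing J D u a with
  | _ s ih =>
  subst hs
  set H := roleMean (D.erase u)
    (fun τ => pathWeight arcs p c J (Function.update τ u (some a))) with hH
  have hH0 : 0 ≤ H := roleMean_nonneg fun τ => pathWeight_nonneg J _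
  -- If `u` becomes a receiver, at most the link into `u` is newly activated. This needs its
  -- predecessor to pick the path arc, which costs at most the fraction 1/9 · 5/4 = 5/36 by
  -- induction.
  have hnone : (1 - 5 / 36) * H ≤
      roleMean (D.erase u) (fun τ => pathWeight arcs p c J (Function.update τ u none)) := by
    by_cases hex : ∃ j ∈ J, p (j + 1) = u
    · obtain ⟨m, hm, hmu⟩ := hex
      set J' := J.erase m with hJ'
      have hJJ : ∀ j ∈ J', j < K := fun j hj => hJ j (Finset.mem_of_mem_erase hj)
      have hother : ∀ j ∈ J', p (j + 1) ≠ u := by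
        intro j hj he
        have := h.injOn (hJJ j hj) (hJ m hm) (he.trans hmu.symm)
        exact Finset.ne_of_mem_erase hj (by omega)
      -- Outside `D.erase u` all roles are `none`, so the update of `u` to a receiver does not
      -- change `τ`.
      have hle : H ≤ roleMean (D.erase u) (pathWeight arcs p c J') := by
        refine roleMean_mono fun τ hτ => ?_
        have h1 : Function.update τ u none = τ := by
          rw [← hτ u (Finset.notMem_erase u D), Function.update_eq_self]
        have h2 := pathWeight_update_le h hJJ (t := none)
          (fun j hj => ha j (Finset.mem_of_mem_erase hj)) (fun j _ _ => by simp)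
          (fun j hj he => absurd he (hother j hj)) τ
        rw [h1] at h2
        refine le_trans ?_ h2
        rw [pathWeight_eq_mul_erase hm]
        exact mul_le_of_le_one_left (pathWeight_nonneg _ _) (linkWeight_le_one _ _)
      have hcorr : roleMean (D.erase u)
          (fun τ => if τ (p m) = some (c m) then pathWeight arcs p c J' τ else 0) ≤
          5 / 36 * roleMean (D.erase u) (pathWeight arcs p c J') := by
        by_cases hpm : p m ∈ D.erase u
        · rw [roleMean_mul_indicator hpm]
          have := ih J'.card (Finset.card_erase_lt_of_mem hm) J' hJJ (D.erase u) hpm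
            (a := c m) (fun j hj hmem => hother j hj
              ((h.eq_of_mem hmem (h.mem (hJ m hm))).trans hmu)) rfl
          simp only [roleMass]
          linarith
        · have h0 : roleMean (D.erase u)
              (fun τ => if τ (p m) = some (c m) then pathWeight arcs p c J' τ else 0) =
              roleMean (D.erase u) (fun _ => 0) :=
            roleMean_congr fun τ hτ => by rw [hτ _ hpm]; simp
          rw [h0, roleMean_const]
          exact mul_nonneg (by norm_num) (roleMean_nonneg fun τ => pathWeight_nonneg _ _)
      have hge : roleMean (D.erase u) (fun τ => pathWeight arcs p c J' τ -
            if τ (p m) = some (c m) then pathWeight arcs p c J' τ else 0) ≤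
          roleMean (D.erase u) (fun τ => pathWeight arcs p c J (Function.update τ u none)) := by
        refine roleMean_mono fun τ hτ => ?_
        have h1 : Function.update τ u none = τ := by
          rw [← hτ u (Finset.notMem_erase u D), Function.update_eq_self]
        rw [h1, pathWeight_eq_mul_erase hm]
        split_ifs with hc
        · rw [sub_self]
          exact mul_nonneg (linkWeight_nonneg _ _) (pathWeight_nonneg _ _)
        · have : linkWeight arcs p c m τ = 1 := by
            unfold linkWeight
            rw [if_neg (fun hh => hc hh.2)]
          rw [this, sub_zero, one_mul]
      rw [roleMean_sub] at hge
      linarith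
    · push Not at hex
      have h1 : H ≤
          roleMean (D.erase u) (fun τ => pathWeight arcs p c J (Function.update τ u none)) :=
        roleMean_mono fun τ _ => pathWeight_update_le h hJ ha (fun j _ _ => by simp)
          (fun j hj he => absurd he (hex j hj)) τ
      linarith
  -- Of the four arcs that `u` may pick, at most one lies on the path. The other three give at least
  -- `H` each, and the remaining one is bounded below by 0.
  have hsome : 3 * H ≤ ∑ b, roleMean (D.erase u)
      (fun τ => pathWeight arcs p c J (Function.update τ u (some b))) := by
    obtain ⟨b₀, hb₀⟩ : ∃ b₀ : Bool × Fin 2, ∀ j ∈ J, p j = u → c j = b₀ := by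
      by_cases hex : ∃ m ∈ J, p m = u
      · obtain ⟨m, hm, hmu⟩ := hex
        refine ⟨c m, fun j hj hju => ?_⟩
        rw [h.injOn (hJ j hj).le (hJ m hm).le (hju.trans hmu.symm)]
      · push Not at hex
        exact ⟨c 0, fun j hj hju => absurd hju (hex j hj)⟩
    calc 3 * H = ∑ _b ∈ (Finset.univ : Finset (Bool × Fin 2)).erase b₀, H := by
          rw [Finset.sum_const, Finset.card_erase_of_mem (Finset.mem_univ _)]
          simp
      _ ≤ ∑ b ∈ (Finset.univ : Finset (Bool × Fin 2)).erase b₀, roleMean (D.erase u)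
            (fun τ => pathWeight arcs p c J (Function.update τ u (some b))) := by
          refine Finset.sum_le_sum fun b hb => roleMean_mono fun τ _ => ?_
          refine pathWeight_update_le h hJ ha (fun j hj hju he => ?_) (fun _ _ _ => by simp) τ
          exact Finset.ne_of_mem_erase hb ((Option.some_injective _ he).trans (hb₀ j hj hju))
      _ ≤ _ := Finset.sum_le_sum_of_subset_of_nonneg (Finset.erase_subset _ _)
          fun b _ _ => roleMean_nonneg fun τ => pathWeight_nonneg _ _
  -- The total is at least (5/9 · 31/36 + 3/9) H = 263/324 · H, and 263/324 > 4/5.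
  rw [roleMean_erase hu, sum_roleMass_mul]
  linarith

end AdWords
end

/-! ### Recursion for the expected weight of a path -/

noncomputable section

namespace AdWords

variable {n : ℕ} {arcs : Fin n → Finset (Fin n × (Bool × Fin 2))} {p : ℕ → Fin n}
  {c : ℕ → Bool × Fin 2} {K : ℕ}

theorem pickedCount_congr (h : IsLinkedPath arcs p c K) {v : Fin n} {τ τ' : Fin n → Role}
    (H : ∀ u < v, τ u = τ' u) : pickedCount arcs v τ = pickedCount arcs v τ' := by
  unfold pickedCount
  congr 1
  refine Finset.filter_congr fun e he => ?_
  rw [H _ (h.lt_of_mem he)]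

theorem pathWeight_empty (τ : Fin n → Role) : pathWeight arcs p c ∅ τ = 1 :=
  Finset.prod_empty

theorem roleMean_pathWeight_empty (D : Finset (Fin n)) :
    roleMean D (pathWeight arcs p c ∅) = 1 :=
  roleMean_const D 1

theorem pathWeight_range_congr (h : IsLinkedPath arcs p c K) {l : ℕ} (hl : l ≤ K)
    {τ τ' : Fin n → Role} (H : ∀ u ≤ p l, τ u = τ' u) :
    pathWeight arcs p c (Finset.range l) τ = pathWeight arcs p c (Finset.range l) τ' := by
  refine Finset.prod_congr rfl fun j hj => ?_
  have hj : j < l := Finset.mem_range.1 hj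
  have h1 : p (j + 1) ≤ p l := by
    rcases Nat.lt_or_ge (j + 1) l with h' | h'
    · exact (h.lt_of_lt h' hl).le
    · exact (congrArg p (le_antisymm (by omega) h' : j + 1 = l)).le
  have h2 : p j < p (j + 1) := h.lt_of_lt (Nat.lt_succ_self j) (by omega)
  unfold linkWeight
  rw [H _ h1, H _ (h2.le.trans h1), pickedCount_congr h fun u hu => H u (hu.le.trans h1)]

theorem pathWeight_range_update (h : IsLinkedPath arcs p c K) {l : ℕ} (hl : l ≤ K)
    {u : Fin n} (hu : p (l - 1) < u ∨ l = 0) (τ : Fin n → Role) (t : Role) :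
    pathWeight arcs p c (Finset.range (l - 1)) (Function.update τ u t) =
      pathWeight arcs p c (Finset.range (l - 1)) τ := by
  rcases hu with hu | rfl
  · exact pathWeight_range_congr h (by omega) fun v hv =>
      Function.update_of_ne (hv.trans_lt hu).ne _ _
  · rfl

/-- The probability that a link is realized, weighted by the links before the preceding one. -/
theorem le_roleMean_link (h : IsLinkedPath arcs p c K) {l : ℕ} (hl : l < K) {D : Finset (Fin n)}
    (hD : ∀ j ≤ K, p j ∈ D) {r : ℝ}
    (hr : ∀ (D' : Finset (Fin n)) (u : Fin n), u ∈ D' → ∀ a : Bool × Fin 2,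
      (∀ j ∈ Finset.range (l - 1), (u, a) ∉ arcs (p (j + 1))) →
      roleMean (D'.erase u)
          (fun τ => pathWeight arcs p c (Finset.range (l - 1)) (Function.update τ u (some a))) ≤
        r * roleMean D' (pathWeight arcs p c (Finset.range (l - 1)))) (hr0 : 0 ≤ r) :
    5 / 81 * (1 - r / 6) * roleMean D (pathWeight arcs p c (Finset.range (l - 1))) ≤
      roleMean D (fun τ => if τ (p (l + 1)) = none then
        if τ (p l) = some (c l) then pathWeight arcs p c (Finset.range (l - 1)) τ *
          (1 / (pickedCount arcs (p (l + 1)) τ : ℝ)) else 0 else 0) := by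
  set W := pathWeight arcs p c (Finset.range (l - 1)) with hW
  have hlt : p l < p (l + 1) := h.lt_of_lt (Nat.lt_succ_self l) hl
  have hmem1 : p (l + 1) ∈ D := hD _ hl
  have hmem2 : p l ∈ D.erase (p (l + 1)) := Finset.mem_erase.2 ⟨hlt.ne, hD _ hl.le⟩
  -- The links below `l - 1` end at `p (l - 1)`, so `W` is independent of the roles of `p l` and `p
  -- (l + 1)`. For `l = 0` the truncated subtraction leaves the empty product.
  have hup : ∀ u, p l ≤ u → ∀ τ t, W (Function.update τ u t) = W τ := by
    intro u hu τ t
    refine pathWeight_range_update h hl.le ?_ τ t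
    rcases Nat.eq_zero_or_pos l with h0 | h0
    · exact Or.inr h0
    · exact Or.inl ((h.lt_of_lt (by omega) hl.le).trans_le hu)
  set D' := (D.erase (p (l + 1))).erase (p l) with hD'
  have hWD : roleMean D' W = roleMean D W := by
    rw [hD', roleMean_erase_of_indep (hup _ le_rfl), roleMean_erase_of_indep (hup _ hlt.le)]
  set others := (arcs (p (l + 1))).erase (p l, c l) with hothers
  have hcard : (others.card : ℝ) ≤ 3 := by
    have h1 := h.card_le (p (l + 1))
    rw [hothers, Finset.card_erase_of_mem (h.mem hl)]
    exact_mod_cast (by omega : (arcs (p (l + 1))).card - 1 ≤ 3)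
  rw [roleMean_mul_indicator hmem1]
  simp only [Function.update_of_ne hlt.ne]
  rw [roleMean_mul_indicator hmem2, ← hWD]
  -- A competing in-arc is picked with probability 1/9. It ends at `p (l + 1)` and thus off the
  -- links of `W`, so conditioning on it raises the mean of `W` by a factor of at most `r`.
  have hother : ∀ e ∈ others,
      roleMean D' (fun τ => if τ e.1 = some e.2 then W τ else 0) ≤
        1 / 9 * (r * roleMean D' W) := by
    intro e he
    by_cases heD : e.1 ∈ D'
    · rw [roleMean_mul_indicator heD]
      refine mul_le_mul_of_nonneg_left (hr D' e.1 heD e.2 fun j hj hmem => ?_)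
        (roleMass_nonneg _)
      have hj := Finset.mem_range.1 hj
      have h1 := h.injOn (by omega) (by omega)
        (h.eq_of_mem hmem (Finset.mem_of_mem_erase he))
      omega
    · have h0 : roleMean D' (fun τ => if τ e.1 = some e.2 then W τ else 0) =
          roleMean D' (fun _ => 0) :=
        roleMean_congr fun τ hτ => by rw [hτ _ heD]; simp
      rw [h0, roleMean_const]
      have := roleMean_nonneg (D := D') (g := W) fun τ => pathWeight_nonneg _ τ
      positivity
  have hlow : roleMean D' (fun τ => W τ - 1 / 2 * ∑ e ∈ others,
        if τ e.1 = some e.2 then W τ else 0) ≤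
      roleMean D' (fun τ =>
        W (Function.update (Function.update τ (p l) (some (c l))) (p (l + 1)) none) *
          (1 / (pickedCount arcs (p (l + 1))
            (Function.update (Function.update τ (p l) (some (c l))) (p (l + 1)) none) : ℝ))) := by
    refine roleMean_mono fun τ _ => ?_
    rw [hup _ hlt.le, hup _ le_rfl]
    set τ' := Function.update (Function.update τ (p l) (some (c l))) (p (l + 1)) none with hτ'
    have hpl : τ' (p l) = some (c l) := by
      rw [hτ', Function.update_of_ne hlt.ne, Function.update_self]
    have hsum : ∑ e ∈ others, (if τ e.1 = some e.2 then W τ else 0) =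
        W τ * (others.filter fun e => τ e.1 = some e.2).card := by
      rw [← Finset.sum_filter, Finset.sum_const, nsmul_eq_mul, mul_comm]
    have hcount : pickedCount arcs (p (l + 1)) τ' ≤
        (others.filter fun e => τ e.1 = some e.2).card + 1 := by
      unfold pickedCount
      rw [← Finset.insert_erase (h.mem hl), Finset.filter_insert, if_pos hpl]
      refine (Finset.card_insert_le _ _).trans (Nat.succ_le_succ (Finset.card_le_card ?_))
      intro e he
      rw [Finset.mem_filter] at he ⊢
      refine ⟨he.1, ?_⟩
      have hne1 : e.1 ≠ p (l + 1) := (h.lt_of_mem (Finset.mem_of_mem_erase he.1)).ne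
      have hne2 : e.1 ≠ p l := by
        intro h1
        have h2 := he.2
        rw [h1, hpl] at h2
        exact Finset.ne_of_mem_erase he.1 (Prod.ext h1 (Option.some_injective _ h2).symm)
      have h2 := he.2
      rwa [hτ', Function.update_of_ne hne1, Function.update_of_ne hne2] at h2
    have hpos : 0 < pickedCount arcs (p (l + 1)) τ' :=
      Finset.card_pos.2 ⟨_, Finset.mem_filter.2 ⟨h.mem hl, hpl⟩⟩
    rw [hsum]
    set N := pickedCount arcs (p (l + 1)) τ' with hN
    set k := (others.filter fun e => τ e.1 = some e.2).card with hk
    have hW0 : 0 ≤ W τ := pathWeight_nonneg _ _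
    have hNk : (N : ℝ) ≤ k + 1 := by exact_mod_cast hcount
    have hN1 : (1 : ℝ) ≤ N := by exact_mod_cast hpos
    -- The bound 1/(k+1) ≥ 1 - k/2 is linear in the number `k` of competitors, so single-arc
    -- probabilities suffice. With at most three competitors it yields 1 - (3/2)(r/9) = 1 - r/6.
    have key : 1 - 1 / 2 * (k : ℝ) ≤ 1 / N := by
      rw [le_div_iff₀ (by linarith)]
      rcases Nat.lt_or_ge N 2 with h2 | h2
      · have h3 : N = 1 := by omega
        rw [h3]
        have : (0 : ℝ) ≤ k := by positivity
        push_cast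
        linarith
      · have h3 : (2 : ℝ) ≤ N := by exact_mod_cast h2
        nlinarith
    calc W τ - 1 / 2 * (W τ * k) = W τ * (1 - 1 / 2 * k) := by ring
      _ ≤ W τ * (1 / N) := mul_le_mul_of_nonneg_left key hW0
  have hlow2 : (1 - r / 6) * roleMean D' W ≤
      roleMean D' (fun τ => W τ - 1 / 2 * ∑ e ∈ others,
        if τ e.1 = some e.2 then W τ else 0) := by
    rw [roleMean_sub, roleMean_const_mul, roleMean_sum]
    have h1 := Finset.sum_le_card_nsmul _ _ _ hother
    rw [nsmul_eq_mul] at h1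
    have hW0 := roleMean_nonneg (D := D') (g := W) fun τ => pathWeight_nonneg _ τ
    have h2 : (others.card : ℝ) * (1 / 9 * (r * roleMean D' W)) ≤
        3 * (1 / 9 * (r * roleMean D' W)) :=
      mul_le_mul_of_nonneg_right hcard (by positivity)
    change _ ≤ roleMean D' W - _
    linarith
  have := hlow2.trans hlow
  simp only [roleMass]
  linarith

/-- The new factor differs from 1 only if `p l` is a sender. Then the preceding link, which needs `p
l` to be a receiver, is inactive. So the amount lost involves the weight two steps back and can be
estimated with independent roles. -/
theorem roleMean_pathWeight_succ_le (h : IsLinkedPath arcs p c K) {l : ℕ} (hl : l < K)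
    {D : Finset (Fin n)} (hD : ∀ j ≤ K, p j ∈ D) {r : ℝ}
    (hr : ∀ (D' : Finset (Fin n)) (u : Fin n), u ∈ D' → ∀ a : Bool × Fin 2,
      (∀ j ∈ Finset.range (l - 1), (u, a) ∉ arcs (p (j + 1))) →
      roleMean (D'.erase u)
          (fun τ => pathWeight arcs p c (Finset.range (l - 1)) (Function.update τ u (some a))) ≤
        r * roleMean D' (pathWeight arcs p c (Finset.range (l - 1)))) (hr0 : 0 ≤ r) :
    roleMean D (pathWeight arcs p c (Finset.range (l + 1))) ≤
      roleMean D (pathWeight arcs p c (Finset.range l)) -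
        5 / 81 * (1 - r / 6) * roleMean D (pathWeight arcs p c (Finset.range (l - 1))) := by
  have h1 := le_roleMean_link h hl hD hr hr0
  have h2 : roleMean D (pathWeight arcs p c (Finset.range (l + 1))) =
      roleMean D (fun τ => pathWeight arcs p c (Finset.range l) τ -
        if τ (p (l + 1)) = none then
        if τ (p l) = some (c l) then pathWeight arcs p c (Finset.range (l - 1)) τ *
          (1 / (pickedCount arcs (p (l + 1)) τ : ℝ)) else 0 else 0) := by
    refine roleMean_congr fun τ _ => ?_
    have hs : pathWeight arcs p c (Finset.range (l + 1)) τ =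
        pathWeight arcs p c (Finset.range l) τ * linkWeight arcs p c l τ :=
      Finset.prod_range_succ _ _
    rw [hs]
    unfold linkWeight
    by_cases h3 : τ (p (l + 1)) = none
    · by_cases h4 : τ (p l) = some (c l)
      · rw [if_pos ⟨h3, h4⟩, if_pos h3, if_pos h4]
        have h5 : pathWeight arcs p c (Finset.range l) τ =
            pathWeight arcs p c (Finset.range (l - 1)) τ := by
          rcases l with _ | l
          · rfl
          · have : pathWeight arcs p c (Finset.range (l + 1)) τ =
                pathWeight arcs p c (Finset.range l) τ * linkWeight arcs p c l τ :=
              Finset.prod_range_succ _ _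
            rw [this]
            unfold linkWeight
            rw [if_neg (fun hh => by rw [h4] at hh; simp at hh), mul_one]
            rfl
        rw [h5]
        ring
      · rw [if_neg (fun hh => h4 hh.2), if_pos h3, if_neg h4]
        ring
    · rw [if_neg (fun hh => h3 hh.1), if_neg h3]
      ring
  rw [h2, roleMean_sub]
  linarith

/-- On a path with `l` links the correlation reduces the expected weight by a constant factor per
link. -/
theorem roleMean_pathWeight_le (h : IsLinkedPath arcs p c K) {D : Finset (Fin n)}
    (hD : ∀ j ≤ K, p j ∈ D) :
    roleMean D (pathWeight arcs p c (Finset.range K)) ≤ (1 - 0.05144) ^ K := by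
  have hstep : ∀ l, l < K → roleMean D (pathWeight arcs p c (Finset.range (l + 1))) ≤
      (1 - 0.05144) * roleMean D (pathWeight arcs p c (Finset.range l)) := by
    intro l
    induction l with
    | zero =>
      intro hl
      -- The weight is the empty product here, so `r = 1` is allowed. The loss is 5/81 · 5/6 =
      -- 25/486, just above 0.05144.
      have h1 := roleMean_pathWeight_succ_le h hl hD (r := 1) (fun D' u _ a _ => by
        simp [pathWeight_empty, roleMean_pathWeight_empty, roleMean_const]) zero_le_one
      simp only [Nat.zero_sub, Finset.range_zero, roleMean_pathWeight_empty] at h1 ⊢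
      norm_num at h1 ⊢
      linarith
    | succ l ih =>
      intro hl
      -- Now the loss is 5/81 · 19/24 = 95/1944 of the weight two steps back. By induction that
      -- weight is at least the last one divided by 1 - 0.05144, and the quotient of the constants
      -- is about 0.0515.
      have h1 := roleMean_pathWeight_succ_le h hl hD (r := 5 / 4) (fun D' u hu a ha =>
        roleMean_pathWeight_update_le h _ (fun j hj => by
          have := Finset.mem_range.1 hj
          omega) D' hu ha) (by norm_num)
      have h2 := ih (by omega)
      have h3 : 0 ≤ roleMean D (pathWeight arcs p c (Finset.range (l + 1))) :=
        roleMean_nonneg fun τ => pathWeight_nonneg _ _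
      simp only [Nat.add_sub_cancel] at h1
      norm_num at h1 h2 ⊢
      linarith
  have hall : ∀ l, l ≤ K →
      roleMean D (pathWeight arcs p c (Finset.range l)) ≤ (1 - 0.05144) ^ l := by
    intro l
    induction l with
    | zero => intro _; simp [roleMean_pathWeight_empty]
    | succ l ih =>
      intro hl
      refine (hstep l (by omega)).trans ?_
      rw [pow_succ, mul_comm]
      exact mul_le_mul_of_nonneg_right (ih (by omega)) (by norm_num)
  exact hall K le_rfl

end AdWords
end

noncomputable section

namespace AdWords

/-! ### Expectations under the law of the outcomes -/

/-- The expectation of a function on a finite type. -/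
def pmfMean {α : Type*} [Fintype α] (q : PMF α) (f : α → ℝ) : ℝ :=
  ∑ x, (q x).toReal * f x

section pmfMean

variable {α β : Type*} [Fintype α] [Fintype β]

theorem pmfMean_mono (q : PMF α) {f g : α → ℝ} (h : ∀ x, f x ≤ g x) :
    pmfMean q f ≤ pmfMean q g :=
  Finset.sum_le_sum fun x _ => mul_le_mul_of_nonneg_left (h x) ENNReal.toReal_nonneg

theorem pmfMean_add (q : PMF α) (f g : α → ℝ) :
    pmfMean q (fun x => f x + g x) = pmfMean q f + pmfMean q g := by
  simp only [pmfMean, mul_add, Finset.sum_add_distrib]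

theorem pmfMean_sub (q : PMF α) (f g : α → ℝ) :
    pmfMean q (fun x => f x - g x) = pmfMean q f - pmfMean q g := by
  simp only [pmfMean, mul_sub, Finset.sum_sub_distrib]

theorem pmfMean_const_mul (q : PMF α) (c : ℝ) (f : α → ℝ) :
    pmfMean q (fun x => c * f x) = c * pmfMean q f := by
  simp only [pmfMean, Finset.mul_sum]
  exact Finset.sum_congr rfl fun x _ => by ring

theorem pmfMean_sum {κ : Type*} (q : PMF α) (s : Finset κ) (f : κ → α → ℝ) :
    pmfMean q (fun x => ∑ k ∈ s, f k x) = ∑ k ∈ s, pmfMean q (f k) := by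
  simp only [pmfMean, Finset.mul_sum]
  exact Finset.sum_comm

theorem sum_toReal_pmf (q : PMF α) : ∑ x, (q x).toReal = 1 := by
  rw [← ENNReal.toReal_sum fun x _ => q.apply_ne_top x, ← tsum_fintype (L := .unconditional α),
    q.tsum_coe, ENNReal.toReal_one]

theorem pmfMean_const (q : PMF α) (c : ℝ) : pmfMean q (fun _ => c) = c := by
  unfold pmfMean
  rw [← Finset.sum_mul, sum_toReal_pmf, one_mul]

theorem pmfMean_pure (x : α) (f : α → ℝ) : pmfMean (PMF.pure x) f = f x := by
  classical
  unfold pmfMean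
  rw [Finset.sum_eq_single x]
  · simp
  · intro y _ hy
    simp [PMF.pure_apply, hy]
  · simp

theorem pmfMean_bind (q : PMF α) (k : α → PMF β) (f : β → ℝ) :
    pmfMean (q.bind k) f = pmfMean q fun x => pmfMean (k x) f := by
  unfold pmfMean
  have h : ∀ y, ((q.bind k) y).toReal = ∑ x, (q x).toReal * (k x y).toReal := by
    intro y
    rw [PMF.bind_apply, tsum_fintype, ENNReal.toReal_sum]
    · simp only [ENNReal.toReal_mul]
    · exact fun x _ => ENNReal.mul_ne_top (q.apply_ne_top x) ((k x).apply_ne_top y)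
  simp only [h, Finset.sum_mul, Finset.mul_sum, mul_assoc]
  exact Finset.sum_comm

theorem pmfMean_uniformOfFintype [Nonempty α] (f : α → ℝ) :
    pmfMean (PMF.uniformOfFintype α) f = (Fintype.card α : ℝ)⁻¹ * ∑ x, f x := by
  unfold pmfMean
  rw [Finset.mul_sum]
  refine Finset.sum_congr rfl fun x _ => ?_
  rw [PMF.uniformOfFintype_apply, ENNReal.toReal_inv, ENNReal.toReal_natCast]

theorem pmfMean_uniformOfFinset (s : Finset α) (hs : s.Nonempty) (f : α → ℝ) :
    pmfMean (PMF.uniformOfFinset s hs) f = (s.card : ℝ)⁻¹ * ∑ x ∈ s, f x := by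
  classical
  unfold pmfMean
  rw [Finset.mul_sum, ← Finset.sum_subset (Finset.subset_univ s)]
  · refine Finset.sum_congr rfl fun x hx => ?_
    rw [PMF.uniformOfFinset_apply_of_mem hs hx, ENNReal.toReal_inv, ENNReal.toReal_natCast]
  · intro x _ hx
    rw [PMF.uniformOfFinset_apply_of_notMem hs hx, ENNReal.toReal_zero, zero_mul]

theorem pmfMean_biasedBit (f : Bool → ℝ) :
    pmfMean (biasedBit senderProb senderProb_le_one) f = 4 / 9 * f true + 5 / 9 * f false := by
  unfold pmfMean biasedBit
  rw [Fintype.sum_bool, PMF.ofFintype_apply, PMF.ofFintype_apply]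
  have h1 : ((senderProb : ℝ≥0∞)).toReal = 4 / 9 := by
    simp [senderProb]
  have h2 : (1 - (senderProb : ℝ≥0∞)).toReal = 5 / 9 := by
    rw [ENNReal.toReal_sub_of_le (by exact_mod_cast senderProb_le_one) ENNReal.one_ne_top, h1]
    norm_num
  simp only [if_true, h1, Bool.false_eq_true, if_false, h2]

end pmfMean

variable {A : Type*} {n : ℕ}

/-- The bit selected in round `v` by a receiver that has chosen the in-arc `e`, if the bit `b` was
selected at the source of `e`. -/
def forcedBit (d : Fin n → Decision A) (v : Fin n) (e : Fin n × A) (b : Bool) : Bool :=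
  open Classical in
  if (d e.1).pick b = e.2 then !decide (e.2 = (d v).pick true) else decide (e.2 = (d v).pick true)

/-- The round `i` is randomized. -/
def IsRandomized (d : Fin n → Decision A) (i : Fin n) : Prop :=
  ∃ a₁ a₂, d i = .rand a₁ a₂

theorem isRandomized_of_semiAssigns {d : Fin n → Decision A} {i : Fin n} {a : A}
    (h : (d i).SemiAssigns a) : IsRandomized d i := by
  unfold IsRandomized
  cases hd : d i with
  | det a' => rw [hd] at h; exact h.elim
  | rand a₁ a₂ => exact ⟨a₁, a₂, rfl⟩

/-- The expectation under the law of the outcomes of the first `m` rounds. -/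
def lawMean [Fintype A] (I : AdWords A n) (d : Fin n → Decision A) (m : ℕ)
    (f : (Fin n → Outcome) → ℝ) : ℝ :=
  pmfMean (outcomeLaw senderProb senderProb_le_one I d m) f

/-- The roles in the outcomes. -/
def roles (ω : Fin n → Outcome) : Fin n → Role := fun i => (ω i).1

/-- The in-arcs of `i` that are picked under the roles `τ`. -/
def pickedBy [Fintype A] (I : AdWords A n) (d : Fin n → Decision A) (τ : Fin n → Role)
    (i : Fin n) : Finset (Fin n × A) :=
  pickedInArcs I d (fun j => (τ j, true)) i

theorem isPickedArc_congr {I : AdWords A n} {d : Fin n → Decision A} {ω ω' : Fin n → Outcome}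
    {i' i : Fin n} {a : A} (h : ∀ j < i, (ω j).1 = (ω' j).1) :
    IsPickedArc I d ω i' i a ↔ IsPickedArc I d ω' i' i a := by
  unfold IsPickedArc
  refine and_congr_right fun harc => ?_
  rw [h i' harc.1.1]

theorem mem_pickedBy [Fintype A] {I : AdWords A n} {d : Fin n → Decision A} {τ : Fin n → Role}
    {i : Fin n} {e : Fin n × A} :
    e ∈ pickedBy I d τ i ↔ IsPickedArc I d (fun j => (τ j, true)) e.1 i e.2 := by
  simp [pickedBy, pickedInArcs]

theorem pickedInArcs_eq [Fintype A] (I : AdWords A n) (d : Fin n → Decision A)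
    (ω : Fin n → Outcome) (i : Fin n) : pickedInArcs I d ω i = pickedBy I d (roles ω) i := by
  ext e
  rw [mem_pickedBy]
  simp only [pickedInArcs, Finset.mem_filter, Finset.mem_univ, true_and]
  exact isPickedArc_congr fun j _ => rfl

theorem pickedBy_congr [Fintype A] {I : AdWords A n} {d : Fin n → Decision A}
    {τ τ' : Fin n → Role} {i : Fin n} (h : ∀ j < i, τ j = τ' j) :
    pickedBy I d τ i = pickedBy I d τ' i := by
  ext e
  rw [mem_pickedBy, mem_pickedBy]
  exact isPickedArc_congr h

theorem pickedBy_update [Fintype A] {I : AdWords A n} {d : Fin n → Decision A}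
    {τ : Fin n → Role} {i j : Fin n} (h : i ≤ j) (t : Role) :
    pickedBy I d (Function.update τ j t) i = pickedBy I d τ i :=
  pickedBy_congr fun _ hk => Function.update_of_ne (hk.trans_le h).ne _ _

theorem lt_of_mem_pickedBy [Fintype A] {I : AdWords A n} {d : Fin n → Decision A}
    {τ : Fin n → Role} {i : Fin n} {e : Fin n × A} (he : e ∈ pickedBy I d τ i) : e.1 < i :=
  (mem_pickedBy.1 he).1.1.1

theorem ne_none_of_mem_pickedBy [Fintype A] {I : AdWords A n} {d : Fin n → Decision A}
    {τ : Fin n → Role} {i : Fin n} {e : Fin n × A} (he : e ∈ pickedBy I d τ i) :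
    τ e.1 ≠ none := by
  obtain ⟨_, c, j, h, _⟩ := mem_pickedBy.1 he
  intro h'
  simp [h'] at h

theorem card_filter_isArc_lt {I : AdWords A n} {d : Fin n → Decision A} {u v v' : Fin n} {a : A}
    (hv : IsArc I d u v a) (hvv : v < v') :
    open Classical in
    (Finset.univ.filter fun i => i < v ∧ IsArc I d u i a).card <
      (Finset.univ.filter fun i => i < v' ∧ IsArc I d u i a).card := by
  classical
  refine Finset.card_lt_card (Finset.ssubset_iff_of_subset ?_ |>.2 ⟨v, ?_, ?_⟩)
  · intro i hi
    simp only [Finset.mem_filter, Finset.mem_univ, true_and] at hi ⊢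
    exact ⟨hi.1.trans hvv, hi.2⟩
  · simp [hvv, hv]
  · simp

/-- The number of an out-arc is its rank among the out-arcs of its source for `a`, so it determines
the target. -/
theorem eq_of_card_filter_isArc {I : AdWords A n} {d : Fin n → Decision A} {u v v' : Fin n}
    {a : A} (hv : IsArc I d u v a) (hv' : IsArc I d u v' a)
    (h : open Classical in (Finset.univ.filter fun i => i < v ∧ IsArc I d u i a).card =
      (Finset.univ.filter fun i => i < v' ∧ IsArc I d u i a).card) : v = v' := by
  rcases lt_trichotomy v v' with hl | hl | hl
  · exact absurd h (card_filter_isArc_lt hv hl).ne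
  · exact hl
  · exact absurd h (card_filter_isArc_lt hv' hl).ne'

/-- A sender picks a single pair of advertiser and rank, so it influences at most one later round.
-/
theorem eq_of_mem_pickedBy [Fintype A] {I : AdWords A n} {d : Fin n → Decision A}
    {τ : Fin n → Role} {v v' : Fin n} {e e' : Fin n × A} (he : e ∈ pickedBy I d τ v)
    (he' : e' ∈ pickedBy I d τ v') (h : e.1 = e'.1) : v = v' := by
  obtain ⟨h1, c, j, h2, h3, h4⟩ := mem_pickedBy.1 he
  obtain ⟨h1', c', j', h2', h3', h4'⟩ := mem_pickedBy.1 he'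
  rw [← h] at h1' h2' h3' h4'
  simp only at h2 h2'
  rw [h2] at h2'
  obtain ⟨rfl, rfl⟩ := Prod.mk.inj (Option.some_injective _ h2')
  rw [h3] at h3'
  rw [← h3'] at h1' h4'
  exact eq_of_card_filter_isArc h1 h1' (h4.trans h4'.symm)

theorem roles_update (ω : Fin n → Outcome) (i : Fin n) (o : Outcome) :
    roles (Function.update ω i o) = Function.update (roles ω) i o.1 := by
  funext j
  by_cases h : j = i
  · subst h; simp [roles]
  · simp [roles, h]

section lawMean

variable [Fintype A] {I : AdWords A n} {d : Fin n → Decision A}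

theorem lawMean_zero (f : (Fin n → Outcome) → ℝ) :
    lawMean I d 0 f = f fun _ => (none, true) :=
  pmfMean_pure _ _

theorem lawMean_succ_of_det {m : ℕ} (h : m < n) {a : A} (ha : d ⟨m, h⟩ = .det a)
    (f : (Fin n → Outcome) → ℝ) :
    lawMean I d (m + 1) f =
      lawMean I d m fun ω => f (Function.update ω ⟨m, h⟩ (none, true)) := by
  unfold lawMean
  rw [outcomeLaw, dif_pos h, pmfMean_bind]
  congr 1
  funext ω
  rw [pmfMean_bind, roundLaw, ha]
  simp only [pmfMean_pure]

/-- One-step expansion of the law. A sender picks each of its four potential arcs with total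
probability 4/9 · 1/4 = 1/9. -/
theorem lawMean_succ_of_rand {m : ℕ} (h : m < n) (hd : IsRandomized d ⟨m, h⟩)
    (f : (Fin n → Outcome) → ℝ) :
    lawMean I d (m + 1) f = lawMean I d m fun ω =>
      1 / 9 * ∑ e : Bool × Fin 2, 1 / 2 * ∑ b, f (Function.update ω ⟨m, h⟩ (some e, b)) +
      5 / 9 * if (pickedBy I d (roles ω) ⟨m, h⟩).Nonempty then
          ((pickedBy I d (roles ω) ⟨m, h⟩).card : ℝ)⁻¹ * ∑ e ∈ pickedBy I d (roles ω) ⟨m, h⟩,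
            f (Function.update ω ⟨m, h⟩ (none, forcedBit d ⟨m, h⟩ e (ω e.1).2))
        else 1 / 2 * ∑ b, f (Function.update ω ⟨m, h⟩ (none, b)) := by
  obtain ⟨a₁, a₂, hd⟩ := hd
  unfold lawMean
  rw [outcomeLaw, dif_pos h, pmfMean_bind]
  congr 1
  funext ω
  rw [pmfMean_bind, roundLaw, hd]
  simp only [pmfMean_pure, pmfMean_bind, pmfMean_biasedBit, if_true, Bool.false_eq_true, if_false,
    pmfMean_uniformOfFintype]
  rw [← pickedInArcs_eq]
  congr 1
  · simp only [Fintype.card_prod, Fintype.card_bool, Fintype.card_fin, Finset.mul_sum]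
    rw [Finset.sum_comm]
    refine Finset.sum_congr rfl fun e _ => Finset.sum_congr rfl fun b _ => ?_
    push_cast
    ring
  · congr 1
    split_ifs with hne
    · rw [pmfMean_bind, pmfMean_uniformOfFinset]
      have hpick : (d ⟨m, h⟩).pick true = a₁ := by rw [hd]; rfl
      subst hpick
      simp only [pmfMean_pure, forcedBit]
    · simp only [pmfMean_bind, pmfMean_uniformOfFintype, pmfMean_pure, Fintype.card_bool]
      norm_num

open Classical in
/-- The roles in the first `m` rounds are independent. -/
theorem lawMean_roles (m : ℕ) (hm : m ≤ n) (g : (Fin n → Role) → ℝ) :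
    lawMean I d m (fun ω => g (roles ω)) =
      roleMean (Finset.univ.filter fun i : Fin n => i.val < m ∧ IsRandomized d i) g := by
  induction m generalizing g with
  | zero =>
    rw [lawMean_zero]
    have : (Finset.univ.filter fun i : Fin n => i.val < 0 ∧ IsRandomized d i) = ∅ := by
      simp
    rw [this]
    refine (roleMean_const ∅ _).symm.trans (roleMean_congr fun τ hτ => ?_)
    congr 1
    funext i
    exact (hτ i (Finset.notMem_empty i)).symm
  | succ m ih =>
    have h : m < n := hm
    by_cases hr : IsRandomized d ⟨m, h⟩
    · have hmem : (⟨m, h⟩ : Fin n) ∈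
          Finset.univ.filter fun i : Fin n => i.val < m + 1 ∧ IsRandomized d i := by
        simp [hr]
      have herase : (Finset.univ.filter fun i : Fin n => i.val < m + 1 ∧ IsRandomized d i).erase
          ⟨m, h⟩ = Finset.univ.filter fun i : Fin n => i.val < m ∧ IsRandomized d i := by
        ext i
        simp only [Finset.mem_erase, Finset.mem_filter, Finset.mem_univ, true_and, ne_eq,
          Fin.ext_iff]
        constructor
        · rintro ⟨h1, h2, h3⟩
          exact ⟨by omega, h3⟩
        · rintro ⟨h1, h2⟩
          exact ⟨by omega, by omega, h2⟩
      rw [lawMean_succ_of_rand h hr, roleMean_erase hmem, herase]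
      have h1 : ∀ t, roleMean
          (Finset.univ.filter fun i : Fin n => i.val < m ∧ IsRandomized d i)
            (fun τ => g (Function.update τ ⟨m, h⟩ t)) =
          lawMean I d m fun ω => g (Function.update (roles ω) ⟨m, h⟩ t) := fun t =>
        (ih (by omega) fun τ => g (Function.update τ ⟨m, h⟩ t)).symm
      simp only [h1]
      unfold lawMean
      simp only [← pmfMean_const_mul]
      rw [← pmfMean_sum]
      congr 1
      funext ω
      rw [sum_roleMass_mul, add_comm]
      simp only [roles_update]
      congr 1
      · congr 1
        split_ifs with hne
        · rw [Finset.sum_const, nsmul_eq_mul, ← mul_assoc, inv_mul_cancel₀, one_mul]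
          exact_mod_cast hne.card_pos.ne'
        · rw [Fintype.sum_bool]; ring
      · congr 1
        refine Finset.sum_congr rfl fun e _ => ?_
        rw [Fintype.sum_bool]; ring
    · obtain ⟨a, ha⟩ : ∃ a, d ⟨m, h⟩ = .det a := by
        cases hd : d ⟨m, h⟩ with
        | det a => exact ⟨a, rfl⟩
        | rand a₁ a₂ => exact absurd ⟨a₁, a₂, hd⟩ hr
      have hset : (Finset.univ.filter fun i : Fin n => i.val < m + 1 ∧ IsRandomized d i) =
          Finset.univ.filter fun i : Fin n => i.val < m ∧ IsRandomized d i := by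
        ext i
        simp only [Finset.mem_filter, Finset.mem_univ, true_and]
        constructor
        · rintro ⟨h2, h3⟩
          refine ⟨?_, h3⟩
          have : i ≠ ⟨m, h⟩ := fun h4 => hr (h4 ▸ h3)
          rw [ne_eq, Fin.ext_iff] at this
          simp only at this
          omega
        · rintro ⟨h1, h2⟩
          exact ⟨by omega, h2⟩
      rw [lawMean_succ_of_det h ha, hset]
      simp only [roles_update]
      rw [ih (by omega) fun τ => g (Function.update τ ⟨m, h⟩ none)]
      refine roleMean_congr fun τ hτ => ?_
      rw [← hτ ⟨m, h⟩ (by simp), Function.update_eq_self]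

end lawMean

end AdWords
end

noncomputable section

namespace AdWords

variable {A : Type*} {n : ℕ}

/-! ### Prescribed selections in a set of rounds -/

/-- The indicator of the event that the selections in the rounds of `S` are given by `r`. -/
def bitsIndicator (S : Finset (Fin n)) (r : Fin n → Bool) (ω : Fin n → Outcome) : ℝ :=
  if ∀ v ∈ S, (ω v).2 = r v then 1 else 0

theorem bitsIndicator_nonneg (S : Finset (Fin n)) (r : Fin n → Bool) (ω : Fin n → Outcome) :
    0 ≤ bitsIndicator S r ω := by
  unfold bitsIndicator
  split_ifs <;> norm_num

theorem bitsIndicator_update_of_notMem {S : Finset (Fin n)} {i : Fin n} (h : i ∉ S)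
    (r : Fin n → Bool) (ω : Fin n → Outcome) (o : Outcome) :
    bitsIndicator S r (Function.update ω i o) = bitsIndicator S r ω := by
  unfold bitsIndicator
  refine if_congr (forall₂_congr fun v hv => ?_) rfl rfl
  rw [Function.update_of_ne]
  rintro rfl
  exact h hv

theorem bitsIndicator_eq_mul_erase {S : Finset (Fin n)} {i : Fin n} (h : i ∈ S)
    (r : Fin n → Bool) (ω : Fin n → Outcome) :
    bitsIndicator S r ω = (if (ω i).2 = r i then 1 else 0) * bitsIndicator (S.erase i) r ω := by
  have key : (∀ v ∈ S, (ω v).2 = r v) ↔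
      (ω i).2 = r i ∧ ∀ v ∈ S.erase i, (ω v).2 = r v := by
    conv_lhs => rw [← Finset.insert_erase h]
    exact Finset.forall_mem_insert _ _ _
  unfold bitsIndicator
  rw [if_congr key rfl rfl]
  split_ifs <;> simp_all

theorem bitsIndicator_update_of_mem {S : Finset (Fin n)} {i : Fin n} (h : i ∈ S)
    (r : Fin n → Bool) (ω : Fin n → Outcome) (o : Outcome) :
    bitsIndicator S r (Function.update ω i o) =
      (if o.2 = r i then 1 else 0) * bitsIndicator (S.erase i) r ω := by
  rw [bitsIndicator_eq_mul_erase h, Function.update_self,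
    bitsIndicator_update_of_notMem (Finset.notMem_erase i S)]

section

variable [Fintype A]

/-- The probability that round `v` is not correlated with an earlier round of `S`, given the roles
`τ`. -/
def linkFactor (I : AdWords A n) (d : Fin n → Decision A) (S : Finset (Fin n))
    (τ : Fin n → Role) (v : Fin n) : ℝ :=
  if τ v = none ∧ (pickedBy I d τ v).Nonempty then
    1 - (((pickedBy I d τ v).filter fun e => e.1 ∈ S).card : ℝ) / (pickedBy I d τ v).card
  else 1

/-- A bound for the conditional probability of prescribed selections in the rounds of `S`. -/
def selectionWeight (I : AdWords A n) (d : Fin n → Decision A) (S : Finset (Fin n))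
    (τ : Fin n → Role) : ℝ :=
  (1 / 2) ^ S.card * ∏ v ∈ S, linkFactor I d S τ v

/-- Rounds of `S` that are correlated under the roles `τ` cannot have the selections `r`. -/
def Conflicting (I : AdWords A n) (d : Fin n → Decision A) (S : Finset (Fin n))
    (r : Fin n → Bool) (τ : Fin n → Role) : Prop :=
  ∀ v ∈ S, τ v = none → ∀ e ∈ pickedBy I d τ v, e.1 ∈ S → forcedBit d v e (r e.1) ≠ r v

variable {I : AdWords A n} {d : Fin n → Decision A} {S S' : Finset (Fin n)} {τ : Fin n → Role}

theorem linkFactor_nonneg (v : Fin n) : 0 ≤ linkFactor I d S τ v := by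
  unfold linkFactor
  split_ifs with h
  · have h1 : (((pickedBy I d τ v).filter fun e => e.1 ∈ S).card : ℝ) ≤
        (pickedBy I d τ v).card := by
      exact_mod_cast Finset.card_filter_le _ _
    have h2 : (0 : ℝ) < (pickedBy I d τ v).card := by exact_mod_cast h.2.card_pos
    have := (div_le_one h2).2 h1
    linarith
  · exact zero_le_one

theorem linkFactor_anti {v : Fin n} (h : ∀ u < v, u ∈ S → u ∈ S') :
    linkFactor I d S' τ v ≤ linkFactor I d S τ v := by
  unfold linkFactor
  split_ifs
  · have h1 : ((pickedBy I d τ v).filter fun e => e.1 ∈ S).card ≤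
        ((pickedBy I d τ v).filter fun e => e.1 ∈ S').card := by
      refine Finset.card_le_card fun e he => ?_
      rw [Finset.mem_filter] at he ⊢
      exact ⟨he.1, h _ (lt_of_mem_pickedBy he.1) he.2⟩
    have h2 : (((pickedBy I d τ v).filter fun e => e.1 ∈ S).card : ℝ) ≤
        ((pickedBy I d τ v).filter fun e => e.1 ∈ S').card := by exact_mod_cast h1
    gcongr
  · exact le_rfl

theorem linkFactor_of_ne_none {v : Fin n} (h : τ v ≠ none) : linkFactor I d S τ v = 1 := by
  unfold linkFactor
  rw [if_neg fun h' => h h'.1]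

theorem linkFactor_update {v i : Fin n} (h : v < i) (t : Role) :
    linkFactor I d S (Function.update τ i t) v = linkFactor I d S τ v := by
  unfold linkFactor
  rw [pickedBy_update h.le, Function.update_of_ne h.ne]

theorem selectionWeight_nonneg : 0 ≤ selectionWeight I d S τ :=
  mul_nonneg (by positivity) (Finset.prod_nonneg fun v _ => linkFactor_nonneg v)

theorem selectionWeight_update_of_lt {i : Fin n} (h : ∀ v ∈ S, v < i) (t : Role) :
    selectionWeight I d S (Function.update τ i t) = selectionWeight I d S τ := by
  unfold selectionWeight
  rw [Finset.prod_congr rfl fun v hv => linkFactor_update (h v hv) t]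

/-- In-arcs come from earlier rounds. The latest round of `S` therefore occurs in no other factor
and splits off. -/
theorem selectionWeight_update_of_mem {i : Fin n} (hi : i ∈ S) (h : ∀ v ∈ S, v ≤ i) (t : Role) :
    selectionWeight I d S (Function.update τ i t) =
      1 / 2 * linkFactor I d S (Function.update τ i t) i *
        selectionWeight I d (S.erase i) τ := by
  unfold selectionWeight
  rw [← Finset.mul_prod_erase S _ hi]
  have hcard : S.card = (S.erase i).card + 1 := (Finset.card_erase_add_one hi).symm
  rw [hcard, pow_succ]
  have hprod : ∏ v ∈ S.erase i, linkFactor I d S (Function.update τ i t) v =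
      ∏ v ∈ S.erase i, linkFactor I d (S.erase i) τ v := by
    refine Finset.prod_congr rfl fun v hv => ?_
    have hvi : v < i := lt_of_le_of_ne (h v (Finset.mem_of_mem_erase hv))
      (Finset.ne_of_mem_erase hv)
    rw [linkFactor_update hvi]
    refine le_antisymm (linkFactor_anti fun u _ hu => Finset.mem_of_mem_erase hu)
      (linkFactor_anti fun u hu hS => Finset.mem_erase.2 ⟨(hu.trans hvi).ne, hS⟩)
  rw [hprod]
  ring

/-- A sender has a fresh bit, so its own link factor is 1. Its presence in `S` can only lower the
factors of the others. -/
theorem selectionWeight_insert_le {u : Fin n} (hu : u ∉ S) (h : τ u ≠ none) :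
    selectionWeight I d (insert u S) τ ≤ 1 / 2 * selectionWeight I d S τ := by
  unfold selectionWeight
  rw [Finset.card_insert_of_notMem hu, Finset.prod_insert hu, linkFactor_of_ne_none h, one_mul,
    pow_succ]
  have h1 : ∏ v ∈ S, linkFactor I d (insert u S) τ v ≤ ∏ v ∈ S, linkFactor I d S τ v :=
    Finset.prod_le_prod (fun v _ => linkFactor_nonneg v) fun v _ =>
      linkFactor_anti fun w _ hw => Finset.mem_insert_of_mem hw
  have h2 : (0 : ℝ) ≤ (1 / 2) ^ S.card := by positivity
  nlinarith [mul_le_mul_of_nonneg_left h1 h2]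

theorem Conflicting.erase {i : Fin n} {r : Fin n → Bool} {t : Role} (h : ∀ v ∈ S, v ≤ i)
    (hc : Conflicting I d S r (Function.update τ i t)) :
    Conflicting I d (S.erase i) r τ := by
  intro v hv hτ e he heS
  have hvi : v < i := lt_of_le_of_ne (h v (Finset.mem_of_mem_erase hv))
    (Finset.ne_of_mem_erase hv)
  refine hc v (Finset.mem_of_mem_erase hv) ?_ e ?_ (Finset.mem_of_mem_erase heS)
  · rwa [Function.update_of_ne hvi.ne]
  · rwa [pickedBy_update hvi.le]

/-- The added round is a sender, so it imposes no condition as a target. Its only picked arc leads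
to `i`, which lies after all of `S`, so it imposes none as a source. Its prescribed bit may hence be
arbitrary. -/
theorem Conflicting.insert {i : Fin n} {r : Fin n → Bool} (hc : Conflicting I d S r τ)
    {e : Fin n × A} (he : e ∈ pickedBy I d τ i) (hS : ∀ v ∈ S, v < i) (b : Bool) :
    Conflicting I d (insert e.1 S) (Function.update r e.1 b) τ := by
  intro v hv hτ e' he' heS
  have hne : τ e.1 ≠ none := ne_none_of_mem_pickedBy he
  have hve : v ≠ e.1 := by rintro rfl; exact hne hτ
  have hvS : v ∈ S := (Finset.mem_insert.1 hv).resolve_left hve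
  have hee : e'.1 ≠ e.1 := by
    intro h
    have := eq_of_mem_pickedBy he' he h
    exact (hS v hvS).ne this
  rw [Function.update_of_ne hve, Function.update_of_ne hee]
  exact hc v hvS hτ e' he' ((Finset.mem_insert.1 heS).resolve_left hee)

end

/-- The source has two distinct advertisers, exactly one of which is the advertiser of the arc. The
forced bit is thus an injective function of the source's bit, and a prescribed bit at the receiver
admits at most one bit at the source. -/
theorem exists_forcedBit {d : Fin n → Decision A}
    (hd : ∀ i a₁ a₂, d i = .rand a₁ a₂ → a₁ ≠ a₂) {i : Fin n}
    {e : Fin n × A} (hsemi : (d e.1).SemiAssigns e.2) (b : Bool) :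
    ∃ b', ∀ x, forcedBit d i e x = b → x = b' := by
  cases hde : d e.1 with
  | det a => rw [hde] at hsemi; exact hsemi.elim
  | rand a₁ a₂ =>
    have hne := hd _ _ _ hde
    rw [hde] at hsemi
    have hinj : forcedBit d i e true ≠ forcedBit d i e false := by
      unfold forcedBit
      rw [hde]
      rcases hsemi with h | h <;> simp [Decision.pick, h, hne, hne.symm]
    refine ⟨if forcedBit d i e true = b then true else false, fun x hx => ?_⟩
    cases x
    · rw [if_neg]
      rw [← hx]
      exact hinj
    · rw [if_pos hx]

end AdWords
end

/-! ### Induction over the rounds for the probability of prescribed selections -/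

noncomputable section

namespace AdWords

variable {A : Type*} {n : ℕ} [Fintype A] {I : AdWords A n} {d : Fin n → Decision A}

theorem lawMean_mono {m : ℕ} {f g : (Fin n → Outcome) → ℝ} (h : ∀ ω, f ω ≤ g ω) :
    lawMean I d m f ≤ lawMean I d m g :=
  pmfMean_mono _ h

theorem lawMean_add (m : ℕ) (f g : (Fin n → Outcome) → ℝ) :
    lawMean I d m (fun ω => f ω + g ω) = lawMean I d m f + lawMean I d m g :=
  pmfMean_add _ f g

theorem lawMean_const_mul (m : ℕ) (c : ℝ) (f : (Fin n → Outcome) → ℝ) :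
    lawMean I d m (fun ω => c * f ω) = c * lawMean I d m f :=
  pmfMean_const_mul _ c f

theorem lawMean_sum {κ : Type*} (m : ℕ) (s : Finset κ) (f : κ → (Fin n → Outcome) → ℝ) :
    lawMean I d m (fun ω => ∑ k ∈ s, f k ω) = ∑ k ∈ s, lawMean I d m (f k) :=
  pmfMean_sum _ s f

/-- The contribution of the choices of a receiver `i ∈ S` to the probability of prescribed
selections. -/
theorem receiver_sum_le {i : Fin n} {S : Finset (Fin n)} (hi : i ∈ S) {r : Fin n → Bool}
    {τ : Fin n → Role}
    (hc : Conflicting I d S r (Function.update τ i none)) {ω : Fin n → Outcome}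
    {b : Fin n × A → Bool}
    (hb : ∀ e ∈ pickedBy I d τ i, ∀ x, forcedBit d i e x = r i → x = b e) :
    ∑ e ∈ pickedBy I d τ i, bitsIndicator S r
        (Function.update ω i (none, forcedBit d i e (ω e.1).2)) ≤
      ∑ e ∈ (pickedBy I d τ i).filter (fun e => e.1 ∉ S),
        bitsIndicator (insert e.1 (S.erase i)) (Function.update r e.1 (b e)) ω := by
  rw [Finset.sum_filter]
  refine Finset.sum_le_sum fun e he => ?_
  have hei : e.1 ≠ i := (lt_of_mem_pickedBy he).ne
  rw [bitsIndicator_update_of_mem hi]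
  simp only
  by_cases h1 : forcedBit d i e (ω e.1).2 = r i
  · rw [if_pos h1, one_mul]
    -- A source inside `S` makes the prescribed bits contradictory. A source outside `S` takes the
    -- place of `i` in the set, with the bit that the arc forces on it.
    by_cases h2 : e.1 ∈ S
    · rw [if_neg (not_not.2 h2)]
      refine le_of_eq (if_neg fun hall => ?_)
      refine hc i hi (Function.update_self _ _ _) e (by rwa [pickedBy_update le_rfl]) h2 ?_
      rw [← hall e.1 (Finset.mem_erase.2 ⟨hei, h2⟩)]
      exact h1
    · rw [if_pos h2, bitsIndicator_eq_mul_erase (Finset.mem_insert_self _ _),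
        Function.update_self, if_pos (hb e he _ h1), one_mul,
        Finset.erase_insert (fun h => h2 (Finset.mem_of_mem_erase h))]
      refine le_of_eq (if_congr (forall₂_congr fun v hv => ?_) rfl rfl)
      rw [Function.update_of_ne]
      rintro rfl
      exact h2 (Finset.mem_of_mem_erase hv)
  · rw [if_neg h1, zero_mul]
    split_ifs
    · exact le_rfl
    · exact bitsIndicator_nonneg _ _ _

/-- Prescribed selections in a set `S` of randomized rounds have at most the probability that they
have if the selections are uniform and only correlations within `S` count. -/
theorem lawMean_mul_bitsIndicator_le
    (hd : ∀ i a₁ a₂, d i = .rand a₁ a₂ → a₁ ≠ a₂) (m : ℕ) (hm : m ≤ n) (S : Finset (Fin n))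
    (hS : ∀ v ∈ S, v.val < m ∧ IsRandomized d v) (r : Fin n → Bool) (g : (Fin n → Role) → ℝ)
    (hg : ∀ τ, 0 ≤ g τ) (hc : ∀ τ, g τ ≠ 0 → Conflicting I d S r τ) :
    lawMean I d m (fun ω => g (roles ω) * bitsIndicator S r ω) ≤
      lawMean I d m (fun ω => g (roles ω) * selectionWeight I d S (roles ω)) := by
  classical
  -- The weight `g` has to vary because events about roles, such as a given arc being picked, are
  -- absorbed into it. The set and the bits vary because receivers are replaced by their sources.
  induction m generalizing S r g with
  | zero =>
    have hS0 : S = ∅ := Finset.eq_empty_of_forall_notMem fun v hv => by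
      have := (hS v hv).1
      omega
    subst hS0
    simp [bitsIndicator, selectionWeight]
  | succ m ih =>
    have h : m < n := hm
    set i : Fin n := ⟨m, h⟩ with hi_def
    by_cases hr : IsRandomized d i
    · by_cases hi : i ∈ S
      · have hle : ∀ v ∈ S, v ≤ i := fun v hv => by
          have := (hS v hv).1
          exact Fin.le_def.2 (by rw [hi_def]; simp only; omega)
        have hS' : ∀ v ∈ S.erase i, v.val < m ∧ IsRandomized d v := fun v hv =>
          ⟨Fin.lt_def.1 (lt_of_le_of_ne (hle v (Finset.mem_of_mem_erase hv))
            (Finset.ne_of_mem_erase hv)), (hS v (Finset.mem_of_mem_erase hv)).2⟩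
        have hlt : ∀ v ∈ S.erase i, v < i := fun v hv => (hS' v hv).1
        have hex : ∀ e : Fin n × A, ∃ b, (d e.1).SemiAssigns e.2 →
            ∀ x, forcedBit d i e x = r i → x = b := fun e => by
          by_cases he : (d e.1).SemiAssigns e.2
          · obtain ⟨b, hb⟩ := exists_forcedBit hd he (r i)
            exact ⟨b, fun _ => hb⟩
          · exact ⟨true, fun h => absurd h he⟩
        choose b hb using hex
        have hb' : ∀ τ, ∀ e ∈ pickedBy I d τ i, ∀ x, forcedBit d i e x = r i → x = b e :=
          fun τ e he => hb e (mem_pickedBy.1 he).1.1.2.1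
        set G : Role → (Fin n → Role) → ℝ := fun t τ => g (Function.update τ i t) with hG
        -- The weight for `i` being a receiver without picked in-arcs. In `G₁ e` below, `i` is a
        -- receiver that chooses the arc `e`, whose source lies outside `S`.
        set G₀ : (Fin n → Role) → ℝ := fun τ =>
          if (pickedBy I d τ i).Nonempty then 0 else G none τ with hG₀
        set G₁ : Fin n × A → (Fin n → Role) → ℝ := fun e τ =>
          if e ∈ pickedBy I d τ i ∧ e.1 ∉ S then
            ((pickedBy I d τ i).card : ℝ)⁻¹ * G none τ else 0 with hG₁
        have hcE : ∀ t τ, G t τ ≠ 0 → Conflicting I d (S.erase i) r τ := fun t τ hne =>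
          (hc _ hne).erase hle
        have ih1 : ∀ t, lawMean I d m (fun ω => G t (roles ω) * bitsIndicator (S.erase i) r ω) ≤
            lawMean I d m (fun ω => G t (roles ω) * selectionWeight I d (S.erase i) (roles ω)) :=
          fun t => ih (by omega) _ hS' r (G t) (fun τ => hg _) (hcE t)
        have ih0 : lawMean I d m (fun ω => G₀ (roles ω) * bitsIndicator (S.erase i) r ω) ≤
            lawMean I d m (fun ω => G₀ (roles ω) * selectionWeight I d (S.erase i) (roles ω)) := by
          refine ih (by omega) _ hS' r G₀ (fun τ => ?_) (fun τ hne => hcE none τ fun h0 => hne ?_)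
          · simp only [hG₀]
            split_ifs
            · exact le_rfl
            · exact hg _
          · simp only [hG₀, h0, ite_self]
        have ih2 : ∀ e, lawMean I d m (fun ω => G₁ e (roles ω) *
              bitsIndicator (insert e.1 (S.erase i)) (Function.update r e.1 (b e)) ω) ≤
            lawMean I d m (fun ω => G₁ e (roles ω) *
              selectionWeight I d (insert e.1 (S.erase i)) (roles ω)) := by
          intro e
          by_cases he : ∃ τ, e ∈ pickedBy I d τ i
          · obtain ⟨τ₀, he⟩ := he
            refine ih (by omega) _ ?_ _ (G₁ e) (fun τ => ?_) fun τ hne => ?_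
            · intro v hv
              rcases Finset.mem_insert.1 hv with rfl | hv
              · exact ⟨Fin.lt_def.1 (lt_of_mem_pickedBy he),
                  isRandomized_of_semiAssigns (mem_pickedBy.1 he).1.1.2.1⟩
              · exact hS' v hv
            · simp only [hG₁]
              split_ifs
              · exact mul_nonneg (by positivity) (hg _)
              · exact le_rfl
            · simp only [hG₁] at hne
              split_ifs at hne with hmem
              · exact (hcE none τ (right_ne_zero_of_mul hne)).insert hmem.1 hlt _
              · exact absurd rfl hne
          · have h0 : ∀ τ, G₁ e τ = 0 := fun τ => if_neg fun h => he ⟨τ, h.1⟩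
            simp only [h0, zero_mul]
            exact le_rfl
        -- The constants are 1/18 = 1/9 · 1/2 for a sender and 5/18 = 5/9 · 1/2 for a receiver with
        -- a fresh bit. A forced receiver carries 5/9, and its factor 1/2 comes later from the
        -- source put into the set.
        calc lawMean I d (m + 1) (fun ω => g (roles ω) * bitsIndicator S r ω)
            ≤ lawMean I d m (fun ω =>
                (∑ e : Bool × Fin 2, 1 / 18 * (G (some e) (roles ω) *
                  bitsIndicator (S.erase i) r ω)) +
                (5 / 18 * (G₀ (roles ω) * bitsIndicator (S.erase i) r ω) +
                ∑ e : Fin n × A, 5 / 9 * (G₁ e (roles ω) * bitsIndicator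
                  (insert e.1 (S.erase i)) (Function.update r e.1 (b e)) ω))) := by
              rw [lawMean_succ_of_rand h hr]
              refine lawMean_mono fun ω => ?_
              simp only [roles_update, ← hi_def]
              refine add_le_add (le_of_eq ?_) ?_
              · rw [Finset.mul_sum]
                refine Finset.sum_congr rfl fun e _ => ?_
                simp only [bitsIndicator_update_of_mem hi, hG]
                rw [Fintype.sum_bool]
                cases r i <;> simp <;> ring
              · by_cases hne : (pickedBy I d (roles ω) i).Nonempty
                · rw [if_pos hne]
                  by_cases hG0 : G none (roles ω) = 0
                  · have h1 : ∀ e, G₁ e (roles ω) = 0 := fun e => by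
                      simp only [hG₁, hG0, mul_zero, ite_self]
                    have h2 : G₀ (roles ω) = 0 := by simp only [hG₀, if_pos hne]
                    simp only [h1, h2]
                    simp only [hG] at hG0
                    simp [hG0]
                  · have hsum := receiver_sum_le hi (hc _ hG0) (ω := ω) (hb' (roles ω))
                    have h2 : G₀ (roles ω) = 0 := by simp only [hG₀, if_pos hne]
                    have h3 : ∑ e : Fin n × A, G₁ e (roles ω) * bitsIndicator
                        (insert e.1 (S.erase i)) (Function.update r e.1 (b e)) ω =
                        ((pickedBy I d (roles ω) i).card : ℝ)⁻¹ * G none (roles ω) *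
                          ∑ e ∈ (pickedBy I d (roles ω) i).filter (fun e => e.1 ∉ S),
                            bitsIndicator (insert e.1 (S.erase i))
                              (Function.update r e.1 (b e)) ω := by
                      rw [Finset.mul_sum, ← Finset.sum_subset (Finset.subset_univ
                        ((pickedBy I d (roles ω) i).filter (fun e => e.1 ∉ S)))]
                      · refine Finset.sum_congr rfl fun e he => ?_
                        simp only [hG₁]
                        rw [if_pos (Finset.mem_filter.1 he)]
                      · intro e _ he
                        simp only [hG₁]
                        rw [if_neg fun h => he (Finset.mem_filter.2 h), zero_mul]
                    rw [h2, zero_mul, mul_zero, zero_add, ← Finset.mul_sum, ← Finset.mul_sum, h3,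
                      ← mul_assoc (_⁻¹)]
                    exact mul_le_mul_of_nonneg_left (mul_le_mul_of_nonneg_left hsum
                      (mul_nonneg (by positivity) (hg _))) (by norm_num)
                · have h1 : ∀ e, G₁ e (roles ω) = 0 := fun e =>
                    if_neg fun h => hne ⟨e, h.1⟩
                  have h2 : G₀ (roles ω) = G none (roles ω) := if_neg hne
                  rw [if_neg hne, h2]
                  simp only [h1, zero_mul, mul_zero, Finset.sum_const_zero, add_zero,
                    bitsIndicator_update_of_mem hi, hG]
                  rw [Fintype.sum_bool]
                  refine le_of_eq ?_
                  cases r i <;> simp <;> ring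
          _ ≤ lawMean I d m (fun ω =>
                (∑ e : Bool × Fin 2, 1 / 18 * (G (some e) (roles ω) *
                  selectionWeight I d (S.erase i) (roles ω))) +
                (5 / 18 * (G₀ (roles ω) * selectionWeight I d (S.erase i) (roles ω)) +
                ∑ e : Fin n × A, 5 / 9 * (G₁ e (roles ω) * selectionWeight I d
                  (insert e.1 (S.erase i)) (roles ω)))) := by
              simp only [lawMean_add, lawMean_sum, lawMean_const_mul]
              refine add_le_add (Finset.sum_le_sum fun e _ => ?_)
                (add_le_add ?_ (Finset.sum_le_sum fun e _ => ?_))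
              · exact mul_le_mul_of_nonneg_left (ih1 _) (by norm_num)
              · exact mul_le_mul_of_nonneg_left ih0 (by norm_num)
              · exact mul_le_mul_of_nonneg_left (ih2 _) (by norm_num)
          _ ≤ _ := by
              rw [lawMean_succ_of_rand h hr]
              refine lawMean_mono fun ω => ?_
              simp only [roles_update, ← hi_def]
              set W := selectionWeight I d (S.erase i) (roles ω) with hW
              have hW0 : 0 ≤ W := selectionWeight_nonneg
              refine add_le_add (le_of_eq ?_) ?_
              · rw [Finset.mul_sum]
                refine Finset.sum_congr rfl fun e _ => ?_
                rw [Fintype.sum_bool, selectionWeight_update_of_mem hi hle,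
                  linkFactor_of_ne_none (by simp)]
                simp only [hG]
                ring
              · rw [selectionWeight_update_of_mem hi hle]
                set P := pickedBy I d (roles ω) i with hP
                have hP' : pickedBy I d (Function.update (roles ω) i none) i = P :=
                  pickedBy_update le_rfl _
                by_cases hne : P.Nonempty
                · have h2 : G₀ (roles ω) = 0 := if_pos hne
                  have hcard : (0 : ℝ) < P.card := by exact_mod_cast hne.card_pos
                  -- The link factor is the share of the picked in-arcs with source outside `S`, and
                  -- only these survived above. Each contributes half of the remaining weight, so
                  -- the two sides match.
                  have hlf : linkFactor I d S (Function.update (roles ω) i none) i =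
                      (P.card : ℝ)⁻¹ * (P.filter fun e => e.1 ∉ S).card := by
                    unfold linkFactor
                    rw [hP', if_pos ⟨Function.update_self _ _ _, hne⟩]
                    have := Finset.card_filter_add_card_filter_not (s := P) (fun e => e.1 ∈ S)
                    rw [← this]
                    rw [← this] at hcard
                    push_cast at hcard ⊢
                    field_simp
                    ring
                  rw [if_pos hne, h2, zero_mul, mul_zero, zero_add, Finset.sum_const,
                    nsmul_eq_mul, inv_mul_cancel_left₀ hcard.ne', ← Finset.mul_sum, hlf,
                    ← Finset.sum_subset (Finset.subset_univ (P.filter fun e => e.1 ∉ S))]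
                  · refine mul_le_mul_of_nonneg_left ?_ (by norm_num)
                    calc _ ≤ ∑ _e ∈ P.filter (fun e => e.1 ∉ S),
                          (P.card : ℝ)⁻¹ * G none (roles ω) * (1 / 2 * W) := by
                          refine Finset.sum_le_sum fun e he => ?_
                          have he' := Finset.mem_filter.1 he
                          simp only [hG₁]
                          rw [if_pos he']
                          refine mul_le_mul_of_nonneg_left ?_ (mul_nonneg (by positivity) (hg _))
                          exact selectionWeight_insert_le
                            (fun h' => he'.2 (Finset.mem_of_mem_erase h'))
                            (ne_none_of_mem_pickedBy he'.1)
                      _ = _ := by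
                          rw [Finset.sum_const, nsmul_eq_mul]
                          simp only [hG]
                          ring
                  · intro e _ he
                    have : G₁ e (roles ω) = 0 := if_neg fun h => he (Finset.mem_filter.2 h)
                    rw [this, zero_mul]
                · have h1 : ∀ e, G₁ e (roles ω) = 0 := fun e =>
                    if_neg fun h => hne ⟨e, h.1⟩
                  have h2 : G₀ (roles ω) = G none (roles ω) := if_neg hne
                  have hlf : linkFactor I d S (Function.update (roles ω) i none) i = 1 := by
                    unfold linkFactor
                    rw [hP', if_neg fun h' => hne h'.2]
                  rw [if_neg hne, h2, hlf, Fintype.sum_bool]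
                  simp only [h1, zero_mul, mul_zero, Finset.sum_const_zero, add_zero, hG]
                  refine le_of_eq ?_
                  ring
      -- Neither the prescribed bits nor the selection weight involve round `i`. Only its role
      -- matters, through `g`, and it is averaged out.
      · have hlt : ∀ v ∈ S, v < i := fun v hv => lt_of_le_of_ne
          (Fin.le_def.2 (by have := (hS v hv).1; rw [hi_def]; simp only; omega))
          (fun h' => hi (h' ▸ hv))
        have hS' : ∀ v ∈ S, v.val < m ∧ IsRandomized d v := fun v hv =>
          ⟨Fin.lt_def.1 (hlt v hv), (hS v hv).2⟩
        have ih1 : ∀ t, lawMean I d m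
              (fun ω => g (Function.update (roles ω) i t) * bitsIndicator S r ω) ≤
            lawMean I d m (fun ω => g (Function.update (roles ω) i t) *
              selectionWeight I d S (roles ω)) := fun t => by
          refine ih (by omega) _ hS' r (fun τ => g (Function.update τ i t)) (fun τ => hg _)
            fun τ hne => ?_
          have := (hc _ hne).erase (i := i) (fun v hv => (hlt v hv).le)
          rwa [Finset.erase_eq_of_notMem hi] at this
        have expand : ∀ F : (Fin n → Outcome) → ℝ, (∀ ω o, F (Function.update ω i o) = F ω) →
            lawMean I d (m + 1) (fun ω => g (roles ω) * F ω) = ∑ t, roleMass t *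
              lawMean I d m (fun ω => g (Function.update (roles ω) i t) * F ω) := by
          intro F hF
          rw [lawMean_succ_of_rand h hr]
          simp only [← lawMean_const_mul, ← lawMean_sum]
          congr 1
          funext ω
          rw [sum_roleMass_mul, add_comm]
          simp only [roles_update, ← hi_def, hF]
          congr 1
          · congr 1
            split_ifs with hne
            · rw [Finset.sum_const, nsmul_eq_mul, ← mul_assoc, inv_mul_cancel₀, one_mul]
              exact_mod_cast hne.card_pos.ne'
            · rw [Fintype.sum_bool]; ring
          · congr 1
            refine Finset.sum_congr rfl fun e _ => ?_
            rw [Fintype.sum_bool]; ring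
        rw [expand _ fun ω o => bitsIndicator_update_of_notMem hi r ω o,
          expand _ fun ω o => by rw [roles_update, selectionWeight_update_of_lt hlt]]
        exact Finset.sum_le_sum fun t _ => mul_le_mul_of_nonneg_left (ih1 t) (roleMass_nonneg t)
    · obtain ⟨a, ha⟩ : ∃ a, d i = .det a := by
        cases hd : d i with
        | det a => exact ⟨a, rfl⟩
        | rand a₁ a₂ => exact absurd ⟨a₁, a₂, hd⟩ hr
      have hi : i ∉ S := fun hi => hr (hS i hi).2
      have hlt : ∀ v ∈ S, v < i := fun v hv => lt_of_le_of_ne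
        (Fin.le_def.2 (by have := (hS v hv).1; rw [hi_def]; simp only; omega))
        (fun h' => hi (h' ▸ hv))
      rw [lawMean_succ_of_det h ha, lawMean_succ_of_det h ha]
      simp only [roles_update, ← hi_def, bitsIndicator_update_of_notMem hi,
        selectionWeight_update_of_lt hlt]
      refine ih (by omega) S (fun v hv => ⟨Fin.lt_def.1 (hlt v hv), (hS v hv).2⟩) r
        (fun τ => g (Function.update τ i none)) (fun τ => hg _) fun τ hne => ?_
      have := (hc _ hne).erase (i := i) (fun v hv => (hlt v hv).le)
      rwa [Finset.erase_eq_of_notMem hi] at this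

end AdWords
end

noncomputable section

namespace AdWords

variable {A : Type*} {n : ℕ} {I : AdWords A n} {d : Fin n → Decision A}

/-! ### The guarantee of the correlated selection -/

open Classical in
/-- The dependence graph has in-degrees and out-degrees at most two for every advertiser. -/
structure HasBoundedDegrees (I : AdWords A n) (d : Fin n → Decision A) : Prop where
  in_le : ∀ v a, (Finset.univ.filter fun u => IsArc I d u v a).card ≤ 2
  out_lt : ∀ {u v a}, IsArc I d u v a →
    (Finset.univ.filter fun i => i < v ∧ IsArc I d u i a).card < 2

open Classical in
/-- The in-arcs of `v`, given by their sources and their numbers there. -/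
def codedInArcs (I : AdWords A n) (d : Fin n → Decision A) (v : Fin n) :
    Finset (Fin n × (Bool × Fin 2)) :=
  Finset.univ.filter fun e => IsArc I d e.1 v ((d e.1).pick e.2.1) ∧
    (Finset.univ.filter fun i => i < v ∧ IsArc I d e.1 i ((d e.1).pick e.2.1)).card =
      (e.2.2 : ℕ)

theorem mem_codedInArcs {v : Fin n} {e : Fin n × (Bool × Fin 2)} :
    e ∈ codedInArcs I d v ↔ IsArc I d e.1 v ((d e.1).pick e.2.1) ∧
      open Classical in
      (Finset.univ.filter fun i => i < v ∧ IsArc I d e.1 i ((d e.1).pick e.2.1)).card =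
      (e.2.2 : ℕ) := by
  simp [codedInArcs]

theorem pick_injective (hd : ∀ i a₁ a₂, d i = .rand a₁ a₂ → a₁ ≠ a₂) {i : Fin n}
    (hi : IsRandomized d i) : Function.Injective (d i).pick := by
  obtain ⟨a₁, a₂, h⟩ := hi
  have hne := hd i a₁ a₂ h
  intro b b' hb
  rw [h] at hb
  cases b <;> cases b' <;> simp_all [Decision.pick]

theorem exists_pick_eq {i : Fin n} {a : A} (h : (d i).SemiAssigns a) :
    ∃ b, (d i).pick b = a := by
  cases hi : d i with
  | det a' => rw [hi] at h; exact h.elim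
  | rand a₁ a₂ =>
    rw [hi] at h
    rcases h with h | h
    · exact ⟨true, h.symm⟩
    · exact ⟨false, h.symm⟩

theorem pick_eq_of_ne {D : Decision A} {x y : A} (hx : D.SemiAssigns x) (hy : D.SemiAssigns y)
    (hxy : x ≠ y) {b : Bool} (hb : D.pick b ≠ x) : D.pick b = y := by
  cases D with
  | det a => exact hx.elim
  | rand a₁ a₂ => cases b <;> rcases hx with rfl | rfl <;> rcases hy with rfl | rfl <;>
      simp_all [Decision.pick]

open Classical in
theorem pick_decide {D : Decision A} {x : A} (hx : D.SemiAssigns x) :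
    D.pick (decide (x = D.pick true)) = x := by
  cases D with
  | det a => exact hx.elim
  | rand a₁ a₂ =>
    by_cases h : x = a₁
    · simp [Decision.pick, h]
    · simpa [Decision.pick, hx.resolve_left h] using Eq.symm

open Classical in
theorem pick_not_decide {D : Decision A} (hD : Function.Injective D.pick) (x : A) :
    D.pick (!decide (x = D.pick true)) ≠ x := by
  by_cases h : x = D.pick true
  · simp only [h, decide_true, Bool.not_true]
    exact fun h' => by simpa using hD h'
  · simp only [h, decide_false, Bool.not_false]
    exact fun h' => h h'.symm

/-- Two advertisers with at most two in-arcs each. Distinct codes give distinct arcs, since the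
advertiser fixes the Boolean and the rank fixes the number. -/
theorem card_codedInArcs_le (hd : ∀ i a₁ a₂, d i = .rand a₁ a₂ → a₁ ≠ a₂)
    (h : HasBoundedDegrees I d) (v : Fin n) : (codedInArcs I d v).card ≤ 4 := by
  classical
  by_cases hv : IsRandomized d v
  · obtain ⟨a₁, a₂, hv⟩ := hv
    calc (codedInArcs I d v).card
        ≤ ((Finset.univ.filter fun u => IsArc I d u v a₁).image (fun u => (u, a₁)) ∪
            (Finset.univ.filter fun u => IsArc I d u v a₂).image (fun u => (u, a₂))).card := by
          refine Finset.card_le_card_of_injOn (fun e => (e.1, (d e.1).pick e.2.1)) ?_ ?_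
          · intro e he
            obtain ⟨h1, -⟩ := mem_codedInArcs.1 (Finset.mem_coe.1 he)
            have h2 := h1.1.2.2.1
            rw [hv] at h2
            rw [Finset.mem_coe, Finset.mem_union]
            rcases h2 with h2 | h2
            · exact Or.inl (Finset.mem_image.2
                ⟨e.1, Finset.mem_filter.2 ⟨Finset.mem_univ _, h2 ▸ h1⟩, by simp only [h2]⟩)
            · exact Or.inr (Finset.mem_image.2
                ⟨e.1, Finset.mem_filter.2 ⟨Finset.mem_univ _, h2 ▸ h1⟩, by simp only [h2]⟩)
          · intro e he e' he' hee
            obtain ⟨h1, h2⟩ := mem_codedInArcs.1 (Finset.mem_coe.1 he)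
            obtain ⟨h1', h2'⟩ := mem_codedInArcs.1 (Finset.mem_coe.1 he')
            obtain ⟨u, c, j⟩ := e
            obtain ⟨u', c', j'⟩ := e'
            simp only [Prod.mk.injEq] at hee h1 h2 h1' h2' ⊢
            obtain ⟨rfl, h3⟩ := hee
            have hc := pick_injective hd (isRandomized_of_semiAssigns h1.1.2.1) h3
            subst hc
            exact ⟨rfl, rfl, Fin.ext (h2.symm.trans h2')⟩
      _ ≤ 2 + 2 := (Finset.card_union_le _ _).trans (add_le_add
          (Finset.card_image_le.trans (h.in_le _ _)) (Finset.card_image_le.trans (h.in_le _ _)))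
  · have : codedInArcs I d v = ∅ := Finset.eq_empty_of_forall_notMem fun e he =>
      hv (isRandomized_of_semiAssigns (mem_codedInArcs.1 he).1.1.2.2.1)
    rw [this]
    simp

variable [Fintype A]

theorem card_pickedBy_le (τ : Fin n → Role) (v : Fin n) :
    (pickedBy I d τ v).card ≤ pickedCount (codedInArcs I d) v τ := by
  -- The default value is never used, because the source of a picked arc is a sender.
  refine Finset.card_le_card_of_injOn (fun e => (e.1, (τ e.1).getD (true, 0))) ?_ ?_
  · intro e he
    obtain ⟨h1, c, j, h2, h3, h4⟩ := mem_pickedBy.1 (Finset.mem_coe.1 he)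
    simp only at h2
    have h5 : (e.1, (c, j)) ∈ codedInArcs I d v := by
      rw [mem_codedInArcs]
      simp only
      rw [h3]
      exact ⟨h1, h4⟩
    rw [Finset.mem_coe, Finset.mem_filter]
    simp only [h2, Option.getD_some]
    exact ⟨h5, trivial⟩
  · intro e he e' he' hee
    obtain ⟨h1, c, j, h2, h3, h4⟩ := mem_pickedBy.1 (Finset.mem_coe.1 he)
    obtain ⟨h1', c', j', h2', h3', h4'⟩ := mem_pickedBy.1 (Finset.mem_coe.1 he')
    simp only at h2 h2'
    simp only [h2, h2', Option.getD_some, Prod.mk.injEq] at hee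
    refine Prod.ext hee.1 ?_
    rw [← h3, ← h3', hee.1, hee.2.1]

/-- Along a path of `K + 1` rounds that are consecutive for `a`, all rounds fail to select `a` with
probability at most `2 ^ (-(K + 1)) * (1 - 0.05144) ^ K`. -/
theorem lawMean_bitsIndicator_le (hd : ∀ i a₁ a₂, d i = .rand a₁ a₂ → a₁ ≠ a₂)
    (hdeg : HasBoundedDegrees I d) {a : A} {K : ℕ} {p : ℕ → Fin n}
    (hsemi : ∀ j ≤ K, (d (p j)).SemiAssigns a)
    (harc : ∀ j < K, IsArc I d (p j) (p (j + 1)) a) {r : Fin n → Bool}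
    (hr : ∀ v, (d v).SemiAssigns a → (d v).pick (r v) ≠ a) :
    lawMean I d n (bitsIndicator ((Finset.range (K + 1)).image p) r) ≤
      (1 / 2) ^ (K + 1) * (1 - 0.05144) ^ K := by
  classical
  have hcode : ∀ j, ∃ c : Bool × Fin 2, j < K →
      (d (p j)).pick c.1 = a ∧
        (Finset.univ.filter fun i => i < p (j + 1) ∧ IsArc I d (p j) i a).card = (c.2 : ℕ) := by
    intro j
    by_cases hj : j < K
    · obtain ⟨b, hb⟩ := exists_pick_eq (hsemi j hj.le)
      exact ⟨(b, ⟨_, hdeg.out_lt (harc j hj)⟩), fun _ => ⟨hb, rfl⟩⟩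
    · exact ⟨(true, 0), fun h => absurd h hj⟩
  choose c hc using hcode
  have hlt : ∀ {i j}, i < j → j ≤ K → p i < p j := by
    intro i j hij hj
    induction j, hij using Nat.le_induction with
    | base => exact (harc i (by omega)).1.1
    | succ j hij ih => exact (ih (by omega)).trans (harc j (by omega)).1.1
  have hpath : IsLinkedPath (codedInArcs I d) p c K := by
    refine ⟨?_, card_codedInArcs_le hd hdeg, ?_, hlt, ?_⟩
    · intro v v' e he he'
      obtain ⟨h1, h2⟩ := mem_codedInArcs.1 he
      obtain ⟨h1', h2'⟩ := mem_codedInArcs.1 he'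
      exact eq_of_card_filter_isArc h1 h1' (h2.trans h2'.symm)
    · intro v e he
      exact (mem_codedInArcs.1 he).1.1.1
    · intro j hj
      rw [mem_codedInArcs]
      simp only
      rw [(hc j hj).1]
      exact ⟨harc j hj, (hc j hj).2⟩
  set S := (Finset.range (K + 1)).image p with hS
  have hinj : Set.InjOn p (Finset.range (K + 1)) := by
    intro i hi j hj hij
    rw [Finset.mem_coe, Finset.mem_range] at hi hj
    exact hpath.injOn (by omega) (by omega) hij
  have hSsemi : ∀ v ∈ S, (d v).SemiAssigns a := by
    intro v hv
    obtain ⟨j, hj, rfl⟩ := Finset.mem_image.1 hv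
    exact hsemi j (Nat.lt_succ_iff.1 (Finset.mem_range.1 hj))
  -- Any chosen arc between two rounds that are both semi-assigned to `a` forbids missing `a` twice.
  -- For an arc with respect to `a` this is the rule of the receiver. Otherwise both rounds have the
  -- same two advertisers: the source selects the other one, so the receiver selects `a`.
  have hconf : ∀ τ, Conflicting I d S r τ := by
    intro τ v hv _ e he heS heq
    have hv' := hSsemi v hv
    have he' := hSsemi e.1 heS
    have harce := (mem_pickedBy.1 he).1.1
    have hrv := hr v hv'
    have hre := hr e.1 he'
    rw [← heq] at hrv
    have hsv := harce.2.2.1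
    have hse := harce.2.1
    unfold forcedBit at hrv
    by_cases hea : e.2 = a
    · rw [hea, if_neg hre] at hrv
      exact hrv (pick_decide hv')
    · rw [if_pos (pick_eq_of_ne he' hse (Ne.symm hea) hre)] at hrv
      exact hrv (pick_eq_of_ne hsv hv' hea
        (pick_not_decide (pick_injective hd (isRandomized_of_semiAssigns hv')) _))
  have h1 := lawMean_mul_bitsIndicator_le hd n le_rfl S
    (fun v hv => ⟨v.2, isRandomized_of_semiAssigns (hSsemi v hv)⟩) r (fun _ => 1)
    (fun _ => zero_le_one) (fun τ _ => hconf τ) (I := I)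
  simp only [one_mul] at h1
  refine h1.trans ?_
  have h2 : ∀ τ, selectionWeight I d S τ ≤
      (1 / 2) ^ (K + 1) * pathWeight (codedInArcs I d) p c (Finset.range K) τ := by
    intro τ
    unfold selectionWeight
    rw [hS, Finset.card_image_of_injOn hinj, Finset.card_range, Finset.prod_image hinj,
      Finset.prod_range_succ']
    refine mul_le_mul_of_nonneg_left ?_ (by positivity)
    have hone : ∀ v, linkFactor I d S τ v ≤ 1 := fun v =>
      (linkFactor_anti (S := ∅) (S' := S) (by simp)).trans (by unfold linkFactor; simp)
    -- The factor of the first round of the path is dropped. For each other round only the in-arc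
    -- from its predecessor on the path is used.
    refine (mul_le_of_le_one_right (Finset.prod_nonneg fun j _ => linkFactor_nonneg _)
      (hone _)).trans (Finset.prod_le_prod (fun j _ => linkFactor_nonneg _) fun j hj => ?_)
    have hj : j < K := Finset.mem_range.1 hj
    unfold linkWeight
    split_ifs with hcond
    · have hmem : (p j, a) ∈ pickedBy I d τ (p (j + 1)) := mem_pickedBy.2
        ⟨harc j hj, (c j).1, (c j).2, hcond.2, (hc j hj).1, (hc j hj).2⟩
      have hmem' : (p j, a) ∈ (pickedBy I d τ (p (j + 1))).filter fun e => e.1 ∈ S :=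
        Finset.mem_filter.2 ⟨hmem, Finset.mem_image.2 ⟨j, Finset.mem_range.2 (by omega), rfl⟩⟩
      unfold linkFactor
      rw [if_pos ⟨hcond.1, _, hmem⟩]
      have h3 : (1 : ℝ) ≤ ((pickedBy I d τ (p (j + 1))).filter fun e => e.1 ∈ S).card := by
        exact_mod_cast Finset.card_pos.2 ⟨_, hmem'⟩
      have h4 : (0 : ℝ) < (pickedBy I d τ (p (j + 1))).card := by
        exact_mod_cast Finset.card_pos.2 ⟨_, hmem⟩
      have h5 : ((pickedBy I d τ (p (j + 1))).card : ℝ) ≤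
          pickedCount (codedInArcs I d) (p (j + 1)) τ := by
        exact_mod_cast card_pickedBy_le τ (p (j + 1))
      have h6 := one_div_le_one_div_of_le h4 h5
      have h7 := div_le_div_of_nonneg_right h3 h4.le
      linarith
    · exact hone _
  calc lawMean I d n (fun ω => selectionWeight I d S (roles ω))
      ≤ lawMean I d n (fun ω => (1 / 2) ^ (K + 1) *
          pathWeight (codedInArcs I d) p c (Finset.range K) (roles ω)) :=
        lawMean_mono fun ω => h2 _
    _ ≤ _ := by
        rw [lawMean_const_mul, lawMean_roles n le_rfl]
        refine mul_le_mul_of_nonneg_left (roleMean_pathWeight_le hpath fun j hj => ?_)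
          (by positivity)
        simp only [Finset.mem_filter, Finset.mem_univ, true_and]
        exact ⟨(p j).2, isRandomized_of_semiAssigns (hsemi j hj)⟩

end AdWords
end

noncomputable section

namespace AdWords

/-! ### Arcs of the circle -/

section Circle

variable {B y t : ℝ}

theorem arc_subset_Ico (B y t : ℝ) : arc B y t ⊆ Set.Ico 0 B := fun _ h => h.1

theorem circDist_nonneg {z : ℝ} (hy : y ∈ Set.Ico 0 B) (hz : z ∈ Set.Ico 0 B) :
    0 ≤ circDist B y z := by
  obtain ⟨h1, h2⟩ := hy
  obtain ⟨h3, h4⟩ := hz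
  unfold circDist
  split_ifs <;> linarith

theorem circDist_lt {z : ℝ} (hy : y ∈ Set.Ico 0 B) (hz : z ∈ Set.Ico 0 B) :
    circDist B y z < B := by
  obtain ⟨h1, h2⟩ := hy
  obtain ⟨h3, h4⟩ := hz
  unfold circDist
  split_ifs <;> linarith

theorem arc_eq_empty (hy : y ∈ Set.Ico 0 B) (ht : t ≤ 0) : arc B y t = ∅ :=
  Set.eq_empty_of_forall_notMem fun _ hz => by
    have := circDist_nonneg hy hz.1
    have := hz.2
    linarith

theorem arc_eq_Ico (hy : y ∈ Set.Ico 0 B) (ht : B ≤ t) : arc B y t = Set.Ico 0 B :=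
  Set.Subset.antisymm (arc_subset_Ico _ _ _) fun _ hz => ⟨hz, (circDist_lt hy hz).trans_le ht⟩

theorem measurable_circDist (B y : ℝ) : Measurable (circDist B y) :=
  Measurable.ite measurableSet_Ici (by fun_prop) (by fun_prop)

theorem measurableSet_arc (B y t : ℝ) : MeasurableSet (arc B y t) :=
  measurableSet_Ico.inter (measurableSet_lt (measurable_circDist B y) measurable_const)

theorem volume_real_arc (hy : y ∈ Set.Ico 0 B) (h0 : 0 ≤ t) (ht : t ≤ B) :
    volume.real (arc B y t) = t := by
  obtain ⟨h1, h2⟩ := hy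
  have h : arc B y t = Set.Ico y (min B (y + t)) ∪ Set.Ico 0 (min y (y + t - B)) := by
    ext z
    simp only [arc, circDist, Set.mem_ofPred_eq, Set.mem_union, Set.mem_Ico, lt_min_iff]
    constructor
    · rintro ⟨⟨h3, h4⟩, h5⟩
      split_ifs at h5 with h6
      · left; refine ⟨h6, h4, ?_⟩; linarith
      · right; push Not at h6; refine ⟨h3, h6, ?_⟩; linarith
    · rintro (⟨h3, h4, h5⟩ | ⟨h3, h4, h5⟩)
      · rw [if_pos h3]; exact ⟨⟨h1.trans h3, h4⟩, by linarith⟩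
      · rw [if_neg (not_le.2 h4)]; exact ⟨⟨h3, h4.trans h2⟩, by linarith⟩
  have hdisj : Disjoint (Set.Ico y (min B (y + t))) (Set.Ico 0 (min y (y + t - B))) :=
    Set.disjoint_left.2 fun z hz hz' => (hz.1.trans_lt (lt_min_iff.1 hz'.2).1).false
  rw [h, measureReal_union hdisj measurableSet_Ico measure_Ico_lt_top.ne measure_Ico_lt_top.ne, Real.volume_real_Ico, Real.volume_real_Ico]
  rcases le_total B (y + t) with h3 | h3
  · rw [min_eq_left h3, min_eq_right (by linarith : y + t - B ≤ y), max_eq_left (by linarith),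
      max_eq_left (by linarith)]
    ring
  · rw [min_eq_right h3, min_eq_right (by linarith : y + t - B ≤ y), max_eq_left (by linarith),
      max_eq_right (by linarith)]
    ring

theorem scanLength_mem {Y : Set ℝ} {b : ℝ} (hy : y ∈ Set.Ico 0 B) :
    scanLength B y Y b ∈ Set.Icc 0 B := by
  have hB : 0 ≤ B := hy.1.trans hy.2.le
  unfold scanLength
  split_ifs with h
  · exact ⟨hB, le_rfl⟩
  · push Not at h
    refine ⟨Real.sInf_nonneg fun x hx => hx.1, csInf_le ⟨0, fun x hx => hx.1⟩ ⟨hB, ?_⟩⟩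
    rw [arc_eq_Ico hy le_rfl]
    exact h.le

theorem scanLength_of_le {Y : Set ℝ} {b : ℝ} (h : volume.real (Set.Ico 0 B \ Y) ≤ b) :
    scanLength B y Y b = B :=
  if_pos h

theorem scanLength_zero {Y : Set ℝ} (h : 0 < volume.real (Set.Ico 0 B \ Y)) :
    scanLength B y Y 0 = 0 := by
  unfold scanLength
  rw [if_neg (not_le.2 h)]
  refine le_antisymm (csInf_le ⟨0, fun x hx => hx.1⟩ ⟨le_rfl, measureReal_nonneg⟩)
    (Real.sInf_nonneg fun x hx => hx.1)

theorem scanLength_empty {b : ℝ} (hy : y ∈ Set.Ico 0 B) (h0 : 0 ≤ b) (hb : b ≤ B) :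
    scanLength B y ∅ b = b := by
  have hB : 0 ≤ B := h0.trans hb
  unfold scanLength
  rw [Set.sdiff_empty, Real.volume_real_Ico, sub_zero, max_eq_left hB]
  split_ifs with h
  · exact le_antisymm h hb
  · push Not at h
    simp only [Set.sdiff_empty]
    refine le_antisymm (csInf_le ⟨0, fun x hx => hx.1⟩ ⟨h0, ?_⟩)
      (le_csInf ⟨b, h0, ?_⟩ fun x hx => ?_)
    · rw [volume_real_arc hy h0 hb]
    · rw [volume_real_arc hy h0 hb]
    · by_contra! hlt
      have h1 := hx.2
      rw [volume_real_arc hy hx.1 (hlt.le.trans hb)] at h1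
      linarith

theorem oplus_mem {Y : Set ℝ} {b : ℝ} (hy : y ∈ Set.Ico 0 B) :
    oplus B y Y b ∈ Set.Ico 0 B := by
  obtain ⟨h1, h2⟩ := scanLength_mem (Y := Y) (b := b) hy
  unfold oplus
  split_ifs with h
  · exact ⟨add_nonneg hy.1 h1, h⟩
  · push Not at h
    exact ⟨by linarith, by linarith [hy.2]⟩

theorem oplus_of_scanLength_eq_zero {Y : Set ℝ} {b : ℝ} (hy : y ∈ Set.Ico 0 B)
    (h : scanLength B y Y b = 0) : oplus B y Y b = y := by
  unfold oplus
  rw [h, add_zero, if_pos hy.2]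

/-- Advancing the origin by `b` lowers distances by `b` modulo `B`. This is the case of points that
were not scanned; scanned points wrap around to the far end. -/
theorem circDist_oplus_of_le {b z : ℝ} (hy : y ∈ Set.Ico 0 B) (h0 : 0 ≤ b) (hb : b ≤ B)
    (hz : z ∈ Set.Ico 0 B) (h : b ≤ circDist B y z) :
    circDist B (oplus B y ∅ b) z = circDist B y z - b := by
  obtain ⟨h1, h2⟩ := hy
  obtain ⟨h3, h4⟩ := hz
  unfold oplus
  rw [scanLength_empty ⟨h1, h2⟩ h0 hb]
  unfold circDist at h ⊢
  split_ifs at h ⊢ <;> linarith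

theorem circDist_oplus_of_lt {b z : ℝ} (hy : y ∈ Set.Ico 0 B) (h0 : 0 ≤ b) (hb : b ≤ B)
    (hz : z ∈ Set.Ico 0 B) (h : circDist B y z < b) :
    circDist B (oplus B y ∅ b) z = circDist B y z + B - b := by
  obtain ⟨h1, h2⟩ := hy
  obtain ⟨h3, h4⟩ := hz
  unfold oplus
  rw [scanLength_empty ⟨h1, h2⟩ h0 hb]
  unfold circDist at h ⊢
  split_ifs at h ⊢ <;> linarith

end Circle

/-! ### The states of an advertiser -/

variable {A : Type*} {n : ℕ}

/-- The points of `a` that have not been assigned deterministically. -/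
def State.remaining (s : State A) (I : AdWords A n) (a : A) : Set ℝ :=
  Set.Ico 0 (I.budget a) \ s.detPoints a

/-- No point of `a` has been assigned deterministically, and along the circle from the starting
point the numbers of semi-assignments increase by at most one. -/
def State.IsFresh (s : State A) (I : AdWords A n) (a : A) : Prop :=
  (∀ y, s.k a y ≠ ⊤) ∧ ∀ y ∈ Set.Ico 0 (I.budget a), ∀ z ∈ Set.Ico 0 (I.budget a),
    circDist (I.budget a) (s.start a) y ≤ circDist (I.budget a) (s.start a) z →
      s.k a y ≤ s.k a z ∧ s.k a z ≤ s.k a y + 1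

/-- The properties of the states that occur if all nonzero bids are large. -/
structure State.IsRegular (s : State A) (I : AdWords A n) (a : A) : Prop where
  start_mem : s.start a ∈ Set.Ico 0 (I.budget a)
  measurable : Measurable (s.k a)
  isFresh_or : s.IsFresh I a ∨ volume.real (s.remaining I a) < I.budget a / 2

variable {s : State A} {I : AdWords A n} {a : A} {b : A → ℝ} {d : Decision A}

theorem State.IsFresh.detPoints_eq (h : s.IsFresh I a) : s.detPoints a = ∅ :=
  Set.eq_empty_of_forall_notMem fun y hy => h.1 y hy

theorem State.IsFresh.remaining_eq (h : s.IsFresh I a) :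
    s.remaining I a = Set.Ico 0 (I.budget a) := by
  rw [State.remaining, h.detPoints_eq, Set.sdiff_empty]

theorem State.subset_subset_remaining (s : State A) (I : AdWords A n) (b : A → ℝ) (a : A) :
    s.subset I b a ⊆ s.remaining I a :=
  Set.sdiff_subset_sdiff_left (arc_subset_Ico _ _ _)

theorem State.remaining_subset_Ico (s : State A) (I : AdWords A n) (a : A) :
    s.remaining I a ⊆ Set.Ico 0 (I.budget a) :=
  Set.sdiff_subset

theorem State.subset_subset_Ico (s : State A) (I : AdWords A n) (b : A → ℝ) (a : A) :
    s.subset I b a ⊆ Set.Ico 0 (I.budget a) :=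
  (s.subset_subset_remaining I b a).trans (s.remaining_subset_Ico I a)

namespace State.IsRegular

theorem measurableSet_detPoints (h : s.IsRegular I a) : MeasurableSet (s.detPoints a) :=
  h.measurable (measurableSet_singleton ⊤)

theorem measurableSet_remaining (h : s.IsRegular I a) : MeasurableSet (s.remaining I a) :=
  measurableSet_Ico.diff h.measurableSet_detPoints

theorem measurableSet_subset (h : s.IsRegular I a) (b : A → ℝ) :
    MeasurableSet (s.subset I b a) :=
  (measurableSet_arc _ _ _).diff h.measurableSet_detPoints

theorem subset_eq_remaining (h : s.IsRegular I a)
    (hb : volume.real (s.remaining I a) ≤ b a) : s.subset I b a = s.remaining I a := by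
  unfold State.subset
  rw [scanLength_of_le hb, arc_eq_Ico h.start_mem le_rfl]
  rfl

theorem subset_eq_arc (h : s.IsRegular I a) (hf : s.IsFresh I a) (h0 : 0 ≤ b a)
    (hb : b a ≤ I.budget a) : s.subset I b a = arc (I.budget a) (s.start a) (b a) := by
  unfold State.subset
  rw [hf.detPoints_eq, scanLength_empty h.start_mem h0 hb, Set.sdiff_empty]

theorem subset_eq_empty (h : s.IsRegular I a) (h0 : b a = 0)
    (hpos : 0 < volume.real (s.remaining I a)) : s.subset I b a = ∅ := by
  unfold State.subset
  rw [h0, scanLength_zero hpos, arc_eq_empty h.start_mem le_rfl, Set.empty_sdiff]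

theorem oplus_eq_start (h : s.IsRegular I a) (h0 : b a = 0)
    (hpos : 0 < volume.real (s.remaining I a)) :
    oplus (I.budget a) (s.start a) (s.detPoints a) (b a) = s.start a := by
  refine oplus_of_scanLength_eq_zero h.start_mem ?_
  rw [h0]
  exact scanLength_zero hpos

theorem remaining_pos_of_isFresh (hf : s.IsFresh I a) :
    0 < volume.real (s.remaining I a) := by
  rw [hf.remaining_eq, Real.volume_real_Ico, sub_zero, max_eq_left (I.budget_pos a).le]
  exact I.budget_pos a

/-- A zero bid scans nothing, or a null set if only a null set remains. A large bid scans an arc of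
its own length, or all of a remainder smaller than half the budget. -/
theorem volume_real_subset_le (h : s.IsRegular I a) (hb : b a ≤ I.budget a)
    (hlarge : b a = 0 ∨ I.budget a / 2 < b a) : volume.real (s.subset I b a) ≤ b a := by
  have hB := I.budget_pos a
  rcases hlarge with h0 | hl
  · rcases (measureReal_nonneg (μ := volume) (s := s.remaining I a)).eq_or_lt with hz | hpos
    · rw [h.subset_eq_remaining (by rw [h0]; exact hz.symm.le), h0]
      exact hz.symm.le
    · rw [h.subset_eq_empty h0 hpos, h0]
      simp
  · rcases h.isFresh_or with hf | hv
    · rw [h.subset_eq_arc hf (by linarith) hb, volume_real_arc h.start_mem (by linarith) hb]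
    · rw [h.subset_eq_remaining (hv.le.trans hl.le)]
      linarith

/-- A large bid on an advertiser gets all remaining points, or an arc of its length. -/
theorem subset_of_large (h : s.IsRegular I a) (hb : b a ≤ I.budget a)
    (hl : I.budget a / 2 < b a) :
    (s.subset I b a = s.remaining I a ∧ volume.real (s.remaining I a) < I.budget a / 2) ∨
      (s.IsFresh I a ∧ s.subset I b a = arc (I.budget a) (s.start a) (b a)) := by
  have hB := I.budget_pos a
  rcases h.isFresh_or with hf | hv
  · exact Or.inr ⟨hf, h.subset_eq_arc hf (by linarith) hb⟩
  · exact Or.inl ⟨h.subset_eq_remaining (hv.le.trans hl.le), hv⟩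

end State.IsRegular

/-- The impression is assigned to `a` by the decision `d`. -/
def Decision.Assigns : Decision A → A → Prop
  | .det a', a => a = a'
  | .rand _ _, _ => False

theorem State.step_start_of_touched (h : d.Assigns a ∨ d.SemiAssigns a) :
    (s.step I b d).start a =
      oplus (I.budget a) (s.start a) (s.detPoints a) (b a) := by
  cases d with
  | det a' => exact if_pos (h.resolve_right id)
  | rand a₁ a₂ => exact if_pos (h.resolve_left id)

theorem State.step_start_of_not (h₁ : ¬ d.Assigns a) (h₂ : ¬ d.SemiAssigns a) :
    (s.step I b d).start a = s.start a := by
  cases d with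
  | det a' => exact if_neg h₁
  | rand a₁ a₂ => exact if_neg h₂

open Classical in
theorem State.step_k_of_assigns (h : d.Assigns a) (y : ℝ) :
    (s.step I b d).k a y = if y ∈ s.subset I b a then ⊤ else s.k a y := by
  cases d with
  | det a' => exact if_congr (and_iff_right h) rfl rfl
  | rand a₁ a₂ => exact h.elim

open Classical in
theorem State.step_k_of_semiAssigns (h : d.SemiAssigns a) (y : ℝ) :
    (s.step I b d).k a y = if y ∈ s.subset I b a then s.k a y + 1 else s.k a y := by
  cases d with
  | det a' => exact h.elim
  | rand a₁ a₂ => exact if_congr (and_iff_right h) rfl rfl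

theorem State.step_k_of_not (h₁ : ¬ d.Assigns a) (h₂ : ¬ d.SemiAssigns a) (y : ℝ) :
    (s.step I b d).k a y = s.k a y := by
  cases d with
  | det a' => exact if_neg fun h => h₁ h.1
  | rand a₁ a₂ => exact if_neg fun h => h₂ h.1

theorem State.k_le_step_k (s : State A) (I : AdWords A n) (b : A → ℝ) (d : Decision A) (a : A)
    (y : ℝ) : s.k a y ≤ (s.step I b d).k a y := by
  classical
  by_cases h₁ : d.Assigns a
  · rw [State.step_k_of_assigns h₁]
    split_ifs
    · exact le_top
    · exact le_rfl
  · by_cases h₂ : d.SemiAssigns a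
    · rw [State.step_k_of_semiAssigns h₂]
      split_ifs
      · exact le_self_add
      · exact le_rfl
    · rw [State.step_k_of_not h₁ h₂]

theorem State.remaining_step_subset (s : State A) (I : AdWords A n) (b : A → ℝ)
    (d : Decision A) (a : A) : (s.step I b d).remaining I a ⊆ s.remaining I a :=
  fun y hy => ⟨hy.1, fun h => hy.2 (top_le_iff.1 (h ▸ s.k_le_step_k I b d a y))⟩

/-- A large deterministic assignment on a fresh circle leaves less than half of the budget. In a
fresh randomized round, the scanned points gain 1 and move behind the unscanned ones in the circular
order. They had counts at most those of the unscanned points and at least one less, so the counts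
stay ordered and balanced. A zero bid changes nothing on a fresh circle. -/
theorem State.IsRegular.step (h : s.IsRegular I a) (h0 : 0 ≤ b a) (hb : b a ≤ I.budget a)
    (hlarge : b a = 0 ∨ I.budget a / 2 < b a) (d : Decision A) :
    (s.step I b d).IsRegular I a := by
  classical
  have hB := I.budget_pos a
  have hmono : volume.real (s.remaining I a) < I.budget a / 2 →
      volume.real ((s.step I b d).remaining I a) < I.budget a / 2 := fun hv =>
    (measureReal_mono (s.remaining_step_subset I b d a)
      (measure_ne_top_of_subset (s.remaining_subset_Ico I a) (by simp))).trans_lt hv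
  by_cases h₁ : d.Assigns a
  · refine ⟨?_, ?_, ?_⟩
    · rw [State.step_start_of_touched (Or.inl h₁)]
      exact oplus_mem h.start_mem
    · have : (s.step I b d).k a = fun y => if y ∈ s.subset I b a then ⊤ else s.k a y :=
        funext fun y => State.step_k_of_assigns h₁ y
      rw [this]
      exact Measurable.ite (h.measurableSet_subset b) measurable_const h.measurable
    · rcases h.isFresh_or with hf | hv
      · rcases hlarge with hz | hl
        · left
          have he := h.subset_eq_empty hz (remaining_pos_of_isFresh hf)
          have hs : (s.step I b d).start a = s.start a := by
            rw [State.step_start_of_touched (Or.inl h₁)]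
            exact h.oplus_eq_start hz (remaining_pos_of_isFresh hf)
          have hk : ∀ y, (s.step I b d).k a y = s.k a y := fun y => by
            rw [State.step_k_of_assigns h₁, he]
            simp
          unfold State.IsFresh
          simp only [hs, hk]
          exact hf
        · right
          have he := h.subset_eq_arc hf h0 hb
          have hsub : (s.step I b d).remaining I a ⊆
              Set.Ico 0 (I.budget a) \ arc (I.budget a) (s.start a) (b a) := fun y hy =>
            ⟨hy.1, fun hy' => hy.2 (by
              change (s.step I b d).k a y = ⊤
              rw [State.step_k_of_assigns h₁, he, if_pos hy'])⟩
          refine (measureReal_mono hsub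
            (measure_ne_top_of_subset Set.sdiff_subset (by simp))).trans_lt ?_
          rw [measureReal_sdiff (arc_subset_Ico _ _ _) (measurableSet_arc _ _ _) (by simp),
            volume_real_arc h.start_mem h0 hb, Real.volume_real_Ico, sub_zero,
            max_eq_left hB.le]
          linarith
      · exact Or.inr (hmono hv)
  · by_cases h₂ : d.SemiAssigns a
    · refine ⟨?_, ?_, ?_⟩
      · rw [State.step_start_of_touched (Or.inr h₂)]
        exact oplus_mem h.start_mem
      · have : (s.step I b d).k a =
            fun y => if y ∈ s.subset I b a then s.k a y + 1 else s.k a y :=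
          funext fun y => State.step_k_of_semiAssigns h₂ y
        rw [this]
        exact Measurable.ite (h.measurableSet_subset b)
          ((Measurable.of_discrete (f := fun k : ℕ∞ => k + 1)).comp h.measurable) h.measurable
      · rcases h.isFresh_or with hf | hv
        · left
          have he := h.subset_eq_arc hf h0 hb
          have hs : (s.step I b d).start a = oplus (I.budget a) (s.start a) ∅ (b a) := by
            rw [State.step_start_of_touched (Or.inr h₂), hf.detPoints_eq]
          refine ⟨fun y => ?_, fun y hy z hz => ?_⟩
          · rw [State.step_k_of_semiAssigns h₂]
            split_ifs
            · simpa using hf.1 y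
            · exact hf.1 y
          · rw [State.step_k_of_semiAssigns h₂, State.step_k_of_semiAssigns h₂, he, hs]
            intro hd
            have hyz := hf.2 y hy z hz
            have hzy := hf.2 z hz y hy
            have hyB := circDist_lt h.start_mem hy
            have hzB := circDist_lt h.start_mem hz
            have hy0 := circDist_nonneg h.start_mem hy
            have hz0 := circDist_nonneg h.start_mem hz
            by_cases hya : circDist (I.budget a) (s.start a) y < b a
            · rw [if_pos (show y ∈ arc (I.budget a) (s.start a) (b a) from ⟨hy, hya⟩)]
              rw [circDist_oplus_of_lt h.start_mem h0 hb hy hya] at hd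
              by_cases hza : circDist (I.budget a) (s.start a) z < b a
              · rw [if_pos (show z ∈ arc (I.budget a) (s.start a) (b a) from ⟨hz, hza⟩)]
                rw [circDist_oplus_of_lt h.start_mem h0 hb hz hza] at hd
                obtain ⟨h3, h4⟩ := hyz (by linarith)
                exact ⟨add_le_add_left h3 1, add_le_add_left h4 1⟩
              · push Not at hza
                rw [circDist_oplus_of_le h.start_mem h0 hb hz hza] at hd
                linarith
            · rw [if_neg (fun h' : y ∈ arc (I.budget a) (s.start a) (b a) => hya h'.2)]
              push Not at hya
              rw [circDist_oplus_of_le h.start_mem h0 hb hy hya] at hd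
              by_cases hza : circDist (I.budget a) (s.start a) z < b a
              · rw [if_pos (show z ∈ arc (I.budget a) (s.start a) (b a) from ⟨hz, hza⟩)]
                obtain ⟨h3, h4⟩ := hzy (by linarith)
                exact ⟨h4, add_le_add_left h3 1⟩
              · rw [if_neg (fun h' : z ∈ arc (I.budget a) (s.start a) (b a) => hza h'.2)]
                push Not at hza
                rw [circDist_oplus_of_le h.start_mem h0 hb hz hza] at hd
                exact hyz (by linarith)
        · exact Or.inr (hmono hv)
    · have hs : (s.step I b d).start a = s.start a := State.step_start_of_not h₁ h₂
      have hk : (s.step I b d).k a = s.k a := funext fun y => State.step_k_of_not h₁ h₂ y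
      refine ⟨hs ▸ h.start_mem, hk ▸ h.measurable, ?_⟩
      have := h.isFresh_or
      unfold State.IsFresh State.remaining State.detPoints at this ⊢
      rwa [hs, hk]

end AdWords
end

noncomputable section

namespace AdWords

variable {A : Type*} {n : ℕ} {I : AdWords A n} {d : Fin n → Decision A} {a : A}

/-! ### The sequence of states -/

theorem stateAt_succ (i : Fin n) :
    stateAt I d (i + 1) = (stateAt I d i).step I (I.bid i) (d i) := by
  rw [stateAt, dif_pos i.2]

theorem stateAt_succ_of_le {m : ℕ} (h : n ≤ m) : stateAt I d (m + 1) = stateAt I d m := by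
  rw [stateAt, dif_neg (not_lt.2 h)]

theorem stateAt_isRegular (hL : I.LargeBids) (d : Fin n → Decision A) (m : ℕ) (a : A) :
    (stateAt I d m).IsRegular I a := by
  induction m with
  | zero =>
    exact ⟨⟨le_rfl, I.budget_pos a⟩, measurable_const,
      Or.inl ⟨fun _ => ENat.zero_ne_top, fun _ _ _ _ _ => ⟨le_rfl, zero_le⟩⟩⟩
  | succ m ih =>
    rcases lt_or_ge m n with h | h
    · have := stateAt_succ (I := I) (d := d) ⟨m, h⟩
      simp only at this
      rw [this]
      exact ih.step (I.bid_nonneg _ a) (I.bid_le_budget _ a) (hL _ a) _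
    · rw [stateAt_succ_of_le h]
      exact ih

theorem monotone_stateAt_k (I : AdWords A n) (d : Fin n → Decision A) (a : A) (y : ℝ) :
    Monotone fun m => (stateAt I d m).k a y := by
  refine monotone_nat_of_le_succ fun m => ?_
  rcases lt_or_ge m n with h | h
  · have := stateAt_succ (I := I) (d := d) ⟨m, h⟩
    simp only at this
    rw [this]
    exact State.k_le_step_k _ _ _ _ _ _
  · rw [stateAt_succ_of_le h]

theorem antitone_stateAt_remaining (I : AdWords A n) (d : Fin n → Decision A) (a : A) :
    Antitone fun m => (stateAt I d m).remaining I a := by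
  refine antitone_nat_of_succ_le fun m => ?_
  rcases lt_or_ge m n with h | h
  · have := stateAt_succ (I := I) (d := d) ⟨m, h⟩
    simp only at this
    rw [this]
    exact State.remaining_step_subset _ _ _ _ _
  · rw [stateAt_succ_of_le h]

theorem State.IsFresh.not_lt {s : State A} (hf : s.IsFresh I a) :
    ¬ volume.real (s.remaining I a) < I.budget a / 2 := by
  have hB := I.budget_pos a
  rw [hf.remaining_eq, Real.volume_real_Ico, sub_zero, max_eq_left hB.le]
  linarith

theorem volume_ne_top_of_subset_Ico {B : ℝ} {S : Set ℝ} (h : S ⊆ Set.Ico 0 B) :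
    volume S ≠ ⊤ :=
  measure_ne_top_of_subset h measure_Ico_lt_top.ne

/-- The remaining set only shrinks, and it is the whole interval in a fresh state. So the
alternative of less than half remaining is excluded at all earlier times. -/
theorem stateAt_isFresh_of_le (hL : I.LargeBids) {m m' : ℕ} (h : m ≤ m')
    (hf : (stateAt I d m').IsFresh I a) : (stateAt I d m).IsFresh I a := by
  refine (stateAt_isRegular hL d m a).isFresh_or.resolve_right fun hv => hf.not_lt ?_
  exact (measureReal_mono (antitone_stateAt_remaining I d a h)
    (volume_ne_top_of_subset_Ico (State.remaining_subset_Ico _ _ _))).trans_lt hv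

theorem subsetAt_subset_Ico (I : AdWords A n) (d : Fin n → Decision A) (i : Fin n) (a : A) :
    subsetAt I d i a ⊆ Set.Ico 0 (I.budget a) :=
  State.subset_subset_Ico _ _ _ _

theorem measurableSet_subsetAt (hL : I.LargeBids) (d : Fin n → Decision A) (i : Fin n) (a : A) :
    MeasurableSet (subsetAt I d i a) :=
  (stateAt_isRegular hL d i a).measurableSet_subset _

/-- While there are no deterministic points, the points shortly before the starting point have
been semi-assigned in the last randomized round with a large bid. -/
theorem mem_subsetAt_of_circDist (hL : I.LargeBids) {u : Fin n} (hu : (d u).SemiAssigns a)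
    {m : ℕ} (hm : u.val + 1 ≤ m)
    (hbetween : ∀ v : Fin n, u < v → v.val < m → (d v).SemiAssigns a → I.bid v a = 0)
    (hf : (stateAt I d m).IsFresh I a) {y : ℝ} (hy : y ∈ Set.Ico 0 (I.budget a))
    (hd : I.budget a - I.bid u a ≤ circDist (I.budget a) ((stateAt I d m).start a) y) :
    y ∈ subsetAt I d u a := by
  induction m, hm using Nat.le_induction with
  | base =>
    have hreg := stateAt_isRegular hL d u a
    have hfu := stateAt_isFresh_of_le hL (Nat.le_succ u) hf
    rw [stateAt_succ u, State.step_start_of_touched (Or.inr hu), hfu.detPoints_eq] at hd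
    unfold subsetAt
    rw [hreg.subset_eq_arc hfu (I.bid_nonneg u a) (I.bid_le_budget u a)]
    refine ⟨hy, lt_of_not_ge fun hge => ?_⟩
    rw [circDist_oplus_of_le hreg.start_mem (I.bid_nonneg u a) (I.bid_le_budget u a) hy hge] at hd
    have := circDist_lt hreg.start_mem hy
    linarith
  | succ m hm ih =>
    have hfm := stateAt_isFresh_of_le hL (Nat.le_succ m) hf
    refine ih (fun v h1 h2 => hbetween v h1 (by omega)) hfm ?_
    rcases lt_or_ge m n with h | h
    · have hs := stateAt_succ (I := I) (d := d) ⟨m, h⟩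
      simp only at hs
      have hreg := stateAt_isRegular hL d m a
      have hpos := State.IsRegular.remaining_pos_of_isFresh hfm
      by_cases h₁ : (d ⟨m, h⟩).Assigns a
      · rcases hL ⟨m, h⟩ a with hz | hl
        · rwa [hs, State.step_start_of_touched (Or.inl h₁), hreg.oplus_eq_start hz hpos] at hd
        -- A large deterministic assignment would leave less than half of the budget, contradicting
        -- freshness at the later time.
        · exfalso
          have hsub : (stateAt I d (m + 1)).remaining I a ⊆ Set.Ico 0 (I.budget a) \
              arc (I.budget a) ((stateAt I d m).start a) (I.bid ⟨m, h⟩ a) := fun z hz =>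
            ⟨hz.1, fun hz' => hz.2 (by
              change (stateAt I d (m + 1)).k a z = ⊤
              rw [hs, State.step_k_of_assigns h₁, hreg.subset_eq_arc hfm
                (I.bid_nonneg _ a) (I.bid_le_budget _ a), if_pos hz'])⟩
          refine hf.not_lt ((measureReal_mono hsub
            (volume_ne_top_of_subset_Ico Set.sdiff_subset)).trans_lt ?_)
          rw [measureReal_sdiff (arc_subset_Ico _ _ _) (measurableSet_arc _ _ _) (by simp),
            volume_real_arc hreg.start_mem (I.bid_nonneg _ a) (I.bid_le_budget _ a),
            Real.volume_real_Ico, sub_zero, max_eq_left (I.budget_pos a).le]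
          linarith
      · by_cases h₂ : (d ⟨m, h⟩).SemiAssigns a
        · have hz := hbetween ⟨m, h⟩ (Fin.lt_def.2 hm) (Nat.lt_succ_self m) h₂
          rwa [hs, State.step_start_of_touched (Or.inr h₂), hreg.oplus_eq_start hz hpos] at hd
        · rwa [hs, State.step_start_of_not h₁ h₂] at hd
    · rwa [stateAt_succ_of_le h] at hd

/-- Two consecutive randomized rounds with large bids on `a` cover all points that are still
available later. -/
theorem remaining_subset_union (hL : I.LargeBids) {u v : Fin n} (huv : u < v)
    (hu : (d u).SemiAssigns a) (hul : I.budget a / 2 < I.bid u a)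
    (hvl : I.budget a / 2 < I.bid v a)
    (hbetween : ∀ w : Fin n, u < w → w < v → (d w).SemiAssigns a → I.bid w a = 0) :
    (stateAt I d v).remaining I a ⊆ subsetAt I d u a ∪ subsetAt I d v a := by
  have hreg := stateAt_isRegular hL d v a
  rcases hreg.subset_of_large (I.bid_le_budget v a) hvl with ⟨he, -⟩ | ⟨hf, he⟩
  · unfold subsetAt
    rw [he]
    exact Set.subset_union_right
  · intro y hy
    by_cases hd : circDist (I.budget a) ((stateAt I d v).start a) y < I.bid v a
    · right
      unfold subsetAt
      rw [he]
      exact ⟨hy.1, hd⟩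
    · left
      exact mem_subsetAt_of_circDist hL hu huv hbetween hf hy.1 (by linarith)

open Classical in
/-- The randomized rounds with large bids on `a` strictly between `u` and `v`. -/
def largeBetween (I : AdWords A n) (d : Fin n → Decision A) (a : A) (u v : Fin n) :
    Finset (Fin n) :=
  Finset.univ.filter fun w => u < w ∧ w < v ∧ (d w).SemiAssigns a ∧ I.budget a / 2 < I.bid w a

theorem mem_largeBetween {u v w : Fin n} :
    w ∈ largeBetween I d a u v ↔
      u < w ∧ w < v ∧ (d w).SemiAssigns a ∧ I.budget a / 2 < I.bid w a := by
  simp [largeBetween]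

/-- The first two large rounds in between would be consecutive and together cover every point
available to `v`, including the point that witnesses the arc. That point must not be touched in
between. -/
theorem card_largeBetween_le_one (hL : I.LargeBids) {u v : Fin n} (h : IsArc I d u v a) :
    (largeBetween I d a u v).card ≤ 1 := by
  by_contra! hcard
  set T := largeBetween I d a u v with hT
  have hne : T.Nonempty := Finset.card_pos.1 (by omega)
  set w₁ := T.min' hne with hw₁
  have hm₁ : w₁ ∈ T := T.min'_mem hne
  have hne' : (T.erase w₁).Nonempty :=
    Finset.card_pos.1 (by rw [Finset.card_erase_of_mem hm₁]; omega)
  set w₂ := (T.erase w₁).min' hne' with hw₂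
  have hm₂' : w₂ ∈ T.erase w₁ := (T.erase w₁).min'_mem hne'
  have hm₂ : w₂ ∈ T := Finset.mem_of_mem_erase hm₂'
  have hlt : w₁ < w₂ := lt_of_le_of_ne (T.min'_le _ hm₂) (Finset.ne_of_mem_erase hm₂').symm
  obtain ⟨h1, h2, h3, h4⟩ := mem_largeBetween.1 hm₁
  obtain ⟨h1', h2', h3', h4'⟩ := mem_largeBetween.1 hm₂
  have hcover := remaining_subset_union hL hlt h3 h4 h4' (fun w hw hw' hs => by
    refine (hL w a).resolve_right fun hl => ?_
    have hwT : w ∈ T.erase w₁ := Finset.mem_erase.2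
      ⟨hw.ne', mem_largeBetween.2 ⟨h1.trans hw, hw'.trans h2', hs, hl⟩⟩
    exact (((T.erase w₁).min'_le w hwT).trans_lt hw').false)
  obtain ⟨⟨_, _, _, y, _, hyv, hy⟩, _, _⟩ := h
  have hrem : y ∈ (stateAt I d w₂).remaining I a :=
    antitone_stateAt_remaining I d a (Fin.lt_def.1 h2').le
      (State.subset_subset_remaining _ _ _ _ hyv)
  rcases hcover hrem with hh | hh
  · exact hy w₁ h1 h2 h3 hh
  · exact hy w₂ h1' h2' h3' hh

/-- All in-neighbours of `v` other than the earliest one lie between the latter and `v`. All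
out-neighbours of `u` before `v` lie between `u` and `v`. In both cases there is at most one. -/
theorem hasBoundedDegrees (hL : I.LargeBids) (d : Fin n → Decision A) :
    HasBoundedDegrees I d := by
  classical
  refine ⟨fun v a => ?_, fun {u v a} h => ?_⟩
  · set T := Finset.univ.filter fun u => IsArc I d u v a with hT
    rcases T.eq_empty_or_nonempty with he | hne
    · rw [he]
      simp
    · set u := T.min' hne with hu
      have hmem : u ∈ T := T.min'_mem hne
      have harc : IsArc I d u v a := (Finset.mem_filter.1 hmem).2
      have hsub : T.erase u ⊆ largeBetween I d a u v := by
        intro w hw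
        have hwT := Finset.mem_of_mem_erase hw
        have hwarc : IsArc I d w v a := (Finset.mem_filter.1 hwT).2
        exact mem_largeBetween.2 ⟨lt_of_le_of_ne (T.min'_le _ hwT)
          (Finset.ne_of_mem_erase hw).symm, hwarc.1.1, hwarc.1.2.1, hwarc.2.1⟩
      have h1 := (Finset.card_le_card hsub).trans (card_largeBetween_le_one hL harc)
      rw [Finset.card_erase_of_mem hmem] at h1
      omega
  · have hsub : (Finset.univ.filter fun i => i < v ∧ IsArc I d u i a) ⊆
        largeBetween I d a u v := by
      intro w hw
      obtain ⟨h1, h2⟩ := (Finset.mem_filter.1 hw).2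
      exact mem_largeBetween.2 ⟨h2.1.1, h1, h2.1.2.2.1, h2.2.2⟩
    have := (Finset.card_le_card hsub).trans (card_largeBetween_le_one hL h)
    exact Nat.lt_succ_of_le this

/-! ### The rounds that semi-assign a given point -/

open Classical in
/-- The randomized rounds that semi-assign the point `y` of `a`. -/
def semiRounds (I : AdWords A n) (d : Fin n → Decision A) (a : A) (y : ℝ) : Finset (Fin n) :=
  Finset.univ.filter fun i => (d i).SemiAssigns a ∧ y ∈ subsetAt I d i a

theorem mem_semiRounds {i : Fin n} {y : ℝ} :
    i ∈ semiRounds I d a y ↔ (d i).SemiAssigns a ∧ y ∈ subsetAt I d i a := by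
  simp [semiRounds]

open Classical in
theorem stateAt_k_eq (I : AdWords A n) (d : Fin n → Decision A) (a : A) (y : ℝ) (m : ℕ)
    (hm : m ≤ n) :
    (stateAt I d m).k a y =
      if ∃ i : Fin n, i.val < m ∧ (d i).Assigns a ∧ y ∈ subsetAt I d i a then ⊤
      else (((semiRounds I d a y).filter fun i => i.val < m).card : ℕ∞) := by
  induction m with
  | zero =>
    simp
    rfl
  | succ m ih =>
    have h : m < n := hm
    have hs := stateAt_succ (I := I) (d := d) ⟨m, h⟩
    simp only at hs
    rw [hs]
    have ih := ih h.le
    have hstep : ∀ i : Fin n, i.val < m + 1 ↔ i = ⟨m, h⟩ ∨ i.val < m := fun i => by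
      rw [Fin.ext_iff]
      simp only
      omega
    have hex : (∃ i : Fin n, i.val < m + 1 ∧ (d i).Assigns a ∧ y ∈ subsetAt I d i a) ↔
        ((d ⟨m, h⟩).Assigns a ∧ y ∈ subsetAt I d ⟨m, h⟩ a) ∨
          ∃ i : Fin n, i.val < m ∧ (d i).Assigns a ∧ y ∈ subsetAt I d i a := by
      simp only [hstep, or_and_right, exists_or, exists_eq_left]
    by_cases h₁ : (d ⟨m, h⟩).Assigns a ∧ y ∈ subsetAt I d ⟨m, h⟩ a
    · rw [if_pos (hex.2 (Or.inl h₁)), State.step_k_of_assigns h₁.1]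
      exact if_pos h₁.2
    · rw [if_congr (hex.trans (or_iff_right h₁)) rfl rfl]
      have hcard : (((semiRounds I d a y).filter fun i => i.val < m + 1).card : ℕ∞) =
          ((semiRounds I d a y).filter fun i => i.val < m).card +
            if (d ⟨m, h⟩).SemiAssigns a ∧ y ∈ subsetAt I d ⟨m, h⟩ a then 1 else 0 := by
        simp only [hstep]
        rw [Finset.filter_or, Finset.filter_eq']
        split_ifs with h2 h3 h3
        · rw [Finset.card_union_of_disjoint]
          · rw [Finset.card_singleton]
            push_cast
            rw [add_comm]
          · simp
        · exact absurd (mem_semiRounds.1 h2) h3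
        · exact absurd (mem_semiRounds.2 h3) h2
        · simp
      have hk : ((stateAt I d m).step I (I.bid ⟨m, h⟩) (d ⟨m, h⟩)).k a y =
          (stateAt I d m).k a y +
            if (d ⟨m, h⟩).SemiAssigns a ∧ y ∈ subsetAt I d ⟨m, h⟩ a then 1 else 0 := by
        by_cases h₂ : (d ⟨m, h⟩).SemiAssigns a
        · have hk' : ((stateAt I d m).step I (I.bid ⟨m, h⟩) (d ⟨m, h⟩)).k a y =
              if y ∈ subsetAt I d ⟨m, h⟩ a then (stateAt I d m).k a y + 1
              else (stateAt I d m).k a y := State.step_k_of_semiAssigns h₂ y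
          rw [hk']
          by_cases h3 : y ∈ subsetAt I d ⟨m, h⟩ a
          · rw [if_pos h3, if_pos ⟨h₂, h3⟩]
          · rw [if_neg h3, if_neg (fun h' => h3 h'.2), add_zero]
        · rw [if_neg (fun h' => h₂ h'.1), add_zero]
          by_cases h4 : (d ⟨m, h⟩).Assigns a
          · rw [State.step_k_of_assigns h4]
            exact if_neg fun h3 => h₁ ⟨h4, h3⟩
          · rw [State.step_k_of_not h4 h₂]
      rw [hk, ih, hcard]
      split_ifs <;> simp

/-- Consecutive rounds that semi-assign `y` are adjacent. -/
theorem adjacent_of_consecutive {u v : Fin n} {y : ℝ} (hu : u ∈ semiRounds I d a y)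
    (hv : v ∈ semiRounds I d a y) (huv : u < v)
    (h : ∀ w ∈ semiRounds I d a y, u < w → w < v → False) : Adjacent I d u v a := by
  obtain ⟨h1, h2⟩ := mem_semiRounds.1 hu
  obtain ⟨h3, h4⟩ := mem_semiRounds.1 hv
  exact ⟨huv, h1, h3, y, h2, h4, fun w hw hw' hs hy => h w (mem_semiRounds.2 ⟨hs, hy⟩) hw hw'⟩

variable [Fintype A]

/-- If `y` has been semi-assigned to `a` in `k ≥ 1` rounds, all of them with large bids, then none
of them selects `a` with probability at most `2 ^ (-k) * (1 - 0.05144) ^ (k - 1)`. -/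
theorem lawMean_bitsIndicator_semiRounds_le (hL : I.LargeBids)
    (hd : ∀ i a₁ a₂, d i = .rand a₁ a₂ → a₁ ≠ a₂) {y : ℝ} {K : ℕ}
    (hcard : (semiRounds I d a y).card = K + 1)
    (hlarge : ∀ i ∈ semiRounds I d a y, I.budget a / 2 < I.bid i a) {r : Fin n → Bool}
    (hr : ∀ v, (d v).SemiAssigns a → (d v).pick (r v) ≠ a) :
    lawMean I d n (bitsIndicator (semiRounds I d a y) r) ≤
      (1 / 2) ^ (K + 1) * (1 - 0.05144) ^ K := by
  classical
  set f := (semiRounds I d a y).orderEmbOfFin hcard with hf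
  -- The increasing enumeration of the rounds. The default `f 0` keeps all values in the set, so
  -- membership needs no bound on the index.
  set p : ℕ → Fin n := fun j => if h : j < K + 1 then f ⟨j, h⟩ else f 0 with hp
  have hpj : ∀ j (h : j < K + 1), p j = f ⟨j, h⟩ := fun j h => dif_pos h
  have hmem : ∀ j, p j ∈ semiRounds I d a y := fun j => by
    simp only [hp]
    split_ifs
    · exact Finset.orderEmbOfFin_mem _ _ _
    · exact Finset.orderEmbOfFin_mem _ _ _
  have himage : (Finset.range (K + 1)).image p = semiRounds I d a y := by
    ext i
    rw [Finset.mem_image]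
    constructor
    · rintro ⟨j, -, rfl⟩
      exact hmem j
    · intro hi
      have : i ∈ Set.range f := by
        rw [hf, Finset.range_orderEmbOfFin]
        exact hi
      obtain ⟨j, rfl⟩ := this
      exact ⟨j, Finset.mem_range.2 j.2, hpj j j.2⟩
  rw [← himage]
  refine lawMean_bitsIndicator_le hd (hasBoundedDegrees hL d) (a := a)
    (fun j _ => (mem_semiRounds.1 (hmem j)).1) (fun j hj => ⟨?_, hlarge _ (hmem _),
      hlarge _ (hmem _)⟩) hr
  refine adjacent_of_consecutive (hmem j) (hmem (j + 1)) ?_ fun w hw h1 h2 => ?_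
  · rw [hpj j (by omega), hpj (j + 1) (by omega)]
    exact f.lt_iff_lt.2 (Fin.lt_def.2 (Nat.lt_succ_self j))
  · have : w ∈ Set.range f := by
      rw [hf, Finset.range_orderEmbOfFin]
      exact hw
    obtain ⟨i, rfl⟩ := this
    rw [hpj j (by omega), f.lt_iff_lt, Fin.lt_def] at h1
    rw [hpj (j + 1) (by omega), f.lt_iff_lt, Fin.lt_def] at h2
    simp only at h1 h2
    omega

end AdWords
end

noncomputable section

namespace AdWords

/-! ### The parameters of the algorithm -/

theorem deltaBeta_one {γ : ℝ} (hγ : 0 ≤ γ) :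
    deltaBeta γ 1 = (3 + 2 * γ) / (6 + 3 * γ) / 2 := by
  have : (6 + 3 * γ) ≠ 0 := by positivity
  simp only [deltaBeta, deltaAlpha, deltaX]
  field_simp
  ring

theorem deltaBeta_add_two {γ : ℝ} (hγ : 0 ≤ γ) (k : ℕ) :
    deltaBeta γ (k + 2) = (1 + γ) / (4 * (2 + γ)) * ((1 - γ) / 2) ^ k := by
  have : (2 + γ) ≠ 0 := by positivity
  simp only [deltaBeta, deltaAlpha, deltaX, div_pow, one_pow, pow_add]
  field_simp
  ring

/-- The sum of `Δβ(ℓ)` over all `ℓ > k`. -/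
def natTail (γ : ℝ) : ℕ → ℝ
  | 0 => (3 + γ) / (6 + 3 * γ)
  | k + 1 => 1 / (2 * (2 + γ)) * ((1 - γ) / 2) ^ k

section

variable {γ : ℝ} (hγ0 : 0 ≤ γ) (hγ1 : γ ≤ 1)

include hγ0 in
theorem natTail_sub_succ (k : ℕ) : natTail γ k - natTail γ (k + 1) = deltaBeta γ (k + 1) := by
  have h2 : (2 + γ) ≠ 0 := by positivity
  have h6 : (6 + 3 * γ) ≠ 0 := by positivity
  cases k with
  | zero =>
    rw [zero_add, deltaBeta_one hγ0]
    simp only [natTail, pow_zero]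
    field_simp
    ring
  | succ k =>
    rw [deltaBeta_add_two hγ0]
    simp only [natTail, pow_succ]
    field_simp
    ring

include hγ0 hγ1 in
theorem natTail_nonneg (k : ℕ) : 0 ≤ natTail γ k := by
  have : 0 ≤ (1 - γ) / 2 := by linarith
  cases k <;> simp only [natTail] <;> positivity

include hγ0 hγ1 in
theorem tendsto_natTail (k : ℕ) :
    Filter.Tendsto (fun j => natTail γ (k + j)) Filter.atTop (nhds 0) := by
  have h : Filter.Tendsto (natTail γ) Filter.atTop (nhds 0) := by
    rw [← Filter.tendsto_add_atTop_iff_nat 1]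
    have := (tendsto_pow_atTop_nhds_zero_of_lt_one (r := (1 - γ) / 2) (by linarith)
      (by linarith)).const_mul (1 / (2 * (2 + γ)))
    rw [mul_zero] at this
    exact this
  have h2 := (Filter.tendsto_add_atTop_iff_nat k).2 h
  simpa only [add_comm k] using h2

include hγ0 hγ1 in
theorem deltaBeta_nonneg (k : ℕ) : 0 ≤ deltaBeta γ (k + 1) := by
  cases k with
  | zero =>
    rw [zero_add, deltaBeta_one hγ0]
    positivity
  | succ k =>
    rw [deltaBeta_add_two hγ0]
    have : 0 ≤ (1 - γ) / 2 := by linarith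
    positivity

include hγ0 hγ1 in
-- The series telescopes, and the closed form of the tails tends to 0.
theorem tsum_deltaBeta (k : ℕ) : ∑' j : ℕ, deltaBeta γ (k + 1 + j) = natTail γ k := by
  refine HasSum.tsum_eq ?_
  rw [hasSum_iff_tendsto_nat_of_nonneg]
  · have h : ∀ N, ∑ j ∈ Finset.range N, deltaBeta γ (k + 1 + j) =
        natTail γ k - natTail γ (k + N) := by
      intro N
      have hsum := Finset.sum_range_sub' (fun j => natTail γ (k + j)) N
      rw [add_zero] at hsum
      rw [← hsum]
      refine Finset.sum_congr rfl fun j _ => ?_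
      rw [← add_assoc k j 1, natTail_sub_succ hγ0]
      congr 1
      ring
    simp only [h]
    simpa using (tendsto_natTail hγ0 hγ1 k).const_sub (natTail γ k)
  · intro j
    have := deltaBeta_nonneg hγ0 hγ1 (k + j)
    rwa [show k + 1 + j = k + j + 1 by ring]

include hγ0 hγ1 in
theorem deltaBeta_succ_le (k : ℕ) : deltaBeta γ (k + 2) ≤ deltaBeta γ (k + 1) := by
  have h2 : 0 < 2 + γ := by positivity
  have hq : 0 ≤ (1 - γ) / 2 := by linarith
  cases k with
  | zero =>
    have h := deltaBeta_add_two hγ0 0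
    rw [pow_zero, mul_one] at h
    rw [h, zero_add, deltaBeta_one hγ0, div_div, div_le_div_iff₀ (by positivity) (by positivity)]
    nlinarith
  | succ k =>
    rw [deltaBeta_add_two hγ0, deltaBeta_add_two hγ0, pow_succ, ← mul_assoc]
    exact mul_le_of_le_one_right (by positivity) (by linarith)

include hγ0 hγ1 in
-- Increments from the second on have ratio (1-γ)/2 ≤ 1/2, so a tail is at most twice its first
-- term. For `k = 0` the closed forms are compared: 3 + γ against 3 + 2γ.
theorem natTail_le (k : ℕ) : natTail γ k ≤ 2 * deltaBeta γ (k + 1) := by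
  have h2 : 0 < 2 + γ := by positivity
  cases k with
  | zero =>
    rw [zero_add, deltaBeta_one hγ0]
    simp only [natTail]
    rw [mul_div_cancel₀ _ two_ne_zero]
    gcongr
    linarith
  | succ k =>
    rw [deltaBeta_add_two hγ0]
    simp only [natTail]
    rw [← mul_assoc]
    refine mul_le_mul_of_nonneg_right ?_ (pow_nonneg (by linarith) k)
    rw [mul_div_assoc', div_le_div_iff₀ (by positivity) (by positivity)]
    nlinarith

end

/-- Twice the next increment `Δβ(k + 1)`, for `k = k_a(y)`. -/
def residual (γ : ℝ) (k : ℕ∞) : ℝ :=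
  if k = ⊤ then 0 else 2 * deltaBeta γ (k.toNat + 1)

/-- The sum of all further increments `Δβ(ℓ)`, `ℓ > k`, for `k = k_a(y)`. -/
def betaTail (γ : ℝ) (k : ℕ∞) : ℝ :=
  if k = ⊤ then 0 else natTail γ k.toNat

theorem residual_top (γ : ℝ) : residual γ ⊤ = 0 := if_pos rfl

theorem betaTail_top (γ : ℝ) : betaTail γ ⊤ = 0 := if_pos rfl

theorem residual_coe (γ : ℝ) (k : ℕ) : residual γ k = 2 * deltaBeta γ (k + 1) := by
  simp [residual]

theorem betaTail_coe (γ : ℝ) (k : ℕ) : betaTail γ k = natTail γ k := by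
  simp [betaTail]

section

variable {γ : ℝ} (hγ0 : 0 ≤ γ) (hγ1 : γ ≤ 1)

include hγ0 hγ1 in
theorem residual_nonneg (k : ℕ∞) : 0 ≤ residual γ k := by
  unfold residual
  split_ifs
  · exact le_rfl
  · have := deltaBeta_nonneg hγ0 hγ1 k.toNat
    linarith

include hγ0 hγ1 in
theorem betaTail_nonneg (k : ℕ∞) : 0 ≤ betaTail γ k := by
  unfold betaTail
  split_ifs
  · exact le_rfl
  · exact natTail_nonneg hγ0 hγ1 _

include hγ0 hγ1 in
theorem residual_antitone : Antitone (residual γ) := by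
  intro k l hkl
  induction l using ENat.recTopCoe with
  | top => rw [residual_top]; exact residual_nonneg hγ0 hγ1 k
  | coe l =>
    induction k using ENat.recTopCoe with
    | top => simp at hkl
    | coe k =>
      rw [residual_coe, residual_coe]
      have h : Antitone fun k => deltaBeta γ (k + 1) :=
        antitone_nat_of_succ_le fun k => deltaBeta_succ_le hγ0 hγ1 k
      have := h (Nat.cast_le.1 hkl)
      simp only at this
      linarith

include hγ0 in
theorem residual_zero : residual γ 0 = (3 + 2 * γ) / (6 + 3 * γ) := by
  have := residual_coe γ 0
  rw [zero_add, deltaBeta_one hγ0] at this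
  rw [Nat.cast_zero] at this
  rw [this]
  ring

include hγ0 in
theorem betaTail_zero : betaTail γ 0 = 1 - (3 + 2 * γ) / (6 + 3 * γ) := by
  have := betaTail_coe γ 0
  rw [Nat.cast_zero] at this
  rw [this]
  simp only [natTail]
  have h6 : (6 + 3 * γ) ≠ 0 := by positivity
  field_simp
  ring

include hγ0 hγ1 in
theorem residual_le (k : ℕ∞) : residual γ k ≤ (3 + 2 * γ) / (6 + 3 * γ) := by
  rw [← residual_zero hγ0]
  exact residual_antitone hγ0 hγ1 zero_le

include hγ0 in
theorem betaTail_sub_succ {k : ℕ∞} (hk : k ≠ ⊤) :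
    betaTail γ k - betaTail γ (k + 1) = 1 / 2 * residual γ k := by
  lift k to ℕ using hk
  have : (k : ℕ∞) + 1 = ((k + 1 : ℕ) : ℕ∞) := by push_cast; rfl
  rw [this, betaTail_coe, betaTail_coe, residual_coe, natTail_sub_succ hγ0]
  ring

include hγ0 hγ1 in
theorem betaTail_le_residual (k : ℕ∞) : betaTail γ k ≤ residual γ k := by
  induction k using ENat.recTopCoe with
  | top => rw [betaTail_top, residual_top]
  | coe k => rw [betaTail_coe, residual_coe]; exact natTail_le hγ0 hγ1 k

include hγ0 hγ1 in
-- Two consecutive increments are the first two terms of the tail, whose other terms are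
-- nonnegative.
theorem residual_add_le (k : ℕ∞) :
    residual γ k + residual γ (k + 1) ≤ 2 * betaTail γ k := by
  induction k using ENat.recTopCoe with
  | top => simp [residual_top, betaTail_top]
  | coe k =>
    have : (k : ℕ∞) + 1 = ((k + 1 : ℕ) : ℕ∞) := by push_cast; rfl
    rw [this, betaTail_coe, residual_coe, residual_coe]
    have h1 := natTail_sub_succ hγ0 k
    have h2 := natTail_sub_succ hγ0 (k + 1)
    have h3 := natTail_nonneg hγ0 hγ1 (k + 1 + 1)
    linarith

include hγ0 hγ1 in
theorem residual_succ_le_betaTail (k : ℕ∞) : residual γ (k + 1) ≤ betaTail γ k := by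
  have h1 := residual_add_le hγ0 hγ1 k
  have h2 := residual_antitone hγ0 hγ1 (le_self_add : k ≤ k + 1)
  linarith

include hγ0 in
-- The identity that fixes the choice of Δα and Δβ: the right-hand side is exactly the selection
-- guarantee for `k + 1` semi-assignments.
theorem one_sub_residual_sub_betaTail_coe_succ (k : ℕ) :
    1 - residual γ ((k + 1 : ℕ) : ℕ∞) - betaTail γ ((k + 1 : ℕ) : ℕ∞) =
      1 - (1 / 2) ^ (k + 1) * (1 - γ) ^ k := by
  rw [betaTail_coe, residual_coe, deltaBeta_add_two hγ0]
  simp only [natTail, div_pow, one_pow, pow_succ]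
  have h2 : (2 + γ) ≠ 0 := by positivity
  field_simp
  ring

end

end AdWords
end

noncomputable section

namespace AdWords

variable {A : Type*} {n : ℕ} {I : AdWords A n} {a : A} {γ : ℝ}

/-! ### The offers -/

theorem integrableOn_comp_of_bounded {f : ℕ∞ → ℝ} {C : ℝ} (hf : ∀ k, |f k| ≤ C) {k : ℝ → ℕ∞}
    (hk : Measurable k) {B : ℝ} {S : Set ℝ} (hS : S ⊆ Set.Ico 0 B) :
    IntegrableOn (fun y => f (k y)) S :=
  Measure.integrableOn_of_bounded (M := C) (volume_ne_top_of_subset_Ico hS)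
    ((Measurable.of_discrete (f := f)).comp hk).aestronglyMeasurable
    (ae_of_all _ fun y => hf (k y))

section

variable (hγ0 : 0 ≤ γ) (hγ1 : γ ≤ 1)

include hγ0 hγ1 in
theorem integrableOn_residual {k : ℝ → ℕ∞} (hk : Measurable k) {B : ℝ} {S : Set ℝ}
    (hS : S ⊆ Set.Ico 0 B) : IntegrableOn (fun y => residual γ (k y)) S :=
  integrableOn_comp_of_bounded (C := (3 + 2 * γ) / (6 + 3 * γ)) (fun k => by
    rw [abs_of_nonneg (residual_nonneg hγ0 hγ1 k)]
    exact residual_le hγ0 hγ1 k) hk hS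

include hγ0 hγ1 in
theorem integrableOn_residual_succ {k : ℝ → ℕ∞} (hk : Measurable k) {B : ℝ} {S : Set ℝ}
    (hS : S ⊆ Set.Ico 0 B) : IntegrableOn (fun y => residual γ (k y + 1)) S :=
  integrableOn_residual hγ0 hγ1
    ((Measurable.of_discrete (f := fun k : ℕ∞ => k + 1)).comp hk) hS

include hγ0 hγ1 in
theorem integrableOn_betaTail {k : ℝ → ℕ∞} (hk : Measurable k) {B : ℝ} {S : Set ℝ}
    (hS : S ⊆ Set.Ico 0 B) : IntegrableOn (fun y => betaTail γ (k y)) S :=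
  integrableOn_comp_of_bounded (C := (3 + 2 * γ) / (6 + 3 * γ)) (fun k => by
    rw [abs_of_nonneg (betaTail_nonneg hγ0 hγ1 k)]
    exact (betaTail_le_residual hγ0 hγ1 k).trans (residual_le hγ0 hγ1 k)) hk hS

variable {s : State A} (hs : s.IsRegular I a) (b : A → ℝ)

include hs in
theorem State.IsRegular.offerR_eq : s.offerR γ I b a =
    1 / 2 * ∫ y in s.subset I b a, residual γ (s.k a y) := by
  unfold State.offerR
  rw [← integral_const_mul]
  refine setIntegral_congr_fun (hs.measurableSet_subset b) fun y hy => ?_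
  have hk : s.k a y ≠ ⊤ := (s.subset_subset_remaining I b a hy).2
  simp only [residual, if_neg hk]
  ring

include hγ0 hγ1 hs in
theorem State.IsRegular.offerD_eq : s.offerD γ I b a =
    ∫ y in s.subset I b a, betaTail γ (s.k a y) := by
  unfold State.offerD
  refine setIntegral_congr_fun (hs.measurableSet_subset b) fun y hy => ?_
  have hk : s.k a y ≠ ⊤ := (s.subset_subset_remaining I b a hy).2
  simp only [betaTail, if_neg hk]
  exact tsum_deltaBeta hγ0 hγ1 _

include hγ0 hγ1 hs in
theorem State.IsRegular.offerR_nonneg : 0 ≤ s.offerR γ I b a := by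
  rw [hs.offerR_eq]
  exact mul_nonneg (by norm_num)
    (integral_nonneg fun y => residual_nonneg hγ0 hγ1 _)

include hγ0 hγ1 hs in
theorem State.IsRegular.offerD_nonneg : 0 ≤ s.offerD γ I b a := by
  rw [hs.offerD_eq hγ0 hγ1]
  exact integral_nonneg fun y => betaTail_nonneg hγ0 hγ1 _

include hγ0 hγ1 hs in
-- Pointwise, the tail is at most twice its first increment.
theorem State.IsRegular.offerD_le : s.offerD γ I b a ≤ 2 * s.offerR γ I b a := by
  rw [hs.offerD_eq hγ0 hγ1, hs.offerR_eq, ← mul_assoc, mul_one_div_cancel two_ne_zero, one_mul]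
  have hS := s.subset_subset_Ico I b a
  exact setIntegral_mono (integrableOn_betaTail hγ0 hγ1 hs.measurable hS)
    (integrableOn_residual hγ0 hγ1 hs.measurable hS) fun y => betaTail_le_residual hγ0 hγ1 _

include hγ0 hγ1 hs in
/-- For a large bid, the points that are scanned have been semi-assigned least often. -/
theorem State.IsRegular.setIntegral_residual_diff_le (hb : b a ≤ I.budget a)
    (hl : I.budget a / 2 < b a) :
    ∫ y in s.remaining I a \ s.subset I b a, residual γ (s.k a y) ≤
      ∫ y in s.subset I b a, residual γ (s.k a y) := by
  have hB := I.budget_pos a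
  rcases hs.subset_of_large hb hl with ⟨he, -⟩ | ⟨hf, he⟩
  · rw [he, Set.sdiff_self, Measure.restrict_empty, integral_zero_measure]
    exact integral_nonneg fun y => residual_nonneg hγ0 hγ1 _
  · rw [he, hf.remaining_eq]
    set Y := arc (I.budget a) (s.start a) (b a) with hY
    have hYI : Y ⊆ Set.Ico 0 (I.budget a) := arc_subset_Ico _ _ _
    have hYm : MeasurableSet Y := measurableSet_arc _ _ _
    have hYv : volume.real Y = b a := volume_real_arc hs.start_mem (by linarith) hb
    have hDv : volume.real (Set.Ico 0 (I.budget a) \ Y) = I.budget a - b a := by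
      rw [measureReal_sdiff hYI hYm measure_Ico_lt_top.ne, hYv, Real.volume_real_Ico,
        sub_zero, max_eq_left hB.le]
    rcases (Set.Ico 0 (I.budget a) \ Y).eq_empty_or_nonempty with h0 | hne
    · rw [h0, Measure.restrict_empty, integral_zero_measure]
      exact integral_nonneg fun y => residual_nonneg hγ0 hγ1 _
    -- The least count outside the scanned arc separates the two integrands: counts are at least
    -- this outside and at most this inside. The arc is also the longer part, because the bid
    -- exceeds half the budget.
    · obtain ⟨_, ⟨z₀, hz₀, rfl⟩, hmin⟩ := WellFounded.has_min (wellFounded_lt (α := ℕ∞))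
        (s.k a '' (Set.Ico 0 (I.budget a) \ Y)) (hne.image _)
      have hT0 := residual_nonneg hγ0 hγ1 (s.k a z₀)
      calc ∫ y in Set.Ico 0 (I.budget a) \ Y, residual γ (s.k a y)
          ≤ ∫ _y in Set.Ico 0 (I.budget a) \ Y, residual γ (s.k a z₀) := by
            refine setIntegral_mono_on
              (integrableOn_residual hγ0 hγ1 hs.measurable Set.sdiff_subset)
              (integrableOn_const (volume_ne_top_of_subset_Ico Set.sdiff_subset))
              (measurableSet_Ico.diff hYm) fun y hy => ?_
            exact residual_antitone hγ0 hγ1 (not_lt.1 (hmin _ ⟨y, hy, rfl⟩))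
        _ ≤ ∫ _y in Y, residual γ (s.k a z₀) := by
            rw [setIntegral_const, setIntegral_const, hYv, hDv, smul_eq_mul, smul_eq_mul]
            exact mul_le_mul_of_nonneg_right (by linarith) hT0
        _ ≤ ∫ y in Y, residual γ (s.k a y) := by
            refine setIntegral_mono_on
              (integrableOn_const (volume_ne_top_of_subset_Ico hYI))
              (integrableOn_residual hγ0 hγ1 hs.measurable hYI) hYm fun y hy => ?_
            refine residual_antitone hγ0 hγ1 (hf.2 y hy.1 z₀ hz₀.1 ?_).1
            exact hy.2.le.trans (not_lt.1 fun h => hz₀.2 ⟨hz₀.1, h⟩)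

end

/-! ### The dual variables of the impressions -/

/-- The amount `β_i` of a round with decision `d` in state `s`. -/
def State.roundBeta (s : State A) (γ : ℝ) (I : AdWords A n) (b : A → ℝ) : Decision A → ℝ
  | .det a => s.offerD γ I b a
  | .rand a₁ a₂ => s.offerR γ I b a₁ + s.offerR γ I b a₂

section

variable (hγ0 : 0 ≤ γ) (hγ1 : γ ≤ 1) {s : State A} {b : A → ℝ} {d : Decision A}

theorem offerD_le_roundBeta (h : IsBasicDecision γ I s b d) :
    s.offerD γ I b a ≤ s.roundBeta γ I b d := by
  cases d with
  | det a' => exact h.1 a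
  | rand a₁ a₂ => exact h.2.2 a

include hγ0 hγ1 in
-- In a deterministic round won by `a'`, the randomized offers of `a` and `a'` sum to less than the
-- deterministic offer of `a'`, which is at most twice the randomized offer of `a'`. So `a` offers
-- less than half of what is accepted. In a randomized round both accepted offers are at least as
-- large as that of `a`.
theorem two_mul_offerR_le_roundBeta (hs : ∀ a, s.IsRegular I a) (h : IsBasicDecision γ I s b d)
    (h₁ : ¬ d.Assigns a) (h₂ : ¬ d.SemiAssigns a) :
    2 * s.offerR γ I b a ≤ s.roundBeta γ I b d := by
  cases d with
  | det a' =>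
    have h3 := h.2 a a' h₁
    have h4 := (hs a').offerD_le hγ0 hγ1 b
    simp only [State.roundBeta]
    linarith
  | rand a₁ a₂ =>
    have h3 := h.2.1 a (fun h' => h₂ (Or.inl h')) (fun h' => h₂ (Or.inr h'))
    simp only [State.roundBeta]
    linarith [h3.1, h3.2]

include hγ0 hγ1 in
theorem roundBeta_nonneg (hs : ∀ a, s.IsRegular I a) : 0 ≤ s.roundBeta γ I b d := by
  cases d with
  | det a' => exact (hs a').offerD_nonneg hγ0 hγ1 b
  | rand a₁ a₂ =>
    exact add_nonneg ((hs a₁).offerR_nonneg hγ0 hγ1 b) ((hs a₂).offerR_nonneg hγ0 hγ1 b)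

/-- A later function `k'` and the set `R` of the points where it is finite, for an impression that
arrives in state `s` and is treated according to `d`. -/
structure IsLaterK (s : State A) (I : AdWords A n) (b : A → ℝ) (d : Decision A) (a : A)
    (k' : ℝ → ℕ∞) (R : Set ℝ) : Prop where
  measurable : Measurable k'
  measurableSet : MeasurableSet R
  subset : R ⊆ s.remaining I a
  ne_top : ∀ y ∈ R, k' y ≠ ⊤
  le : ∀ y, (s.step I b d).k a y ≤ k' y

variable {k' : ℝ → ℕ∞} {R : Set ℝ}

theorem IsLaterK.k_le (hk : IsLaterK s I b d a k' R) (y : ℝ) : s.k a y ≤ k' y :=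
  (s.k_le_step_k I b d a y).trans (hk.le y)

theorem IsLaterK.k_add_one_le (hk : IsLaterK s I b d a k' R)
    (h : d.Assigns a ∨ d.SemiAssigns a) {y : ℝ} (hyR : y ∈ R) (hy : y ∈ s.subset I b a) :
    s.k a y + 1 ≤ k' y := by
  classical
  have h1 := hk.le y
  rcases h with h | h
  · rw [State.step_k_of_assigns h, if_pos hy, top_le_iff] at h1
    exact absurd h1 (hk.ne_top y hyR)
  · rwa [State.step_k_of_semiAssigns h, if_pos hy] at h1

include hγ0 hγ1 in
-- If the round touches `a`, the scanned points that stay finite have gained at least 1, and r(k+1)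
-- ≤ t(k) leads to the deterministic offer. If not, the integral is at most twice the rejected
-- randomized offer.
theorem setIntegral_inter_le_roundBeta (hs : ∀ a, s.IsRegular I a)
    (h : IsBasicDecision γ I s b d) (hk : IsLaterK s I b d a k' R) :
    ∫ y in s.subset I b a ∩ R, residual γ (k' y) ≤ s.roundBeta γ I b d := by
  set Y := s.subset I b a with hY
  have hYI : Y ⊆ Set.Ico 0 (I.budget a) := s.subset_subset_Ico I b a
  have hYm : MeasurableSet Y := (hs a).measurableSet_subset b
  have hYRI : Y ∩ R ⊆ Set.Ico 0 (I.budget a) := Set.inter_subset_left.trans hYI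
  by_cases ht : d.Assigns a ∨ d.SemiAssigns a
  · calc ∫ y in Y ∩ R, residual γ (k' y)
        ≤ ∫ y in Y ∩ R, betaTail γ (s.k a y) := by
          refine setIntegral_mono_on (integrableOn_residual hγ0 hγ1 hk.measurable hYRI)
            (integrableOn_betaTail hγ0 hγ1 (hs a).measurable hYRI)
            (hYm.inter hk.measurableSet) fun y hy => ?_
          exact (residual_antitone hγ0 hγ1 (hk.k_add_one_le ht hy.2 hy.1)).trans
            (residual_succ_le_betaTail hγ0 hγ1 _)
      _ ≤ ∫ y in Y, betaTail γ (s.k a y) :=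
          setIntegral_mono_set (integrableOn_betaTail hγ0 hγ1 (hs a).measurable hYI)
            (ae_of_all _ fun y => betaTail_nonneg hγ0 hγ1 _)
            (Set.inter_subset_left.eventuallyLE)
      _ ≤ s.roundBeta γ I b d := by
          rw [← (hs a).offerD_eq hγ0 hγ1]
          exact offerD_le_roundBeta h
  · push Not at ht
    calc ∫ y in Y ∩ R, residual γ (k' y)
        ≤ ∫ y in Y ∩ R, residual γ (s.k a y) :=
          setIntegral_mono (integrableOn_residual hγ0 hγ1 hk.measurable hYRI)
            (integrableOn_residual hγ0 hγ1 (hs a).measurable hYRI) fun y =>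
            residual_antitone hγ0 hγ1 (hk.k_le y)
      _ ≤ ∫ y in Y, residual γ (s.k a y) :=
          setIntegral_mono_set (integrableOn_residual hγ0 hγ1 (hs a).measurable hYI)
            (ae_of_all _ fun y => residual_nonneg hγ0 hγ1 _)
            (Set.inter_subset_left.eventuallyLE)
      _ ≤ s.roundBeta γ I b d := by
          have := two_mul_offerR_le_roundBeta hγ0 hγ1 hs h ht.1 ht.2
          rw [(hs a).offerR_eq] at this
          linarith

include hγ0 hγ1 in
-- The unscanned points contribute at most the integral of r(k) over the scanned ones. In a touched
-- round the two parts combine through r(k) + r(k+1) ≤ 2t(k). Otherwise each part is at most twice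
-- the rejected randomized offer.
theorem setIntegral_le_two_mul_roundBeta (hs : ∀ a, s.IsRegular I a)
    (h : IsBasicDecision γ I s b d) (hk : IsLaterK s I b d a k' R) (hb : b a ≤ I.budget a)
    (hl : I.budget a / 2 < b a) :
    ∫ y in R, residual γ (k' y) ≤ 2 * s.roundBeta γ I b d := by
  set Y := s.subset I b a with hY
  have hYI : Y ⊆ Set.Ico 0 (I.budget a) := s.subset_subset_Ico I b a
  have hRI : s.remaining I a ⊆ Set.Ico 0 (I.budget a) := s.remaining_subset_Ico I a
  have hYm : MeasurableSet Y := (hs a).measurableSet_subset b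
  have hYRI : Y ∩ R ⊆ Set.Ico 0 (I.budget a) := Set.inter_subset_left.trans hYI
  have hm := (hs a).measurable
  have hsplit : ∫ y in R, residual γ (k' y) =
      (∫ y in Y ∩ R, residual γ (k' y)) + ∫ y in R \ Y, residual γ (k' y) := by
    rw [Set.inter_comm,
      integral_inter_add_sdiff hYm (integrableOn_residual hγ0 hγ1 hk.measurable
        (hk.subset.trans hRI))]
  have hout : ∫ y in R \ Y, residual γ (k' y) ≤ ∫ y in Y, residual γ (s.k a y) := by
    calc ∫ y in R \ Y, residual γ (k' y)
        ≤ ∫ y in R \ Y, residual γ (s.k a y) :=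
          setIntegral_mono (integrableOn_residual hγ0 hγ1 hk.measurable
              (Set.sdiff_subset.trans (hk.subset.trans hRI)))
            (integrableOn_residual hγ0 hγ1 hm (Set.sdiff_subset.trans (hk.subset.trans hRI)))
            fun y => residual_antitone hγ0 hγ1 (hk.k_le y)
      _ ≤ ∫ y in s.remaining I a \ Y, residual γ (s.k a y) :=
          setIntegral_mono_set (integrableOn_residual hγ0 hγ1 hm (Set.sdiff_subset.trans hRI))
            (ae_of_all _ fun y => residual_nonneg hγ0 hγ1 _)
            ((Set.sdiff_subset_sdiff_left hk.subset).eventuallyLE)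
      _ ≤ _ := (hs a).setIntegral_residual_diff_le hγ0 hγ1 b hb hl
  rw [hsplit]
  by_cases ht : d.Assigns a ∨ d.SemiAssigns a
  · have hin : ∫ y in Y ∩ R, residual γ (k' y) ≤ ∫ y in Y, residual γ (s.k a y + 1) := by
      calc ∫ y in Y ∩ R, residual γ (k' y)
          ≤ ∫ y in Y ∩ R, residual γ (s.k a y + 1) :=
            setIntegral_mono_on (integrableOn_residual hγ0 hγ1 hk.measurable hYRI)
              (integrableOn_residual_succ hγ0 hγ1 hm hYRI)
              (hYm.inter hk.measurableSet) fun y hy =>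
                residual_antitone hγ0 hγ1 (hk.k_add_one_le ht hy.2 hy.1)
        _ ≤ _ := setIntegral_mono_set (integrableOn_residual_succ hγ0 hγ1 hm hYI)
            (ae_of_all _ fun y => residual_nonneg hγ0 hγ1 _)
            (Set.inter_subset_left.eventuallyLE)
    have hsum : (∫ y in Y, residual γ (s.k a y)) + ∫ y in Y, residual γ (s.k a y + 1) ≤
        2 * ∫ y in Y, betaTail γ (s.k a y) := by
      rw [← integral_const_mul, ← integral_add (integrableOn_residual hγ0 hγ1 hm hYI)
        (integrableOn_residual_succ hγ0 hγ1 hm hYI)]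
      exact setIntegral_mono ((integrableOn_residual hγ0 hγ1 hm hYI).add
        (integrableOn_residual_succ hγ0 hγ1 hm hYI))
        ((integrableOn_betaTail hγ0 hγ1 hm hYI).const_mul 2) fun y =>
          residual_add_le hγ0 hγ1 _
    have hD : s.offerD γ I b a ≤ s.roundBeta γ I b d := offerD_le_roundBeta h
    rw [(hs a).offerD_eq hγ0 hγ1] at hD
    linarith
  · have hin := setIntegral_inter_le_roundBeta hγ0 hγ1 hs h hk
    push Not at ht
    have hR := two_mul_offerR_le_roundBeta hγ0 hγ1 hs h ht.1 ht.2
    rw [(hs a).offerR_eq] at hR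
    linarith

include hγ0 hγ1 in
-- The unscanned part has measure at most the budget minus the bid, and `residual` never exceeds its
-- value Γ at 0.
theorem setIntegral_le_roundBeta_add (hs : ∀ a, s.IsRegular I a)
    (h : IsBasicDecision γ I s b d) (hk : IsLaterK s I b d a k' R) (hb : b a ≤ I.budget a)
    (hl : I.budget a / 2 < b a) :
    ∫ y in R, residual γ (k' y) ≤
      s.roundBeta γ I b d + (3 + 2 * γ) / (6 + 3 * γ) * (I.budget a - b a) := by
  set Y := s.subset I b a with hY
  have hB := I.budget_pos a
  have hΓ : 0 ≤ (3 + 2 * γ) / (6 + 3 * γ) := by positivity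
  have hRI : s.remaining I a ⊆ Set.Ico 0 (I.budget a) := s.remaining_subset_Ico I a
  have hYm : MeasurableSet Y := (hs a).measurableSet_subset b
  have hRYI : R \ Y ⊆ Set.Ico 0 (I.budget a) := Set.sdiff_subset.trans (hk.subset.trans hRI)
  rw [← integral_inter_add_sdiff hYm (integrableOn_residual hγ0 hγ1 hk.measurable
        (hk.subset.trans hRI)), Set.inter_comm]
  refine add_le_add (setIntegral_inter_le_roundBeta hγ0 hγ1 hs h hk) ?_
  have hvol : volume.real (R \ Y) ≤ I.budget a - b a := by
    refine (measureReal_mono (Set.sdiff_subset_sdiff_left hk.subset)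
      (volume_ne_top_of_subset_Ico (Set.sdiff_subset.trans hRI))).trans ?_
    rcases (hs a).subset_of_large hb hl with ⟨he, -⟩ | ⟨hf, he⟩
    · rw [hY, he, Set.sdiff_self, measureReal_empty]
      linarith
    · rw [hY, he, hf.remaining_eq, measureReal_sdiff (arc_subset_Ico _ _ _)
        (measurableSet_arc _ _ _) measure_Ico_lt_top.ne,
        volume_real_arc (hs a).start_mem (by linarith) hb, Real.volume_real_Ico, sub_zero,
        max_eq_left hB.le]
  calc ∫ y in R \ Y, residual γ (k' y)
      ≤ ∫ _y in R \ Y, (3 + 2 * γ) / (6 + 3 * γ) :=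
        setIntegral_mono (integrableOn_residual hγ0 hγ1 hk.measurable hRYI)
          (integrableOn_const (volume_ne_top_of_subset_Ico hRYI)) fun y =>
          residual_le hγ0 hγ1 _
    _ ≤ _ := by
        rw [setIntegral_const, smul_eq_mul, mul_comm]
        exact mul_le_mul_of_nonneg_left hvol hΓ

end

end AdWords
end

noncomputable section

namespace AdWords

variable {A : Type*} {n : ℕ} {I : AdWords A n} {d : Fin n → Decision A} {γ : ℝ}

/-! ### Runs of the algorithm -/

theorem exists_isBasicDecision [Finite A] [Nonempty A] (γ : ℝ) (I : AdWords A n) (s : State A)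
    (b : A → ℝ) : ∃ d, IsBasicDecision γ I s b d := by
  obtain ⟨a', ha'⟩ := Finite.exists_max fun a => s.offerD γ I b a
  by_cases hdet : ∀ a₁ a₂, a₁ ≠ a₂ →
      s.offerR γ I b a₁ + s.offerR γ I b a₂ < s.offerD γ I b a'
  · exact ⟨.det a', ha', hdet⟩
  · push Not at hdet
    obtain ⟨c₁, c₂, hc, hD⟩ := hdet
    -- A pair of distinct advertisers with maximal sum of offers consists of two largest ones, by
    -- exchanging one member. With a single advertiser the deterministic case above applies
    -- vacuously.
    have : Nonempty {q : A × A // q.1 ≠ q.2} := ⟨⟨(c₁, c₂), hc⟩⟩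
    obtain ⟨⟨⟨a₁, a₂⟩, hne⟩, hmax⟩ := Finite.exists_max
      fun q : {q : A × A // q.1 ≠ q.2} => s.offerR γ I b q.1.1 + s.offerR γ I b q.1.2
    refine ⟨.rand a₁ a₂, hne, fun a h₁ h₂ => ⟨?_, ?_⟩, fun a => ?_⟩
    · have := hmax ⟨(a, a₂), h₂⟩
      simp only at this
      linarith
    · have := hmax ⟨(a₁, a), h₁.symm⟩
      simp only at this
      linarith
    · have := hmax ⟨(c₁, c₂), hc⟩
      simp only at this
      exact (ha' a).trans (hD.trans this)

theorem stateAt_congr {d' : Fin n → Decision A} {m : ℕ} (h : ∀ i : Fin n, i.val < m → d i = d' i) :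
    stateAt I d m = stateAt I d' m := by
  induction m with
  | zero => rfl
  | succ m ih =>
    have ih := ih fun i hi => h i (by omega)
    by_cases hm : m < n
    · rw [stateAt, stateAt, dif_pos hm, dif_pos hm, ih, h ⟨m, hm⟩ (Nat.lt_succ_self m)]
    · rw [stateAt, stateAt, dif_neg hm, dif_neg hm, ih]

/-- Decisions are fixed one round at a time. Changing the decision of round `m` leaves the states up
to its arrival unchanged. -/
theorem exists_isBasicRun [Finite A] [Nonempty A] (γ : ℝ) (I : AdWords A n) :
    ∃ d, IsBasicRun γ I d := by
  suffices h : ∀ m, m ≤ n → ∃ d : Fin n → Decision A, ∀ i : Fin n, i.val < m →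
      IsBasicDecision γ I (stateAt I d i) (I.bid i) (d i) by
    obtain ⟨d, hd⟩ := h n le_rfl
    exact ⟨d, fun i => hd i i.2⟩
  intro m
  induction m with
  | zero => exact fun _ => ⟨fun _ => .det (Classical.arbitrary A), fun i hi => by omega⟩
  | succ m ih =>
    intro hm
    obtain ⟨d, hd⟩ := ih (by omega)
    obtain ⟨e, he⟩ := exists_isBasicDecision γ I (stateAt I d m) (I.bid ⟨m, hm⟩)
    have hcongr : ∀ j, j ≤ m →
        stateAt I (Function.update d ⟨m, hm⟩ e) j = stateAt I d j := fun j hj =>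
      stateAt_congr fun i hi => Function.update_of_ne (fun h => by
        rw [h] at hi
        simp only at hi
        omega) _ _
    refine ⟨Function.update d ⟨m, hm⟩ e, fun i hi => ?_⟩
    rw [hcongr i (by omega)]
    by_cases him : i = ⟨m, hm⟩
    · subst him
      rw [Function.update_self]
      exact he
    · rw [Function.update_of_ne him]
      refine hd i ?_
      rw [Fin.ext_iff] at him
      simp only at him
      omega

theorem IsBasicRun.ne (h : IsBasicRun γ I d) {i : Fin n} {a₁ a₂ : A} (hi : d i = .rand a₁ a₂) :
    a₁ ≠ a₂ := by
  have := h i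
  rw [hi] at this
  exact this.1

/-! ### Dual feasibility -/

/-- The amount `β_i` in a run. -/
def runBeta (γ : ℝ) (I : AdWords A n) (d : Fin n → Decision A) (i : Fin n) : ℝ :=
  (stateAt I d i).roundBeta γ I (I.bid i) (d i)

theorem isLaterK_stateAt (hL : I.LargeBids) (d : Fin n → Decision A) (i : Fin n) (a : A) :
    IsLaterK (stateAt I d i) I (I.bid i) (d i) a ((stateAt I d n).k a)
      ((stateAt I d n).remaining I a) where
  measurable := (stateAt_isRegular hL d n a).measurable
  measurableSet := (stateAt_isRegular hL d n a).measurableSet_remaining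
  subset := antitone_stateAt_remaining I d a i.2.le
  ne_top := fun _ hy => hy.2
  le := fun y => by
    rw [← stateAt_succ i]
    exact monotone_stateAt_k I d a y i.2

section

variable (hγ0 : 0 ≤ γ) (hγ1 : γ ≤ 1)

include hγ0 hγ1 in
-- Approximate dual feasibility for whole bundles: Γ times the budget minus the integral plays the
-- role of the dual variable of `a`.
theorem payment_le (hL : I.LargeBids) (hd : IsBasicRun γ I d) (a : A) (S : Finset (Fin n)) :
    (3 + 2 * γ) / (6 + 3 * γ) * I.payment a S ≤
      (3 + 2 * γ) / (6 + 3 * γ) * I.budget a -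
        (∫ y in (stateAt I d n).remaining I a, residual γ ((stateAt I d n).k a y)) +
        ∑ i ∈ S, runBeta γ I d i := by
  classical
  set Γ := (3 + 2 * γ) / (6 + 3 * γ) with hΓ
  set R := (stateAt I d n).remaining I a with hR
  have hΓ0 : 0 ≤ Γ := by positivity
  have hB := I.budget_pos a
  have hreg := fun i : Fin n => stateAt_isRegular hL d i
  have hβ0 : ∀ i, 0 ≤ runBeta γ I d i := fun i => roundBeta_nonneg hγ0 hγ1 (hreg i)
  set L := S.filter fun i => I.budget a / 2 < I.bid i a with hLdef
  have hLS : L ⊆ S := Finset.filter_subset _ _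
  have hsum : ∑ i ∈ S, I.bid i a = ∑ i ∈ L, I.bid i a := by
    rw [hLdef, Finset.sum_filter]
    refine Finset.sum_congr rfl fun i _ => ?_
    split_ifs with h
    · rfl
    · exact (hL i a).resolve_right h
  have hβL : ∑ i ∈ L, runBeta γ I d i ≤ ∑ i ∈ S, runBeta γ I d i :=
    Finset.sum_le_sum_of_subset_of_nonneg hLS fun i _ _ => hβ0 i
  have hmemL : ∀ i ∈ L, I.budget a / 2 < I.bid i a := fun i hi => (Finset.mem_filter.1 hi).2
  unfold payment
  rw [hsum]
  -- No large bid: the dual variable of `a` is nonnegative. One: the payment is the bid itself. Two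
  -- or more: the payment is at most the budget, and each of two rounds pays for half of the
  -- integral.
  rcases Nat.lt_or_ge L.card 2 with hcard | hcard
  · rcases L.eq_empty_or_nonempty with h0 | hne
    · have hle : ∫ y in R, residual γ ((stateAt I d n).k a y) ≤ Γ * I.budget a := by
        have hRI : R ⊆ Set.Ico 0 (I.budget a) := State.remaining_subset_Ico _ _ _
        calc ∫ y in R, residual γ ((stateAt I d n).k a y) ≤ ∫ _y in R, Γ :=
              setIntegral_mono (integrableOn_residual hγ0 hγ1
                (stateAt_isRegular hL d n a).measurable hRI)
                (integrableOn_const (volume_ne_top_of_subset_Ico hRI)) fun y =>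
                residual_le hγ0 hγ1 _
          _ ≤ Γ * I.budget a := by
              rw [setIntegral_const, smul_eq_mul, mul_comm]
              refine mul_le_mul_of_nonneg_left ?_ hΓ0
              have := measureReal_mono (μ := volume) hRI measure_Ico_lt_top.ne
              rwa [Real.volume_real_Ico, sub_zero, max_eq_left hB.le] at this
      rw [h0, Finset.sum_empty] at hβL
      rw [h0, Finset.sum_empty, min_eq_left hB.le, mul_zero]
      linarith
    · obtain ⟨i, hi⟩ := Finset.card_eq_one.1
        (le_antisymm (Nat.lt_succ_iff.1 hcard) hne.card_pos)
      have hl : I.budget a / 2 < I.bid i a := hmemL i (by rw [hi]; exact Finset.mem_singleton_self i)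
      have h1 := setIntegral_le_roundBeta_add hγ0 hγ1 (hreg i) (hd i)
        (isLaterK_stateAt hL d i a) (I.bid_le_budget i a) hl
      rw [hi, Finset.sum_singleton] at hβL
      rw [hi, Finset.sum_singleton, min_eq_left (I.bid_le_budget i a)]
      unfold runBeta at hβL ⊢
      linarith
  · obtain ⟨i, hi, j, hj, hij⟩ := Finset.one_lt_card.1 hcard
    have h1 := setIntegral_le_two_mul_roundBeta hγ0 hγ1 (hreg i) (hd i)
        (isLaterK_stateAt hL d i a) (I.bid_le_budget i a) (hmemL i hi)
    have h2 := setIntegral_le_two_mul_roundBeta hγ0 hγ1 (hreg j) (hd j)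
        (isLaterK_stateAt hL d j a) (I.bid_le_budget j a) (hmemL j hj)
    have h3 : runBeta γ I d i + runBeta γ I d j ≤ ∑ i ∈ L, runBeta γ I d i := by
      rw [← Finset.sum_pair hij]
      exact Finset.sum_le_sum_of_subset_of_nonneg
        (Finset.insert_subset hi (Finset.singleton_subset_iff.2 hj)) fun i _ _ => hβ0 i
    have h4 : Γ * min (∑ i ∈ L, I.bid i a) (I.budget a) ≤ Γ * I.budget a :=
      mul_le_mul_of_nonneg_left (min_le_right _ _) hΓ0
    unfold runBeta at hβL h3 ⊢
    linarith

/-- The value of the relaxed primal solution for the advertiser `a`. -/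
def primalValue (γ : ℝ) (I : AdWords A n) (d : Fin n → Decision A) (a : A) : ℝ :=
  ∫ y in Set.Ico 0 (I.budget a),
    (1 - residual γ ((stateAt I d n).k a y) - betaTail γ ((stateAt I d n).k a y))

include hγ0 hγ1 in
theorem primalValue_eq (hL : I.LargeBids) (d : Fin n → Decision A) (a : A) :
    primalValue γ I d a = I.budget a -
      (∫ y in (stateAt I d n).remaining I a, residual γ ((stateAt I d n).k a y)) -
      ∫ y in Set.Ico 0 (I.budget a), betaTail γ ((stateAt I d n).k a y) := by
  have hm := (stateAt_isRegular hL d n a).measurable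
  have h1 := integrableOn_residual hγ0 hγ1 hm (subset_refl (Set.Ico 0 (I.budget a)))
  have h2 := integrableOn_betaTail hγ0 hγ1 hm (subset_refl (Set.Ico 0 (I.budget a)))
  have h3 : IntegrableOn (fun _ : ℝ => (1 : ℝ)) (Set.Ico 0 (I.budget a)) :=
    integrableOn_const measure_Ico_lt_top.ne
  unfold primalValue
  have h4 : IntegrableOn (fun y => 1 - residual γ ((stateAt I d n).k a y))
      (Set.Ico 0 (I.budget a)) := h3.sub h1
  rw [integral_sub h4 h2, integral_sub h3 h1, setIntegral_const, Real.volume_real_Ico,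
    sub_zero, max_eq_left (I.budget_pos a).le, smul_eq_mul, mul_one,
    setIntegral_eq_of_subset_of_forall_sdiff_eq_zero measurableSet_Ico
      ((stateAt I d n).remaining_subset_Ico I a)]
  intro y hy
  have : (stateAt I d n).k a y = ⊤ := by
    by_contra h
    exact hy.2 ⟨hy.1, h⟩
  rw [this, residual_top]

include hγ0 hγ1 in
open Classical in
-- A semi-assignment removes the first increment from the tail of each scanned point, and a
-- deterministic assignment removes the whole tail. These amounts are precisely the offers.
theorem setIntegral_betaTail_step {s : State A} {a : A} (hs : s.IsRegular I a) {b : A → ℝ}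
    {d : Decision A} (hs' : (s.step I b d).IsRegular I a) :
    (∫ y in Set.Ico 0 (I.budget a), betaTail γ (s.k a y)) -
      ∫ y in Set.Ico 0 (I.budget a), betaTail γ ((s.step I b d).k a y) =
      if d.Assigns a then s.offerD γ I b a else
        if d.SemiAssigns a then s.offerR γ I b a else 0 := by
  have hYI := s.subset_subset_Ico I b a
  have hYm := hs.measurableSet_subset b
  rw [← integral_sub (integrableOn_betaTail hγ0 hγ1 hs.measurable subset_rfl)
    (integrableOn_betaTail hγ0 hγ1 hs'.measurable subset_rfl)]
  by_cases h₁ : d.Assigns a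
  · rw [if_pos h₁, hs.offerD_eq hγ0 hγ1,
      setIntegral_eq_of_subset_of_forall_sdiff_eq_zero measurableSet_Ico hYI]
    · refine setIntegral_congr_fun hYm fun y hy => ?_
      rw [State.step_k_of_assigns h₁, if_pos hy, betaTail_top, sub_zero]
    · intro y hy
      rw [State.step_k_of_assigns h₁, if_neg hy.2, sub_self]
  · rw [if_neg h₁]
    by_cases h₂ : d.SemiAssigns a
    · rw [if_pos h₂, hs.offerR_eq, ← integral_const_mul,
        setIntegral_eq_of_subset_of_forall_sdiff_eq_zero measurableSet_Ico hYI]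
      · refine setIntegral_congr_fun hYm fun y hy => ?_
        rw [State.step_k_of_semiAssigns h₂, if_pos hy]
        exact betaTail_sub_succ hγ0 (s.subset_subset_remaining I b a hy).2
      · intro y hy
        rw [State.step_k_of_semiAssigns h₂, if_neg hy.2, sub_self]
    · rw [if_neg h₂]
      simp only [State.step_k_of_not h₁ h₂, sub_self, integral_zero]

variable [Fintype A]

include hγ0 hγ1 in
/-- The sum of the `β_i` is the total decrease of the tails. -/
theorem sum_runBeta (hL : I.LargeBids) (hd : IsBasicRun γ I d) :
    ∑ i, runBeta γ I d i = ∑ a, ((1 - (3 + 2 * γ) / (6 + 3 * γ)) * I.budget a -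
      ∫ y in Set.Ico 0 (I.budget a), betaTail γ ((stateAt I d n).k a y)) := by
  classical
  set Φ : ℕ → ℝ := fun m =>
    ∑ a, ∫ y in Set.Ico 0 (I.budget a), betaTail γ ((stateAt I d m).k a y) with hΦ
  have hstep : ∀ i : Fin n, runBeta γ I d i = Φ i - Φ (i + 1) := by
    intro i
    have hreg := stateAt_isRegular hL d
    simp only [hΦ]
    rw [← Finset.sum_sub_distrib]
    have h1 : ∀ a, (∫ y in Set.Ico 0 (I.budget a), betaTail γ ((stateAt I d i).k a y)) -
        ∫ y in Set.Ico 0 (I.budget a), betaTail γ ((stateAt I d (i + 1)).k a y) =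
        if (d i).Assigns a then (stateAt I d i).offerD γ I (I.bid i) a else
          if (d i).SemiAssigns a then (stateAt I d i).offerR γ I (I.bid i) a else 0 := by
      intro a
      have h2 := hreg (i + 1) a
      rw [stateAt_succ i] at h2 ⊢
      exact setIntegral_betaTail_step hγ0 hγ1 (hreg i a) h2
    rw [Finset.sum_congr rfl fun a _ => h1 a, runBeta]
    cases hdi : d i with
    | det a' =>
      rw [Finset.sum_eq_single a' (fun a _ ha =>
          (if_neg (show ¬ (Decision.det a').Assigns a from ha)).trans
            (if_neg (show ¬ (Decision.det a').SemiAssigns a from id)))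
        (fun h => absurd (Finset.mem_univ _) h)]
      exact (if_pos rfl).symm
    | rand a₁ a₂ =>
      have hnot : ∀ a, ¬ (Decision.rand a₁ a₂).Assigns a := fun _ => id
      have hsemi : ∀ a, a ∈ ({a₁, a₂} : Finset A) ↔ (Decision.rand a₁ a₂).SemiAssigns a := by
        intro a
        rw [Finset.mem_insert, Finset.mem_singleton]
        rfl
      rw [← Finset.sum_subset (Finset.subset_univ {a₁, a₂}) fun a _ ha => by
        rw [if_neg (hnot a), if_neg fun h => ha ((hsemi a).2 h)],
        Finset.sum_pair (hd.ne hdi), if_neg (hnot _), if_neg (hnot _),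
        if_pos ((hsemi a₁).1 (Finset.mem_insert_self _ _)),
        if_pos ((hsemi a₂).1 (Finset.mem_insert_of_mem (Finset.mem_singleton_self _)))]
      rfl
  have h0 : Φ 0 = ∑ a, (1 - (3 + 2 * γ) / (6 + 3 * γ)) * I.budget a := by
    refine Finset.sum_congr rfl fun a _ => ?_
    have : ∀ y, (stateAt I d 0).k a y = 0 := fun y => rfl
    simp only [this, betaTail_zero hγ0]
    rw [setIntegral_const, Real.volume_real_Ico, sub_zero, max_eq_left (I.budget_pos a).le,
      smul_eq_mul, mul_comm]
  rw [Finset.sum_sub_distrib, ← h0, Finset.sum_congr rfl fun i _ => hstep i,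
    Fin.sum_univ_eq_sum_range (fun m => Φ m - Φ (m + 1)) n, Finset.sum_range_sub']

include hγ0 hγ1 in
-- Weak duality: summing the bundle inequalities over any assignment counts each `runBeta` once, and
-- the dual total equals the total relaxed primal value.
theorem mul_opt_le [Nonempty A] (hL : I.LargeBids) (hd : IsBasicRun γ I d) :
    (3 + 2 * γ) / (6 + 3 * γ) * I.opt ≤ ∑ a, primalValue γ I d a := by
  classical
  have hΓ : 0 < (3 + 2 * γ) / (6 + 3 * γ) := by positivity
  have hobj : ∀ f : Fin n → A, (3 + 2 * γ) / (6 + 3 * γ) * I.objective f ≤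
      ∑ a, primalValue γ I d a := by
    intro f
    unfold objective
    rw [Finset.mul_sum]
    refine (Finset.sum_le_sum fun a _ => payment_le hγ0 hγ1 hL hd a _).trans (le_of_eq ?_)
    rw [Finset.sum_add_distrib,
      Finset.sum_fiberwise (s := Finset.univ) f fun i => runBeta γ I d i,
      sum_runBeta hγ0 hγ1 hL hd, ← Finset.sum_add_distrib]
    refine Finset.sum_congr rfl fun a _ => ?_
    rw [primalValue_eq hγ0 hγ1 hL]
    ring
  rw [mul_comm, ← le_div_iff₀ hΓ]
  refine ciSup_le fun f => ?_
  rw [le_div_iff₀ hΓ, mul_comm]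
  exact hobj f

end

end AdWords
end

noncomputable section

namespace AdWords

variable {A : Type*} {n : ℕ} {I : AdWords A n} {d : Fin n → Decision A} {γ : ℝ} {a : A}

/-! ### The expected objective -/

open Classical in
/-- The impressions that `a` gets. -/
def wonRounds (d : Fin n → Decision A) (a : A) (ω : Fin n → Outcome) : Finset (Fin n) :=
  Finset.univ.filter fun i => (d i).pick (ω i).2 = a

theorem mem_wonRounds {ω : Fin n → Outcome} {i : Fin n} :
    i ∈ wonRounds d a ω ↔ (d i).pick (ω i).2 = a := by
  simp [wonRounds]

/-- The points of `a` that are assigned. -/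
def wonPoints (I : AdWords A n) (d : Fin n → Decision A) (a : A) (ω : Fin n → Outcome) : Set ℝ :=
  ⋃ i ∈ wonRounds d a ω, subsetAt I d i a

theorem wonPoints_subset_Ico (I : AdWords A n) (d : Fin n → Decision A) (a : A)
    (ω : Fin n → Outcome) : wonPoints I d a ω ⊆ Set.Ico 0 (I.budget a) :=
  Set.iUnion₂_subset fun i _ => subsetAt_subset_Ico I d i a

theorem measurableSet_wonPoints (hL : I.LargeBids) (d : Fin n → Decision A) (a : A)
    (ω : Fin n → Outcome) : MeasurableSet (wonPoints I d a ω) :=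
  Finset.measurableSet_biUnion _ fun i _ => measurableSet_subsetAt hL d i a

/-- The union bound compares the measure with the sum of the bids, and containment in the interval
compares it with the budget. -/
theorem volume_real_wonPoints_le (hL : I.LargeBids) (d : Fin n → Decision A) (a : A)
    (ω : Fin n → Outcome) :
    volume.real (wonPoints I d a ω) ≤ I.payment a (wonRounds d a ω) := by
  refine le_min ?_ ?_
  · refine (measureReal_biUnion_finset_le _ _).trans (Finset.sum_le_sum fun i _ => ?_)
    exact (stateAt_isRegular hL d i a).volume_real_subset_le (I.bid_le_budget i a) (hL i a)
  · have := measureReal_mono (μ := volume) (wonPoints_subset_Ico I d a ω) measure_Ico_lt_top.ne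
    rwa [Real.volume_real_Ico, sub_zero, max_eq_left (I.budget_pos a).le] at this

theorem stateAt_k_eq_top_iff {y : ℝ} : (stateAt I d n).k a y = ⊤ ↔
    ∃ i, (d i).Assigns a ∧ y ∈ subsetAt I d i a := by
  classical
  rw [stateAt_k_eq I d a y n le_rfl]
  have : (∃ i : Fin n, i.val < n ∧ (d i).Assigns a ∧ y ∈ subsetAt I d i a) ↔
      ∃ i, (d i).Assigns a ∧ y ∈ subsetAt I d i a :=
    exists_congr fun i => and_iff_right i.2
  rw [if_congr this rfl rfl]
  split_ifs with h
  · exact ⟨fun _ => h, fun _ => rfl⟩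
  · exact ⟨fun h' => absurd h' (ENat.natCast_ne_top _), fun h' => absurd h' h⟩

theorem stateAt_k_eq_card {y : ℝ} (h : (stateAt I d n).k a y ≠ ⊤) :
    (stateAt I d n).k a y = ((semiRounds I d a y).card : ℕ∞) := by
  classical
  have h1 := stateAt_k_eq I d a y n le_rfl
  split_ifs at h1 with h2
  · exact absurd h1 h
  · rw [h1, Finset.filter_true_of_mem fun i _ => i.2]

theorem Decision.pick_of_assigns {D : Decision A} (h : D.Assigns a) (c : Bool) :
    D.pick c = a := by
  cases D with
  | det a' => exact h.symm
  | rand a₁ a₂ => exact h.elim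

theorem exists_pick_ne (hd : ∀ i a₁ a₂, d i = .rand a₁ a₂ → a₁ ≠ a₂) (a : A) :
    ∃ r : Fin n → Bool, ∀ v, (d v).SemiAssigns a → (d v).pick (r v) ≠ a := by
  suffices h : ∀ v, ∃ c, (d v).SemiAssigns a → (d v).pick c ≠ a from Classical.skolem.1 h
  intro v
  cases hv : d v with
  | det a' => exact ⟨true, fun h => h.elim⟩
  | rand a₁ a₂ =>
    by_cases h : a₁ = a
    · exact ⟨false, fun _ h' => hd v a₁ a₂ hv (h.trans h'.symm)⟩
    · exact ⟨true, fun _ => h⟩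

/-- A point that is never assigned in a round that semi-assigns it has the prescribed bits. -/
theorem one_sub_bitsIndicator_le {y : ℝ} {r : Fin n → Bool}
    (ω : Fin n → Outcome) (hr : ∀ v, (d v).SemiAssigns a → (d v).pick (r v) ≠ a) :
    1 - bitsIndicator (semiRounds I d a y) r ω ≤
      (wonPoints I d a ω).indicator (fun _ => (1 : ℝ)) y := by
  by_cases hy : y ∈ wonPoints I d a ω
  · rw [Set.indicator_of_mem hy]
    linarith [bitsIndicator_nonneg (semiRounds I d a y) r ω]
  · rw [Set.indicator_of_notMem hy, bitsIndicator, if_pos, sub_self]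
    intro v hv
    obtain ⟨h1, h2⟩ := mem_semiRounds.1 hv
    have h3 : (d v).pick (ω v).2 ≠ a := fun h =>
      hy (Set.mem_iUnion₂.2 ⟨v, mem_wonRounds.2 h, h2⟩)
    have h4 := hr v h1
    by_contra hne
    obtain ⟨b, hb⟩ := exists_pick_eq h1
    have h6 : (ω v).2 ≠ b := fun h => h3 (by rw [h, hb])
    have h7 : r v ≠ b := fun h => h4 (by rw [h, hb])
    exact hne ((Bool.eq_not.2 h6).trans (Bool.eq_not.2 h7).symm)

/-- When only a null set remains, a zero bid scans all of it, so counts there can grow without large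
bids. Such points have to be discarded before the selection guarantee is applied. -/
theorem ae_k_eq_top_or (I : AdWords A n) (d : Fin n → Decision A) (a : A) :
    ∀ᵐ y ∂volume.restrict (Set.Ico 0 (I.budget a)),
      (stateAt I d n).k a y = ⊤ ∨ 0 < volume.real ((stateAt I d n).remaining I a) := by
  rcases (measureReal_nonneg (μ := volume) (s := (stateAt I d n).remaining I a)).eq_or_lt
    with hz | hpos
  · rw [ae_restrict_iff' measurableSet_Ico]
    have h0 : volume ((stateAt I d n).remaining I a) = 0 :=
      (measureReal_eq_zero_iff
        (volume_ne_top_of_subset_Ico (State.remaining_subset_Ico _ _ _))).1 hz.symm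
    filter_upwards [measure_eq_zero_iff_ae_notMem.1 h0] with y hy hyI
    by_contra h
    exact hy ⟨hyI, fun h' => h (Or.inl h')⟩
  · exact ae_of_all _ fun _ => Or.inr hpos

variable [Fintype A]

/-- The probability that a point is assigned is at least its share of the relaxed primal
solution. -/
theorem le_lawMean_indicator (hL : I.LargeBids)
    (hd : ∀ i a₁ a₂, d i = .rand a₁ a₂ → a₁ ≠ a₂) {y : ℝ}
    (hy : (stateAt I d n).k a y = ⊤ ∨ 0 < volume.real ((stateAt I d n).remaining I a)) :
    1 - residual 0.05144 ((stateAt I d n).k a y) - betaTail 0.05144 ((stateAt I d n).k a y) ≤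
      lawMean I d n fun ω => (wonPoints I d a ω).indicator (fun _ => (1 : ℝ)) y := by
  have hγ : (0 : ℝ) ≤ 0.05144 := by norm_num
  by_cases htop : (stateAt I d n).k a y = ⊤
  · obtain ⟨i, h1, h2⟩ := stateAt_k_eq_top_iff.1 htop
    have : ∀ ω, (wonPoints I d a ω).indicator (fun _ => (1 : ℝ)) y = 1 := fun ω =>
      Set.indicator_of_mem
        (Set.mem_iUnion₂.2 ⟨i, mem_wonRounds.2 (Decision.pick_of_assigns h1 _), h2⟩) _
    simp only [this]
    rw [htop, residual_top, betaTail_top, lawMean, pmfMean_const]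
    norm_num
  · have hpos := hy.resolve_left htop
    rw [stateAt_k_eq_card htop]
    rcases hK : (semiRounds I d a y).card with _ | K
    · rw [Nat.cast_zero, residual_zero hγ, betaTail_zero hγ]
      have h0 : lawMean I d n (fun _ => 0) = 0 := pmfMean_const _ 0
      have h1 : lawMean I d n (fun _ => 0) ≤
          lawMean I d n fun ω => (wonPoints I d a ω).indicator (fun _ => (1 : ℝ)) y :=
        lawMean_mono fun ω => Set.indicator_nonneg (fun _ _ => zero_le_one) _
      linarith
    · rw [one_sub_residual_sub_betaTail_coe_succ hγ]
      obtain ⟨r, hr⟩ := exists_pick_ne hd a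
      -- Positive remaining measure at the end implies the same in every earlier round, and then a
      -- zero bid scans nothing.
      have hlarge : ∀ i ∈ semiRounds I d a y, I.budget a / 2 < I.bid i a := fun i hi => by
        refine (hL i a).resolve_left fun h0 => ?_
        have hempty : subsetAt I d i a = ∅ :=
          (stateAt_isRegular hL d i a).subset_eq_empty h0 (hpos.trans_le
            (measureReal_mono (antitone_stateAt_remaining I d a i.2.le)
              (volume_ne_top_of_subset_Ico (State.remaining_subset_Ico _ _ _))))
        have := (mem_semiRounds.1 hi).2
        rw [hempty] at this
        exact this
      have h1 := lawMean_bitsIndicator_semiRounds_le hL hd hK hlarge hr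
      have h2 := lawMean_mono (I := I) (d := d) (m := n)
        fun ω => one_sub_bitsIndicator_le (I := I) (y := y) ω hr
      have h3 : lawMean I d n (fun ω => 1 - bitsIndicator (semiRounds I d a y) r ω) =
          1 - lawMean I d n (bitsIndicator (semiRounds I d a y) r) := by
        unfold lawMean
        rw [pmfMean_sub, pmfMean_const]
      linarith

/-- The expected measure of the won points is the integral of the pointwise winning probabilities,
and this measure is a lower bound for the payment. -/
theorem primalValue_le_lawMean (hL : I.LargeBids)
    (hd : ∀ i a₁ a₂, d i = .rand a₁ a₂ → a₁ ≠ a₂) (a : A) :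
    primalValue 0.05144 I d a ≤
      lawMean I d n fun ω => I.payment a (wonRounds d a ω) := by
  have hγ0 : (0 : ℝ) ≤ 0.05144 := by norm_num
  have hγ1 : (0.05144 : ℝ) ≤ 1 := by norm_num
  have hm := (stateAt_isRegular hL d n a).measurable
  have hint : ∀ ω, IntegrableOn ((wonPoints I d a ω).indicator fun _ => (1 : ℝ))
      (Set.Ico 0 (I.budget a)) := fun ω =>
    (integrableOn_const measure_Ico_lt_top.ne).indicator (measurableSet_wonPoints hL d a ω)
  have h1 : IntegrableOn (fun y => lawMean I d n fun ω =>
      (wonPoints I d a ω).indicator (fun _ => (1 : ℝ)) y) (Set.Ico 0 (I.budget a)) :=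
    integrable_finsetSum _ fun ω _ => (hint ω).const_mul _
  have h2 : IntegrableOn (fun y => 1 - residual 0.05144 ((stateAt I d n).k a y) -
      betaTail 0.05144 ((stateAt I d n).k a y)) (Set.Ico 0 (I.budget a)) :=
    ((integrableOn_const measure_Ico_lt_top.ne).sub
      (integrableOn_residual hγ0 hγ1 hm subset_rfl)).sub
      (integrableOn_betaTail hγ0 hγ1 hm subset_rfl)
  have h3 : ∫ y in Set.Ico 0 (I.budget a), (lawMean I d n fun ω =>
      (wonPoints I d a ω).indicator (fun _ => (1 : ℝ)) y) =
      lawMean I d n fun ω => volume.real (wonPoints I d a ω) := by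
    unfold lawMean pmfMean
    rw [integral_finsetSum _ fun ω _ => (hint ω).const_mul _]
    refine Finset.sum_congr rfl fun ω _ => ?_
    rw [integral_const_mul, setIntegral_indicator (measurableSet_wonPoints hL d a ω),
      Set.inter_eq_self_of_subset_right (wonPoints_subset_Ico I d a ω), setIntegral_const,
      smul_eq_mul, mul_one]
  calc primalValue 0.05144 I d a ≤ ∫ y in Set.Ico 0 (I.budget a), (lawMean I d n fun ω =>
        (wonPoints I d a ω).indicator (fun _ => (1 : ℝ)) y) :=
        integral_mono_ae h2 h1 ((ae_k_eq_top_or I d a).mono fun y hy =>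
          le_lawMean_indicator hL hd hy)
    _ = lawMean I d n fun ω => volume.real (wonPoints I d a ω) := h3
    _ ≤ _ := lawMean_mono fun ω => volume_real_wonPoints_le hL d a ω

theorem expectedObjective_eq (I : AdWords A n) (d : Fin n → Decision A) :
    I.expectedObjective senderProb senderProb_le_one d =
      ∑ a, lawMean I d n fun ω => I.payment a (wonRounds d a ω) := by
  rw [← lawMean_sum]
  rfl

end AdWords
end

/-! ### The competitive ratio -/

theorem mainTheorem2 (γ Γ : ℝ) (hγ : γ = 0.05144) (hΓ : Γ = (3 + 2 * γ) / (6 + 3 * γ)) :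
    Γ > 0.5041 ∧
    ∀ (A : Type*) [Fintype A] [Nonempty A] (n : ℕ) (I : AdWords A n), I.LargeBids →
      (∃ d, AdWords.IsBasicRun γ I d) ∧
      ∀ d, AdWords.IsBasicRun γ I d →
        I.expectedObjective AdWords.senderProb AdWords.senderProb_le_one d ≥ Γ * I.opt := by
  subst hΓ
  subst hγ
  refine ⟨by norm_num, fun A _ _ n I hL => ⟨AdWords.exists_isBasicRun _ I, fun d hd => ?_⟩⟩
  rw [AdWords.expectedObjective_eq]
  exact (AdWords.mul_opt_le (by norm_num) (by norm_num) hL hd).trans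
    (Finset.sum_le_sum fun a _ => AdWords.primalValue_le_lawMean hL (fun _ _ _ h => hd.ne h) a)
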